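/- **Formulas and derivations.** Fix a set of atoms. Formulas are built from atoms $a$, negated atoms $a^\perp$ and the units $1,\bot$ by $\otimes$ and $⅋$. Negation is the involution with $(a)^\perp=a^\perp$, $1^\perp=\bot$, $(A\otimes B)^\perp=B^\perp ⅋ A^\perp$, $(A⅋ B)^\perp=B^\perp\otimes A^\perp$. Sequents $\vdash\Gamma$ are finite lists of formulas. $MLL_u$ derivations are built from the rules: $Ax$: $\vdash A,A^\perp$; $Cut$: from $\vdash\Gamma,A$ and $\vdash A^\perp,\Delta$ infer $\vdash\Gamma,\Delta$; $\otimes$: from $\vdash\Gamma,A$ and $\vdash B,\Delta$ infer $\vdash\Gamma,A\otimes B,\Delta$; $⅋$: from $\vdash\Gamma,A,B$ infer $\vdash\Gamma,A⅋ B$; $1$: $\vdash 1$; $\bot$: from $\vdash\Gamma$ infer $\vdash\Gamma,\bot$; exchange: from $\vdash\Gamma$ infer $\vdash\sigma(\Gamma)$ for a permutation $\sigma$ of the positions. A cut-elimination step $d\to\hat d$ is the usual one, applied anywhere in a derivation, exchange rules being allowed between the cut and the rules which introduce its active formulas: a cut against an axiom is erased; a cut $\otimes/⅋$ (on $A\otimes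 B$) or $⅋/\otimes$ (on $A⅋ B$) is replaced by two cuts, on the immediate subformulas (for $\otimes/⅋$ the cut on $B$ comes first, for $⅋/\otimes$ the cut on $A$); a cut of $\bot$ against $1$ is erased. **Diagrams.** Strings are labelled by the formulas and two further symbols $L,R$. Write $\vec\Gamma=L,\Gamma,R$. The gates are $$\otimes:A,R,L,B\to A\otimes B,\quad ⅋:A,B\to A⅋ B,\quad Ax_A:\emptyset\to L,A,A^\perp,R,\quad Cut_A:A,R,L,A^\perp\to\emptyset,$$ $$\times:A,B\to B,A,\quad 1:\emptyset\to L,1,R,\quad \bot:\emptyset\to\bot,\quad B_{W,W'}:L,W,R,L,W',R\to L,W',R,L,W,R,$$ where $W,W'$ are words in the formulas and the block $R,L$. The gates other than the $B_{W,W'}$ are called control gates. Diagrams are the morphisms of the free strict monoidal category on these gates. $\langle Sem(MLL_u)\rangle$ is the quotient of that category by the congruence (for both compositions) generated by the following relations. 1. *Control relations.* $\times\circ\times=\mathrm{id}$; the Yang–Baxter relation; a gate $⅋$ or $\bot$ slides through a crossing with a string, on either side; $Ax_A$ followed by the crossing of its two formulas is $Ax_{A^\perp}$. Oriented as $\times\circ\times\to\mathrm{id}$,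 Yang–Baxter from $(\times_{AB}\,C),(B\,\times_{AC}),(\times_{BC}\,A)$ to $(A\,\times_{BC}),(\times_{AC}\,B),(C\,\times_{AB})$ (from top to bottom), gate first and crossing second replaced by crossing first and gate second, and $Ax_A$ followed by the crossing replaced by $Ax_{A^\perp}$, they are rewriting rules; a diagram of control gates is *irreducible* if none of these rules applies to it. 2. *Introduction of $B$.* Let $\alpha:A,R,L,B\to a$ and $\beta:A',R,L,C\to b$ each be a $\otimes$ or a $Cut$ gate (so $a$, $b$ are words of length one or zero). Let $\varphi_0:\emptyset\to L,\Gamma,G_2,M,G_3,R$, let $N':M\to A$ and $N:G_2,G_3\to A'$ consist of gates $\times,⅋,\bot$, and let $\varphi:\emptyset\to L,\Gamma,G_2,G_3,A,R$ be $\varphi_0$ followed by the crossing of $M$ with $G_3$ and by $N'$. Let $\varphi_1:\emptyset\to L,B,\Delta,R$ and $\varphi_2:\emptyset\to L,C,S,R$. Suppose that $\varphi,\varphi_1,\varphi_2,N,N'$ are irreducible. The juxtaposition $\varphi*\varphi_1*\varphi_2$, followed by $\alpha$, the crossing of $G_2,G_3$ with $a,\Delta$, the gate sequence $N$ and $\beta$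 (a diagram $\emptyset\to L,\Gamma,a,\Delta,b,S,R$), equals $\varphi*\varphi_1*\varphi_2$, followed by the crossing of $G_2,G_3$ with $A$, the gate $B$ which exchanges $\vec{B,\Delta}$ and $\vec{C,S}$, then $N$, $\beta$, the crossings to $\Gamma,S,b,A$, then $\alpha$, and the crossings to $\Gamma,a,\Delta,b,S$. The mirror image relation is also imposed. 3. *Untangle relations.* A control gate which acts inside one of the two sheaves $L,W,R$, turning it into a sheaf $L,W_1,R$, slides through $B$; if the gate has no inputs and creates the whole sheaf, then no $B$ remains beneath it. 4. *Cut relations.* (i) $Ax_A$ with $Cut_{A^\perp}$ on its second formula is $\mathrm{id}_{L,A}$, and $Ax_{A^\perp}$ with $Cut_A$ on its first formula is $\mathrm{id}_{A,R}$. (ii) On inputs $A,R,L,B,\Gamma,R,L,B^\perp,A^\perp$: $\otimes$, the crossing of $A\otimes B$ with $\Gamma$, $⅋$ and $Cut_{A\otimes B}$ compose to the same diagram as the crossing of $B$ with $\Gamma$, $Cut_B$, the crossing of $\Gamma$ with $A^\perp$, and $Cut_A$. (iii) On inputs $A,B,R,L,\Gamma,B^\perp,R,L,A^\perp$: $⅋$,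 $\otimes$, the crossing of $\Gamma$ with $B^\perp\otimes A^\perp$ and $Cut_{A⅋ B}$ compose to the same diagram as the crossing of $\Gamma$ with $B^\perp$, $Cut_B$, the crossing of $A$ with $\Gamma$, and $Cut_A$. (iv) On input $R$: $\bot$, $1$ and $Cut_\bot$ compose to $\mathrm{id}_R$. On input $L$: $1$, $\bot$ and $Cut_1$ compose to $\mathrm{id}_L$. **Representation.** A diagram $\varphi:\emptyset\to L,\Gamma,R$ *represents* a derivation $d$ of $\vdash\Gamma$ if it is obtained by induction on $d$, as follows. The rules $Ax$ and $1$ are represented by their gates. The rules $⅋$ and $\bot$ add their gate beneath a representation of the premise. The exchange rule adds any diagram of crossings which realizes its permutation. For $\otimes$ and $Cut$, representations $\varphi:\emptyset\to L,\Gamma,A,R$ and $\psi:\emptyset\to L,B,\Delta,R$ of the premises ($B=A^\perp$ for $Cut$) are put side by side, and the gate is added beneath. For any factorizations $\varphi=\varphi_2'\circ\varphi_2$ and $\psi=\varphi_1'\circ\varphi_1$ through sheaves $L,W_2,R$ and $L,W_1,R$, one may instead add the gate beneath $(\varphi_2'*\varphi_1')\circ B_{W_1,W_2}\circ(\varphi_1*\varphi_2)$.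 **Theorem (Proof diagram semantics).** Every $MLL_u$ derivation $d$ of $\vdash\Gamma$ is represented by some diagram, and all diagrams that represent $d$ have the same class in $\langle Sem(MLL_u)\rangle$. Hence there is exactly one map $[-]_D$ which sends each derivation $d$ of $\vdash\Gamma$ to a morphism $[d]_D:\emptyset\to L,\Gamma,R$ of $\langle Sem(MLL_u)\rangle$ such that $[d]_D=[\varphi]$ for every diagram $\varphi$ that represents $d$. This map is a denotational semantics of the $MLL_u$ sequent calculus: 1. (invariance) if $d\to\hat d$ is a cut-elimination step, then $[d]_D=[\hat d]_D$; 2. (non-degeneracy) there are a formula $A$ and two derivations $d,d'$ of $\vdash A$ with $[d]_D\neq[d']_D$; 3. (congruence) if the same inference rule (cut, $\otimes$, $⅋$, $\bot$ or exchange) is applied to premises which have pairwise the same image under $[-]_D$, then the conclusions have the same image. -/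

import Mathlib

open CategoryTheory

universe u

namespace ProofDiagrams

/-! ## Formulas of multiplicative linear logic with units, in negation normal form -/

inductive Formula (Atom : Type u) : Type u
  | atom (a : Atom)
  | natom (a : Atom)
  | one
  | bot
  | tensor (A B : Formula Atom)
  | par (A B : Formula Atom)

/-- Linear negation. It reverses the order of the two components:
`(A ⊗ B)^⊥ = B^⊥ ⅋ A^⊥` and `(A ⅋ B)^⊥ = B^⊥ ⊗ A^⊥`. -/
def Formula.neg {Atom : Type u} : Formula Atom → Formula Atom
  | .atom a => .natom a
  | .natom a => .atom a
  | .one => .bot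
  | .bot => .one
  | .tensor A B => .par B.neg A.neg
  | .par A B => .tensor B.neg A.neg

theorem Formula.neg_neg {Atom : Type u} (A : Formula Atom) : A.neg.neg = A := by
  induction A with
  | atom a => rfl
  | natom a => rfl
  | one => rfl
  | bot => rfl
  | tensor A B hA hB => simp [Formula.neg, hA, hB]
  | par A B hA hB => simp [Formula.neg, hA, hB]

/-! ## Permutations of lists of formulas -/

/-- `Exch Γ Δ` is a permutation `σ` of positions such that `Δ` is the list
`Γ_{σ(1)}, …, Γ_{σ(k)}`. -/
@[ext]
structure Exch {Atom : Type u} (Γ Δ : List (Formula Atom)) : Type where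
  toEquiv : Fin Δ.length ≃ Fin Γ.length
  get_eq : ∀ i, Δ.get i = Γ.get (toEquiv i)

namespace Exch

variable {Atom : Type u}

def refl (Γ : List (Formula Atom)) : Exch Γ Γ where
  toEquiv := Equiv.refl _
  get_eq _ := rfl

/-- First the permutation `σ`, then the permutation `τ`. -/
def trans {Γ Δ Θ : List (Formula Atom)} (σ : Exch Γ Δ) (τ : Exch Δ Θ) : Exch Γ Θ where
  toEquiv := τ.toEquiv.trans σ.toEquiv
  get_eq i := by rw [τ.get_eq, σ.get_eq]; rfl

/-- The trivial permutation between two lists that are equal. -/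
def ofEq {Γ Δ : List (Formula Atom)} (h : Γ = Δ) : Exch Γ Δ where
  toEquiv := finCongr (by rw [h])
  get_eq i := by subst h; rfl

/-- Positions of `Γ ++ Δ` are positions of `Γ` followed by positions of `Δ`. -/
def appendPos (Γ Δ : List (Formula Atom)) :
    Fin Γ.length ⊕ Fin Δ.length ≃ Fin (Γ ++ Δ).length :=
  finSumFinEquiv.trans (finCongr List.length_append.symm)

theorem get_appendPos_inl (Γ Δ : List (Formula Atom)) (i : Fin Γ.length) :
    (Γ ++ Δ).get (appendPos Γ Δ (Sum.inl i)) = Γ.get i := by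
  simp [appendPos]

theorem get_appendPos_inr (Γ Δ : List (Formula Atom)) (i : Fin Δ.length) :
    (Γ ++ Δ).get (appendPos Γ Δ (Sum.inr i)) = Δ.get i := by
  simp [appendPos]

/-- Two permutations side by side. -/
def append {Γ Γ' Δ Δ' : List (Formula Atom)} (σ : Exch Γ Γ') (τ : Exch Δ Δ') :
    Exch (Γ ++ Δ) (Γ' ++ Δ') where
  toEquiv := (appendPos Γ' Δ').symm.trans
    ((Equiv.sumCongr σ.toEquiv τ.toEquiv).trans (appendPos Γ Δ))
  get_eq i := by
    obtain ⟨j, rfl⟩ := (appendPos Γ' Δ').surjective i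
    rcases j with j | j
    · simp only [Equiv.trans_apply, Equiv.symm_apply_apply, Equiv.sumCongr_apply, Sum.map_inl,
        get_appendPos_inl, σ.get_eq]
    · simp only [Equiv.trans_apply, Equiv.symm_apply_apply, Equiv.sumCongr_apply, Sum.map_inr,
        get_appendPos_inr, τ.get_eq]

/-- The exchange of two consecutive blocks. -/
def comm (Γ Δ : List (Formula Atom)) : Exch (Γ ++ Δ) (Δ ++ Γ) where
  toEquiv := (appendPos Δ Γ).symm.trans ((Equiv.sumComm _ _).trans (appendPos Γ Δ))
  get_eq i := by
    obtain ⟨j, rfl⟩ := (appendPos Δ Γ).surjective i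
    rcases j with j | j
    · simp only [Equiv.trans_apply, Equiv.symm_apply_apply, Equiv.sumComm_apply, Sum.swap_inl,
        get_appendPos_inl, get_appendPos_inr]
    · simp only [Equiv.trans_apply, Equiv.symm_apply_apply, Equiv.sumComm_apply, Sum.swap_inr,
        get_appendPos_inl, get_appendPos_inr]

def assoc (Γ Δ Θ : List (Formula Atom)) : Exch ((Γ ++ Δ) ++ Θ) (Γ ++ (Δ ++ Θ)) :=
  ofEq (List.append_assoc Γ Δ Θ)

def assocInv (Γ Δ Θ : List (Formula Atom)) : Exch (Γ ++ (Δ ++ Θ)) ((Γ ++ Δ) ++ Θ) :=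
  ofEq (List.append_assoc Γ Δ Θ).symm

/-- The transposition of two neighbouring formulas. -/
def adjacent (Γ : List (Formula Atom)) (A B : Formula Atom) (Δ : List (Formula Atom)) :
    Exch (Γ ++ A :: B :: Δ) (Γ ++ B :: A :: Δ) :=
  (refl Γ).append ((comm [A] [B]).append (refl Δ))

end Exch

/-! ## The sequent calculus -/

/-- Derivations of the one-sided sequent calculus, with explicit exchange.
The side conditions `B = A.neg` only spare the transport along `A.neg.neg = A`. -/
inductive Derivation {Atom : Type u} : List (Formula Atom) → Type u
  | ax (A B : Formula Atom) (h : B = A.neg) : Derivation [A, B]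
  | cut {Γ Δ : List (Formula Atom)} (A B : Formula Atom) (h : B = A.neg)
      (d : Derivation (Γ ++ [A])) (e : Derivation (B :: Δ)) : Derivation (Γ ++ Δ)
  | tensor {Γ Δ : List (Formula Atom)} (A B : Formula Atom)
      (d : Derivation (Γ ++ [A])) (e : Derivation (B :: Δ)) :
      Derivation (Γ ++ Formula.tensor A B :: Δ)
  | par {Γ : List (Formula Atom)} (A B : Formula Atom)
      (d : Derivation (Γ ++ [A, B])) : Derivation (Γ ++ [Formula.par A B])
  | bot {Γ : List (Formula Atom)} (d : Derivation Γ) : Derivation (Γ ++ [Formula.bot])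
  | one : Derivation [Formula.one]
  | exch {Γ Δ : List (Formula Atom)} (σ : Exch Γ Δ) (d : Derivation Γ) : Derivation Δ

/-- `ExchOf σ d e`: the derivation `e` is `d` followed by finitely many (possibly no) exchange
rules whose composite is the permutation `σ`. -/
inductive ExchOf {Atom : Type u} : {Γ Δ : List (Formula Atom)} →
    Exch Γ Δ → Derivation Γ → Derivation Δ → Prop
  | refl {Γ : List (Formula Atom)} (d : Derivation Γ) : ExchOf (Exch.refl Γ) d d
  | step {Γ Δ Θ : List (Formula Atom)} {σ : Exch Γ Δ} {d : Derivation Γ} {e : Derivation Δ}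
      (τ : Exch Δ Θ) (h : ExchOf σ d e) : ExchOf (σ.trans τ) d (Derivation.exch τ e)

/-- One step of cut elimination. As the sequents of the usual presentation are read up to
reordering, exchange rules may stand between a cut and the rules that introduce its active
formulas; they are recorded by the permutations `ρ` and `ρ'` of the side formulas. -/
inductive CutStep {Atom : Type u} : {Γ : List (Formula Atom)} →
    Derivation Γ → Derivation Γ → Prop
  /-- the right premise of the cut is an axiom -/
  | ax_right {Γ : List (Formula Atom)} (A B : Formula Atom) (h : B = A.neg)
      (d : Derivation (Γ ++ [A])) (X Y : Formula Atom) (hX : Y = X.neg)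
      (σ : Exch [X, Y] [B, A]) (e : Derivation [B, A])
      (he : ExchOf σ (Derivation.ax X Y hX) e) :
      CutStep (Derivation.cut (Γ := Γ) (Δ := [A]) A B h d e) d
  /-- the left premise of the cut is an axiom -/
  | ax_left {Δ : List (Formula Atom)} (A B : Formula Atom) (h : B = A.neg)
      (d : Derivation (B :: Δ)) (X Y : Formula Atom) (hX : Y = X.neg)
      (σ : Exch [X, Y] [B, A]) (e : Derivation [B, A])
      (he : ExchOf σ (Derivation.ax X Y hX) e) :
      CutStep (Derivation.cut (Γ := [B]) (Δ := Δ) A B h e d) d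
  /-- `⊗` against `⅋`: from `⊢ Γ, A`, `⊢ B, Δ` and `⊢ Ξ, B^⊥, A^⊥`, the cut on `A ⊗ B` becomes a
  cut on `B` of the last two, followed by a cut on `A` with the first -/
  | tensor_par {Γ Δ Ξ Θ Θ' : List (Formula Atom)} (A B A' B' : Formula Atom)
      (hA : A' = A.neg) (hB : B' = B.neg)
      (h : Formula.par B' A' = (Formula.tensor A B).neg)
      (d₁ : Derivation (Γ ++ [A])) (d₂ : Derivation (B :: Δ)) (d₃ : Derivation (Ξ ++ [B', A']))
      (ρ : Exch (Γ ++ Δ) Θ) (ρ' : Exch Ξ Θ')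
      (e₁ : Derivation (Θ ++ [Formula.tensor A B])) (e₂ : Derivation (Formula.par B' A' :: Θ'))
      (he₁ : ExchOf
        ((((Exch.refl Γ).append (Exch.comm [Formula.tensor A B] Δ)).trans
          (Exch.assocInv Γ Δ [Formula.tensor A B])).trans
          (ρ.append (Exch.refl [Formula.tensor A B])))
        (Derivation.tensor A B d₁ d₂) e₁)
      (he₂ : ExchOf
        ((Exch.comm Ξ [Formula.par B' A']).trans ((Exch.refl [Formula.par B' A']).append ρ'))
        (Derivation.par B' A' d₃) e₂)
      (f₂ : Derivation (Δ ++ [B])) (hf₂ : ExchOf (Exch.comm [B] Δ) d₂ f₂)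
      (f₃ : Derivation (B' :: A' :: Ξ)) (hf₃ : ExchOf (Exch.comm Ξ [B', A']) d₃ f₃)
      (g : Derivation (A' :: (Δ ++ Ξ)))
      (hg : ExchOf
        (((Exch.assocInv Δ [A'] Ξ).trans ((Exch.comm Δ [A']).append (Exch.refl Ξ))).trans
          (Exch.assoc [A'] Δ Ξ))
        (Derivation.cut (Γ := Δ) (Δ := A' :: Ξ) B B' hB f₂ f₃) g)
      (t : Derivation (Θ ++ Θ'))
      (ht : ExchOf ((Exch.assocInv Γ Δ Ξ).trans (ρ.append ρ'))
        (Derivation.cut (Γ := Γ) (Δ := Δ ++ Ξ) A A' hA d₁ g) t) :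
      CutStep (Derivation.cut (Formula.tensor A B) (Formula.par B' A') h e₁ e₂) t
  /-- `⅋` against `⊗`: from `⊢ Γ, A, B`, `⊢ Δ, B^⊥` and `⊢ A^⊥, Ξ`, the cut on `A ⅋ B` becomes a
  cut on `A` of the first with the last, followed by a cut on `B` with the second -/
  | par_tensor {Γ Δ Ξ Θ Θ' : List (Formula Atom)} (A B A' B' : Formula Atom)
      (hA : A' = A.neg) (hB : B' = B.neg)
      (h : Formula.tensor B' A' = (Formula.par A B).neg)
      (d₁ : Derivation (Γ ++ [A, B])) (d₂ : Derivation (Δ ++ [B'])) (d₃ : Derivation (A' :: Ξ))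
      (ρ : Exch Γ Θ) (ρ' : Exch (Δ ++ Ξ) Θ')
      (e₁ : Derivation (Θ ++ [Formula.par A B])) (e₂ : Derivation (Formula.tensor B' A' :: Θ'))
      (he₁ : ExchOf (ρ.append (Exch.refl [Formula.par A B])) (Derivation.par A B d₁) e₁)
      (he₂ : ExchOf
        ((((Exch.assocInv Δ [Formula.tensor B' A'] Ξ).trans
          ((Exch.comm Δ [Formula.tensor B' A']).append (Exch.refl Ξ))).trans
          (Exch.assoc [Formula.tensor B' A'] Δ Ξ)).trans
          ((Exch.refl [Formula.tensor B' A']).append ρ'))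
        (Derivation.tensor B' A' d₂ d₃) e₂)
      (f₁ : Derivation ((Γ ++ [B]) ++ [A]))
      (hf₁ : ExchOf
        (((Exch.refl Γ).append (Exch.comm [A] [B])).trans (Exch.assocInv Γ [B] [A])) d₁ f₁)
      (g : Derivation ((Γ ++ Ξ) ++ [B]))
      (hg : ExchOf
        (((Exch.assoc Γ [B] Ξ).trans ((Exch.refl Γ).append (Exch.comm [B] Ξ))).trans
          (Exch.assocInv Γ Ξ [B]))
        (Derivation.cut (Γ := Γ ++ [B]) (Δ := Ξ) A A' hA f₁ d₃) g)
      (f₂ : Derivation (B' :: Δ)) (hf₂ : ExchOf (Exch.comm Δ [B']) d₂ f₂)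
      (t : Derivation (Θ ++ Θ'))
      (ht : ExchOf
        (((Exch.assoc Γ Ξ Δ).trans ((Exch.refl Γ).append (Exch.comm Ξ Δ))).trans (ρ.append ρ'))
        (Derivation.cut (Γ := Γ ++ Ξ) (Δ := Δ) B B' hB g f₂) t) :
      CutStep (Derivation.cut (Formula.par A B) (Formula.tensor B' A') h e₁ e₂) t
  | bot_one {Γ Θ : List (Formula Atom)} (h : Formula.one = (Formula.bot (Atom := Atom)).neg)
      (d : Derivation Γ) (ρ : Exch Γ Θ)
      (e₁ : Derivation (Θ ++ [Formula.bot])) (e₂ : Derivation [Formula.one])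
      (he₁ : ExchOf (ρ.append (Exch.refl [Formula.bot])) (Derivation.bot d) e₁)
      (he₂ : ExchOf (Exch.refl [Formula.one]) Derivation.one e₂)
      (t : Derivation (Θ ++ []))
      (ht : ExchOf (ρ.trans (Exch.ofEq (List.append_nil Θ).symm)) d t) :
      CutStep (Derivation.cut (Γ := Θ) (Δ := []) Formula.bot Formula.one h e₁ e₂) t
  | one_bot {Γ Θ : List (Formula Atom)} (h : Formula.bot = (Formula.one (Atom := Atom)).neg)
      (d : Derivation Γ) (ρ : Exch Γ Θ)
      (e₁ : Derivation [Formula.one]) (e₂ : Derivation (Formula.bot :: Θ))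
      (he₁ : ExchOf (Exch.refl [Formula.one]) Derivation.one e₁)
      (he₂ : ExchOf ((Exch.comm Γ [Formula.bot]).trans ((Exch.refl [Formula.bot]).append ρ))
        (Derivation.bot d) e₂)
      (t : Derivation Θ) (ht : ExchOf ρ d t) :
      CutStep (Derivation.cut (Γ := []) (Δ := Θ) Formula.one Formula.bot h e₁ e₂) t
  /- closure under contexts -/
  | cut_left {Γ Δ : List (Formula Atom)} (A B : Formula Atom) (h : B = A.neg)
      {d d' : Derivation (Γ ++ [A])} (e : Derivation (B :: Δ)) (hd : CutStep d d') :
      CutStep (Derivation.cut A B h d e) (Derivation.cut A B h d' e)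
  | cut_right {Γ Δ : List (Formula Atom)} (A B : Formula Atom) (h : B = A.neg)
      (d : Derivation (Γ ++ [A])) {e e' : Derivation (B :: Δ)} (he : CutStep e e') :
      CutStep (Derivation.cut A B h d e) (Derivation.cut A B h d e')
  | tensor_left {Γ Δ : List (Formula Atom)} (A B : Formula Atom)
      {d d' : Derivation (Γ ++ [A])} (e : Derivation (B :: Δ)) (hd : CutStep d d') :
      CutStep (Derivation.tensor A B d e) (Derivation.tensor A B d' e)
  | tensor_right {Γ Δ : List (Formula Atom)} (A B : Formula Atom)
      (d : Derivation (Γ ++ [A])) {e e' : Derivation (B :: Δ)} (he : CutStep e e') :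
      CutStep (Derivation.tensor A B d e) (Derivation.tensor A B d e')
  | par {Γ : List (Formula Atom)} (A B : Formula Atom)
      {d d' : Derivation (Γ ++ [A, B])} (hd : CutStep d d') :
      CutStep (Derivation.par A B d) (Derivation.par A B d')
  | bot {Γ : List (Formula Atom)} {d d' : Derivation Γ} (hd : CutStep d d') :
      CutStep (Derivation.bot d) (Derivation.bot d')
  | exch {Γ Δ : List (Formula Atom)} (σ : Exch Γ Δ) {d d' : Derivation Γ} (hd : CutStep d d') :
      CutStep (Derivation.exch σ d) (Derivation.exch σ d')

/-! ## String labels, gates and diagrams -/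

/-- String labels: the formulas and the two control strings `L` and `R`. -/
inductive Label (Atom : Type u) : Type u
  | fm (A : Formula Atom)
  | L
  | R

/-- Words of string labels. -/
abbrev Word (Atom : Type u) : Type u := List (Label Atom)

/-- A list of formulas as a word. -/
def fms {Atom : Type u} (Γ : List (Formula Atom)) : Word Atom := Γ.map Label.fm

/-- The word `L, Γ, R`. -/
def sequent {Atom : Type u} (Γ : List (Formula Atom)) : Word Atom :=
  Label.L :: (fms Γ ++ [Label.R])

/-- The word `L, W, R`, for `W` a word made of formulas (`some A`) and of the block `R, L`
(`none`). -/
def sheaf {Atom : Type u} (W : List (Option (Formula Atom))) : Word Atom :=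
  Label.L :: (W.flatMap (fun o => match o with
    | some A => [Label.fm A]
    | none => [Label.R, Label.L]) ++ [Label.R])

/-- Gates. `big W W'` is the gate that exchanges the sheaves `L, W, R` and `L, W', R`; the other
gates form the signature of the control polygraph. -/
inductive Gate (Atom : Type u) : Type u
  | tensor (A B : Formula Atom)
  | par (A B : Formula Atom)
  | ax (A : Formula Atom)
  | cut (A : Formula Atom)
  | swap (A B : Formula Atom)
  | one
  | bot
  | big (W W' : List (Option (Formula Atom)))

namespace Gate

variable {Atom : Type u}

/-- Inputs of a gate. -/
def src : Gate Atom → Word Atom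
  | tensor A B => [Label.fm A, Label.R, Label.L, Label.fm B]
  | par A B => [Label.fm A, Label.fm B]
  | ax _ => []
  | cut A => [Label.fm A, Label.R, Label.L, Label.fm A.neg]
  | swap A B => [Label.fm A, Label.fm B]
  | one => []
  | bot => []
  | big W W' => sheaf W ++ sheaf W'

/-- Outputs of a gate. -/
def tgt : Gate Atom → Word Atom
  | tensor A B => [Label.fm (Formula.tensor A B)]
  | par A B => [Label.fm (Formula.par A B)]
  | ax A => [Label.L, Label.fm A, Label.fm A.neg, Label.R]
  | cut _ => []
  | swap A B => [Label.fm B, Label.fm A]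
  | one => [Label.L, Label.fm Formula.one, Label.R]
  | bot => [Label.fm Formula.bot]
  | big W W' => sheaf W' ++ sheaf W

/-- The gates of the control polygraph: all gates except the `big` ones. -/
def IsControl : Gate Atom → Prop
  | big _ _ => False
  | _ => True

/-- The gates `swap`, `⅋` and `⊥`. -/
def IsLocal : Gate Atom → Prop
  | swap _ _ => True
  | par _ _ => True
  | bot => True
  | _ => False

end Gate

/-- An elementary diagram `id_left * gate * id_right`. -/
@[ext]
structure Layer (Atom : Type u) : Type u where
  left : Word Atom
  gate : Gate Atom
  right : Word Atom

/-- `IsDiagram w φ w'`: the layers `φ`, from top to bottom, compose to a diagram `w ⇒ w'`. -/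
def IsDiagram {Atom : Type u} : Word Atom → List (Layer Atom) → Word Atom → Prop
  | w, [], w' => w = w'
  | w, a :: φ, w' => w = a.left ++ a.gate.src ++ a.right ∧
      IsDiagram (a.left ++ a.gate.tgt ++ a.right) φ w'

/-- The diagram `id_l * φ * id_r`. -/
def whisk {Atom : Type u} (l r : Word Atom) (φ : List (Layer Atom)) : List (Layer Atom) :=
  φ.map fun a => ⟨l ++ a.left, a.gate, a.right ++ r⟩

/-- The interchange rule: two neighbouring gates with disjoint supports may be applied in either
order. Diagrams of the free strict monoidal category on the gates are lists of layers modulo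
this rule. -/
inductive Interchange {Atom : Type u} : List (Layer Atom) → List (Layer Atom) → Prop
  | mk (p q : List (Layer Atom)) (l x r : Word Atom) (g g' : Gate Atom) :
      Interchange
        (p ++ [⟨l, g, x ++ g'.src ++ r⟩, ⟨l ++ g.tgt ++ x, g', r⟩] ++ q)
        (p ++ [⟨l ++ g.src ++ x, g', r⟩, ⟨l, g, x ++ g'.tgt ++ r⟩] ++ q)

/-- Application of a rewriting rule in a context. -/
inductive Rewrites {Atom : Type u} (Rule : List (Layer Atom) → List (Layer Atom) → Prop) :
    List (Layer Atom) → List (Layer Atom) → Prop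
  | mk (p q : List (Layer Atom)) (l r : Word Atom) (φ ψ : List (Layer Atom)) (h : Rule φ ψ) :
      Rewrites Rule (p ++ whisk l r φ ++ q) (p ++ whisk l r ψ ++ q)

/-! ## The control polygraph -/

/-- The 3-cells of the control polygraph: the twisting relations and the involution rule. -/
inductive ControlRule {Atom : Type u} : List (Layer Atom) → List (Layer Atom) → Prop
  | involution (A B : Formula Atom) :
      ControlRule [⟨[], .swap A B, []⟩, ⟨[], .swap B A, []⟩] []
  | yangBaxter (A B C : Formula Atom) :
      ControlRule
        [⟨[], .swap A B, [.fm C]⟩, ⟨[.fm B], .swap A C, []⟩, ⟨[], .swap B C, [.fm A]⟩]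
        [⟨[.fm A], .swap B C, []⟩, ⟨[], .swap A C, [.fm B]⟩, ⟨[.fm C], .swap A B, []⟩]
  | par_left (A B C : Formula Atom) :
      ControlRule
        [⟨[], .par A B, [.fm C]⟩, ⟨[], .swap (.par A B) C, []⟩]
        [⟨[.fm A], .swap B C, []⟩, ⟨[], .swap A C, [.fm B]⟩, ⟨[.fm C], .par A B, []⟩]
  | par_right (A B C : Formula Atom) :
      ControlRule
        [⟨[.fm A], .par B C, []⟩, ⟨[], .swap A (.par B C), []⟩]
        [⟨[], .swap A B, [.fm C]⟩, ⟨[.fm B], .swap A C, []⟩, ⟨[], .par B C, [.fm A]⟩]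
  | ax (A : Formula Atom) :
      ControlRule
        [⟨[], .ax A, []⟩, ⟨[.L], .swap A A.neg, [.R]⟩]
        [⟨[], .ax A.neg, []⟩]
  | bot_left (A : Formula Atom) :
      ControlRule
        [⟨[], .bot, [.fm A]⟩, ⟨[], .swap .bot A, []⟩]
        [⟨[.fm A], .bot, []⟩]
  | bot_right (A : Formula Atom) :
      ControlRule
        [⟨[.fm A], .bot, []⟩, ⟨[], .swap A .bot, []⟩]
        [⟨[], .bot, [.fm A]⟩]

/-- `φ` is a diagram of the control polygraph to which none of its 3-cells applies. -/
def IrreducibleDiagram {Atom : Type u} (φ : List (Layer Atom)) : Prop :=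
  (∀ a ∈ φ, a.gate.IsControl) ∧
    ∀ ψ ψ', Relation.EqvGen Interchange φ ψ → ¬ Rewrites ControlRule ψ ψ'

/-! ## The polygraph of proof diagrams -/

/-- The diagram `A, Δ ⇒ Δ, A` moving one string to the right. -/
def crossOne {Atom : Type u} (A : Formula Atom) : List (Formula Atom) → List (Layer Atom)
  | [] => []
  | B :: Δ => ⟨[], .swap A B, fms Δ⟩ :: whisk [.fm B] [] (crossOne A Δ)

/-- The diagram `Γ, Δ ⇒ Δ, Γ` crossing two blocks of strings. -/
def cross {Atom : Type u} : List (Formula Atom) → List (Formula Atom) → List (Layer Atom)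
  | [], _ => []
  | A :: Γ, Δ => whisk [.fm A] [] (cross Γ Δ) ++ whisk [] (fms Γ) (crossOne A Δ)

/-- `IsSplit A B α a`: `α` is a splitting gate with inputs `A, R, L, B` and list of outputs `a`. -/
inductive IsSplit {Atom : Type u} :
    Formula Atom → Formula Atom → Gate Atom → List (Formula Atom) → Prop
  | tensor (A B : Formula Atom) : IsSplit A B (.tensor A B) [Formula.tensor A B]
  | cut (A : Formula Atom) : IsSplit A A.neg (.cut A) []

/-- The 3-cells of the polygraph of proof diagrams: those of the control polygraph, the
introduction rules of the `big` gates and the untangle relations. -/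
inductive ProofRule {Atom : Type u} : List (Layer Atom) → List (Layer Atom) → Prop
  | control {φ ψ : List (Layer Atom)} (h : ControlRule φ ψ) : ProofRule φ ψ
  /-- Introduction. The source applies `α` to `φ = N' ∘ (crossing) ∘ φ₀` and `φ₁`, moves the
  strings `G₂, G₃` to the right, joins them by `N` into one string `A'`, and applies `β` to the
  result and `φ₂`. The target crosses `φ₁` and `φ₂` and applies `β` before `α`. -/
  | intro_left (Γ G₂ G₃ M Δ S : List (Formula Atom)) (A B A' C : Formula Atom)
      (α β : Gate Atom) (a b : List (Formula Atom))
      (hα : IsSplit A B α a) (hβ : IsSplit A' C β b)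
      (φ₀ φ φ₁ φ₂ N N' : List (Layer Atom))
      (h₀ : IsDiagram [] φ₀ (sequent (Γ ++ G₂ ++ M ++ G₃)))
      (hN' : IsDiagram (fms M) N' [.fm A]) (lN' : ∀ x ∈ N', x.gate.IsLocal)
      (hφ : φ = φ₀ ++ whisk (.L :: fms (Γ ++ G₂)) [.R] (cross M G₃)
        ++ whisk (.L :: fms (Γ ++ G₂ ++ G₃)) [.R] N')
      (h₁ : IsDiagram [] φ₁ (sequent (B :: Δ)))
      (h₂ : IsDiagram [] φ₂ (sequent (C :: S)))
      (hN : IsDiagram (fms (G₂ ++ G₃)) N [.fm A']) (lN : ∀ x ∈ N, x.gate.IsLocal)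
      (iφ : IrreducibleDiagram φ) (i₁ : IrreducibleDiagram φ₁) (i₂ : IrreducibleDiagram φ₂)
      (iN : IrreducibleDiagram N) (iN' : IrreducibleDiagram N') :
      ProofRule
        (φ ++ whisk (sequent (Γ ++ G₂ ++ G₃ ++ [A])) [] φ₁
          ++ whisk (sequent (Γ ++ G₂ ++ G₃ ++ [A]) ++ sequent (B :: Δ)) [] φ₂
          ++ [⟨.L :: fms (Γ ++ G₂ ++ G₃), α, fms Δ ++ [.R] ++ sequent (C :: S)⟩]
          ++ whisk (.L :: fms Γ) ([.R] ++ sequent (C :: S)) (cross (G₂ ++ G₃) (a ++ Δ))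
          ++ whisk (.L :: fms (Γ ++ a ++ Δ)) ([.R] ++ sequent (C :: S)) N
          ++ [⟨.L :: fms (Γ ++ a ++ Δ), β, fms S ++ [.R]⟩])
        (φ ++ whisk (sequent (Γ ++ G₂ ++ G₃ ++ [A])) [] φ₁
          ++ whisk (sequent (Γ ++ G₂ ++ G₃ ++ [A]) ++ sequent (B :: Δ)) [] φ₂
          ++ whisk (.L :: fms Γ) ([.R] ++ sequent (B :: Δ) ++ sequent (C :: S))
              (cross (G₂ ++ G₃) [A])
          ++ [⟨sequent (Γ ++ [A] ++ G₂ ++ G₃),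
                .big ((B :: Δ).map some) ((C :: S).map some), []⟩]
          ++ whisk (.L :: fms (Γ ++ [A])) ([.R] ++ sequent (C :: S) ++ sequent (B :: Δ)) N
          ++ [⟨.L :: fms (Γ ++ [A]), β, fms S ++ [.R] ++ sequent (B :: Δ)⟩]
          ++ whisk (.L :: fms Γ) ([.R] ++ sequent (B :: Δ)) (cross (A :: b) S)
          ++ whisk (.L :: fms (Γ ++ S)) ([.R] ++ sequent (B :: Δ)) (cross [A] b)
          ++ [⟨.L :: fms (Γ ++ S ++ b), α, fms Δ ++ [.R]⟩]
          ++ whisk (.L :: fms Γ) (fms Δ ++ [.R]) (cross (S ++ b) a)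
          ++ whisk (.L :: fms (Γ ++ a)) [.R] (cross (S ++ b) Δ)
          ++ whisk (.L :: fms (Γ ++ a ++ Δ)) [.R] (cross S b))
  /-- The mirror image of the previous rule. -/
  | intro_right (Γ G₂ G₃ M Δ S : List (Formula Atom)) (A B A' C : Formula Atom)
      (α β : Gate Atom) (a b : List (Formula Atom))
      (hα : IsSplit B A α a) (hβ : IsSplit C A' β b)
      (φ₀ φ φ₁ φ₂ N N' : List (Layer Atom))
      (h₀ : IsDiagram [] φ₀ (sequent (G₂ ++ M ++ G₃ ++ Γ)))
      (hN' : IsDiagram (fms M) N' [.fm A]) (lN' : ∀ x ∈ N', x.gate.IsLocal)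
      (hφ : φ = φ₀ ++ whisk [.L] (fms (G₃ ++ Γ) ++ [.R]) (cross G₂ M)
        ++ whisk [.L] (fms (G₂ ++ G₃ ++ Γ) ++ [.R]) N')
      (h₁ : IsDiagram [] φ₁ (sequent (S ++ [C])))
      (h₂ : IsDiagram [] φ₂ (sequent (Δ ++ [B])))
      (hN : IsDiagram (fms (G₂ ++ G₃)) N [.fm A']) (lN : ∀ x ∈ N, x.gate.IsLocal)
      (iφ : IrreducibleDiagram φ) (i₁ : IrreducibleDiagram φ₁) (i₂ : IrreducibleDiagram φ₂)
      (iN : IrreducibleDiagram N) (iN' : IrreducibleDiagram N') :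
      ProofRule
        (φ₁ ++ whisk (sequent (S ++ [C])) [] φ₂
          ++ whisk (sequent (S ++ [C]) ++ sequent (Δ ++ [B])) [] φ
          ++ [⟨sequent (S ++ [C]) ++ .L :: fms Δ, α, fms (G₂ ++ G₃ ++ Γ) ++ [.R]⟩]
          ++ whisk (sequent (S ++ [C]) ++ [.L]) (fms Γ ++ [.R]) (cross (Δ ++ a) (G₂ ++ G₃))
          ++ whisk (sequent (S ++ [C]) ++ [.L]) (fms (Δ ++ a ++ Γ) ++ [.R]) N
          ++ [⟨.L :: fms S, β, fms (Δ ++ a ++ Γ) ++ [.R]⟩])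
        (φ₁ ++ whisk (sequent (S ++ [C])) [] φ₂
          ++ whisk (sequent (S ++ [C]) ++ sequent (Δ ++ [B])) [] φ
          ++ [⟨[], .big ((S ++ [C]).map some) ((Δ ++ [B]).map some),
                sequent (A :: (G₂ ++ G₃ ++ Γ))⟩]
          ++ whisk (sequent (Δ ++ [B]) ++ sequent (S ++ [C]) ++ [.L]) (fms Γ ++ [.R])
              (cross [A] (G₂ ++ G₃))
          ++ whisk (sequent (Δ ++ [B]) ++ sequent (S ++ [C]) ++ [.L])
              (fms (A :: Γ) ++ [.R]) N
          ++ [⟨sequent (Δ ++ [B]) ++ .L :: fms S, β, fms (A :: Γ) ++ [.R]⟩]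
          ++ whisk (sequent (Δ ++ [B]) ++ [.L]) (fms Γ ++ [.R]) (cross (S ++ b) [A])
          ++ [⟨.L :: fms Δ, α, fms (S ++ b ++ Γ) ++ [.R]⟩]
          ++ whisk [.L] (fms Γ ++ [.R]) (cross (Δ ++ a) (S ++ b)))
  /-- Untangle relation: a gate slides through a `big` gate along its left sheaf. -/
  | untangle_left (g : Gate Atom) (hg : g.IsControl) (l r : Word Atom)
      (W W₁ W' : List (Option (Formula Atom)))
      (hs : l ++ g.src ++ r = sheaf W) (ht : l ++ g.tgt ++ r = sheaf W₁) :
      ProofRule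
        [⟨l, g, r ++ sheaf W'⟩, ⟨[], .big W₁ W', []⟩]
        [⟨[], .big W W', []⟩, ⟨sheaf W' ++ l, g, r⟩]
  /-- The same for a gate without inputs that creates the whole sheaf: below it there is nothing
  left to be crossed. -/
  | untangle_left_new (g : Gate Atom) (hg : g.IsControl)
      (W₁ W' : List (Option (Formula Atom))) (hs : g.src = []) (ht : g.tgt = sheaf W₁) :
      ProofRule
        [⟨[], g, sheaf W'⟩, ⟨[], .big W₁ W', []⟩]
        [⟨sheaf W', g, []⟩]
  | untangle_right (g : Gate Atom) (hg : g.IsControl) (l r : Word Atom)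
      (W W' W₁ : List (Option (Formula Atom)))
      (hs : l ++ g.src ++ r = sheaf W') (ht : l ++ g.tgt ++ r = sheaf W₁) :
      ProofRule
        [⟨sheaf W ++ l, g, r⟩, ⟨[], .big W W₁, []⟩]
        [⟨[], .big W W', []⟩, ⟨l, g, r ++ sheaf W⟩]
  | untangle_right_new (g : Gate Atom) (hg : g.IsControl)
      (W W₁ : List (Option (Formula Atom))) (hs : g.src = []) (ht : g.tgt = sheaf W₁) :
      ProofRule
        [⟨sheaf W, g, []⟩, ⟨[], .big W W₁, []⟩]
        [⟨[], g, sheaf W⟩]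

/-! ## The polygraph of the semantics -/

/-- The 3-cells of the polygraph `Sem(MLLu)`: those of the polygraph of proof diagrams and the
cut-elimination rules. -/
inductive SemRule {Atom : Type u} : List (Layer Atom) → List (Layer Atom) → Prop
  | proof {φ ψ : List (Layer Atom)} (h : ProofRule φ ψ) : SemRule φ ψ
  | ax_left (A : Formula Atom) :
      SemRule
        [⟨[], .ax A, [.L, .fm A]⟩, ⟨[.L, .fm A], .cut A.neg, []⟩]
        []
  | ax_right (A : Formula Atom) :
      SemRule
        [⟨[.fm A, .R], .ax A.neg, []⟩, ⟨[], .cut A, [.fm A, .R]⟩]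
        []
  | tensor_par (A B : Formula Atom) (Γ : List (Formula Atom)) :
      SemRule
        ([⟨[], .tensor A B, fms Γ ++ [.R, .L, .fm B.neg, .fm A.neg]⟩]
          ++ whisk [] [.R, .L, .fm B.neg, .fm A.neg] (crossOne (.tensor A B) Γ)
          ++ [⟨fms Γ ++ [.fm (.tensor A B), .R, .L], .par B.neg A.neg, []⟩,
              ⟨fms Γ, .cut (.tensor A B), []⟩])
        (whisk [.fm A, .R, .L] [.R, .L, .fm B.neg, .fm A.neg] (crossOne B Γ)
          ++ [⟨[.fm A, .R, .L] ++ fms Γ, .cut B, [.fm A.neg]⟩]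
          ++ whisk [.fm A, .R, .L] [] (cross Γ [A.neg])
          ++ [⟨[], .cut A, fms Γ⟩])
  | par_tensor (A B : Formula Atom) (Γ : List (Formula Atom)) :
      SemRule
        ([⟨[.fm A, .fm B, .R, .L] ++ fms Γ, .tensor B.neg A.neg, []⟩,
          ⟨[], .par A B, [.R, .L] ++ fms Γ ++ [.fm (.tensor B.neg A.neg)]⟩]
          ++ whisk [.fm (.par A B), .R, .L] [] (cross Γ [.tensor B.neg A.neg])
          ++ [⟨[], .cut (.par A B), fms Γ⟩])
        (whisk [.fm A, .fm B, .R, .L] [.R, .L, .fm A.neg] (cross Γ [B.neg])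
          ++ [⟨[.fm A], .cut B, fms Γ ++ [.R, .L, .fm A.neg]⟩]
          ++ whisk [] [.R, .L, .fm A.neg] (crossOne A Γ)
          ++ [⟨fms Γ, .cut A, []⟩])
  | bot_one :
      SemRule
        [⟨[], .bot, [.R]⟩, ⟨[.fm .bot, .R], .one, []⟩, ⟨[], .cut .bot, [.R]⟩]
        []
  | one_bot :
      SemRule
        [⟨[], .one, [.L]⟩, ⟨[.L, .fm .one, .R, .L], .bot, []⟩, ⟨[.L], .cut .one, []⟩]
        []

/-! ## The category presented by a set of rules -/

/-- Typed diagrams. -/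
def Diagram {Atom : Type u} (w w' : Word Atom) : Type u :=
  {φ : List (Layer Atom) // IsDiagram w φ w'}

/-- Two diagrams that differ by one interchange or by one application of a rule in a context. -/
def Related {Atom : Type u} (Rule : List (Layer Atom) → List (Layer Atom) → Prop)
    {w w' : Word Atom} (φ ψ : Diagram w w') : Prop :=
  Interchange φ.1 ψ.1 ∨ Rewrites Rule φ.1 ψ.1

/-- Equivalence classes of diagrams modulo interchange and the rules. -/
def PresentedHom {Atom : Type u} (Rule : List (Layer Atom) → List (Layer Atom) → Prop)
    (w w' : Word Atom) : Type u :=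
  Quot (Related Rule (w := w) (w' := w'))

/-- Objects of the category presented by a set of rules: words of string labels. -/
structure Presented {Atom : Type u}
    (Rule : List (Layer Atom) → List (Layer Atom) → Prop) : Type u where
  word : Word Atom

theorem IsDiagram.append {Atom : Type u} {w w' w'' : Word Atom} {φ ψ : List (Layer Atom)}
    (hφ : IsDiagram w φ w') (hψ : IsDiagram w' ψ w'') : IsDiagram w (φ ++ ψ) w'' := by
  induction φ generalizing w with
  | nil =>
    have h : w = w' := hφ
    subst h
    exact hψ
  | cons a φ ih => exact ⟨hφ.1, ih hφ.2⟩

/-- Sequential composition of diagrams. -/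
def Diagram.comp {Atom : Type u} {w w' w'' : Word Atom} (φ : Diagram w w')
    (ψ : Diagram w' w'') : Diagram w w'' :=
  ⟨φ.1 ++ ψ.1, φ.2.append ψ.2⟩

theorem Related.comp_left {Atom : Type u}
    {Rule : List (Layer Atom) → List (Layer Atom) → Prop} {w w' w'' : Word Atom}
    (φ : Diagram w w') {ψ ψ' : Diagram w' w''} (h : Related Rule ψ ψ') :
    Related Rule (φ.comp ψ) (φ.comp ψ') := by
  obtain ⟨x, hx⟩ := ψ
  obtain ⟨x', hx'⟩ := ψ'
  rcases h with h | h
  · refine Or.inl ?_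
    dsimp only [Diagram.comp] at h ⊢
    obtain ⟨p, q, l, y, r, g, g'⟩ := h
    simpa only [List.append_assoc] using Interchange.mk (φ.1 ++ p) q l y r g g'
  · refine Or.inr ?_
    dsimp only [Diagram.comp] at h ⊢
    obtain ⟨p, q, l, r, y, z, h⟩ := h
    simpa only [List.append_assoc] using Rewrites.mk (φ.1 ++ p) q l r y z h

theorem Related.comp_right {Atom : Type u}
    {Rule : List (Layer Atom) → List (Layer Atom) → Prop} {w w' w'' : Word Atom}
    {φ φ' : Diagram w w'} (h : Related Rule φ φ') (ψ : Diagram w' w'') :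
    Related Rule (φ.comp ψ) (φ'.comp ψ) := by
  obtain ⟨x, hx⟩ := φ
  obtain ⟨x', hx'⟩ := φ'
  rcases h with h | h
  · refine Or.inl ?_
    dsimp only [Diagram.comp] at h ⊢
    obtain ⟨p, q, l, y, r, g, g'⟩ := h
    simpa only [List.append_assoc] using Interchange.mk p (q ++ ψ.1) l y r g g'
  · refine Or.inr ?_
    dsimp only [Diagram.comp] at h ⊢
    obtain ⟨p, q, l, r, y, z, h⟩ := h
    simpa only [List.append_assoc] using Rewrites.mk p (q ++ ψ.1) l r y z h

instance {Atom : Type u} (Rule : List (Layer Atom) → List (Layer Atom) → Prop) :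
    Category.{u} (Presented Rule) where
  Hom w w' := PresentedHom Rule w.word w'.word
  id w := Quot.mk _ ⟨[], rfl⟩
  comp f g := Quot.map₂ Diagram.comp (fun φ _ _ h => h.comp_left φ)
    (fun _ _ ψ h => h.comp_right ψ) f g
  id_comp f := by
    obtain ⟨φ, rfl⟩ := Quot.exists_rep f
    rfl
  comp_id f := by
    obtain ⟨φ, rfl⟩ := Quot.exists_rep f
    exact congrArg (Quot.mk _) (Subtype.ext (List.append_nil φ.1))
  assoc f g h := by
    obtain ⟨φ, rfl⟩ := Quot.exists_rep f
    obtain ⟨ψ, rfl⟩ := Quot.exists_rep g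
    obtain ⟨χ, rfl⟩ := Quot.exists_rep h
    exact congrArg (Quot.mk _) (Subtype.ext (List.append_assoc φ.1 ψ.1 χ.1))

/-- The category presented by `Sem(MLLu)`. -/
abbrev SemCategory (Atom : Type u) : Type u := Presented (SemRule (Atom := Atom))

/-- The class of a diagram in the category presented by `Sem(MLLu)`. -/
def semClass {Atom : Type u} {w w' : Word Atom} (φ : Diagram w w') :
    (⟨w⟩ : SemCategory Atom) ⟶ ⟨w'⟩ :=
  Quot.mk _ φ

/-! ## Representation of derivations by proof diagrams -/

/-- `Twisting τ σ`: the diagram `τ` is made of `swap` gates and realizes the permutation `σ`. -/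
inductive Twisting {Atom : Type u} : {Γ Δ : List (Formula Atom)} →
    List (Layer Atom) → Exch Γ Δ → Prop
  | nil (Γ : List (Formula Atom)) : Twisting [] (Exch.refl Γ)
  | snoc {Γ : List (Formula Atom)} (l r : List (Formula Atom)) (A B : Formula Atom)
      {τ : List (Layer Atom)} {σ : Exch Γ (l ++ A :: B :: r)} (h : Twisting τ σ) :
      Twisting (τ ++ [⟨fms l, .swap A B, fms r⟩]) (σ.trans (Exch.adjacent l A B r))

/-- `Represents φ d`: the proof diagram `φ : ∅ ⇒ L, Γ, R` represents the derivation `d` of `Γ`.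
In the two binary rules the diagrams of the premises are put side by side, and a `big` gate may
first permute them. -/
inductive Represents {Atom : Type u} : {Γ : List (Formula Atom)} →
    List (Layer Atom) → Derivation Γ → Prop
  | ax (A B : Formula Atom) (h : B = A.neg) :
      Represents [⟨[], .ax A, []⟩] (Derivation.ax A B h)
  | one : Represents [⟨[], .one, []⟩] Derivation.one
  | par {Γ : List (Formula Atom)} (A B : Formula Atom) {d : Derivation (Γ ++ [A, B])}
      {φ : List (Layer Atom)} (h : Represents φ d) :
      Represents (φ ++ [⟨.L :: fms Γ, .par A B, [.R]⟩]) (Derivation.par A B d)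
  | bot {Γ : List (Formula Atom)} {d : Derivation Γ} {φ : List (Layer Atom)}
      (h : Represents φ d) :
      Represents (φ ++ [⟨.L :: fms Γ, .bot, [.R]⟩]) (Derivation.bot d)
  | exch {Γ Δ : List (Formula Atom)} {d : Derivation Γ} {φ τ : List (Layer Atom)}
      {σ : Exch Γ Δ} (h : Represents φ d) (hτ : Twisting τ σ) :
      Represents (φ ++ whisk [.L] [.R] τ) (Derivation.exch σ d)
  | tensor {Γ Δ : List (Formula Atom)} (A B : Formula Atom) {d : Derivation (Γ ++ [A])}
      {e : Derivation (B :: Δ)} {φ ψ : List (Layer Atom)}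
      (hd : Represents φ d) (he : Represents ψ e) :
      Represents (φ ++ whisk (sequent (Γ ++ [A])) [] ψ
        ++ [⟨.L :: fms Γ, .tensor A B, fms Δ ++ [.R]⟩]) (Derivation.tensor A B d e)
  | cut {Γ Δ : List (Formula Atom)} (A B : Formula Atom) (hB : B = A.neg)
      {d : Derivation (Γ ++ [A])} {e : Derivation (B :: Δ)} {φ ψ : List (Layer Atom)}
      (hd : Represents φ d) (he : Represents ψ e) :
      Represents (φ ++ whisk (sequent (Γ ++ [A])) [] ψ
        ++ [⟨.L :: fms Γ, .cut A, fms Δ ++ [.R]⟩]) (Derivation.cut A B hB d e)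
  | tensor_big {Γ Δ : List (Formula Atom)} (A B : Formula Atom) {d : Derivation (Γ ++ [A])}
      {e : Derivation (B :: Δ)} (W₁ W₂ : List (Option (Formula Atom)))
      {φ₁ φ₁' φ₂ φ₂' : List (Layer Atom)}
      (h₁ : IsDiagram [] φ₁ (sheaf W₁)) (h₁' : IsDiagram (sheaf W₁) φ₁' (sequent (B :: Δ)))
      (h₂ : IsDiagram [] φ₂ (sheaf W₂)) (h₂' : IsDiagram (sheaf W₂) φ₂' (sequent (Γ ++ [A])))
      (hd : Represents (φ₂ ++ φ₂') d) (he : Represents (φ₁ ++ φ₁') e) :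
      Represents (φ₁ ++ whisk (sheaf W₁) [] φ₂ ++ [⟨[], .big W₁ W₂, []⟩]
        ++ whisk [] (sheaf W₁) φ₂' ++ whisk (sequent (Γ ++ [A])) [] φ₁'
        ++ [⟨.L :: fms Γ, .tensor A B, fms Δ ++ [.R]⟩]) (Derivation.tensor A B d e)
  | cut_big {Γ Δ : List (Formula Atom)} (A B : Formula Atom) (hB : B = A.neg)
      {d : Derivation (Γ ++ [A])} {e : Derivation (B :: Δ)}
      (W₁ W₂ : List (Option (Formula Atom))) {φ₁ φ₁' φ₂ φ₂' : List (Layer Atom)}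
      (h₁ : IsDiagram [] φ₁ (sheaf W₁)) (h₁' : IsDiagram (sheaf W₁) φ₁' (sequent (B :: Δ)))
      (h₂ : IsDiagram [] φ₂ (sheaf W₂)) (h₂' : IsDiagram (sheaf W₂) φ₂' (sequent (Γ ++ [A])))
      (hd : Represents (φ₂ ++ φ₂') d) (he : Represents (φ₁ ++ φ₁') e) :
      Represents (φ₁ ++ whisk (sheaf W₁) [] φ₂ ++ [⟨[], .big W₁ W₂, []⟩]
        ++ whisk [] (sheaf W₁) φ₂' ++ whisk (sequent (Γ ++ [A])) [] φ₁'
        ++ [⟨.L :: fms Γ, .cut A, fms Δ ++ [.R]⟩]) (Derivation.cut A B hB d e)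
  /-- diagrams are read up to the interchange rule -/
  | interchange {Γ : List (Formula Atom)} {d : Derivation Γ} {φ ψ : List (Layer Atom)}
      (h : Represents φ d) (hφ : Relation.EqvGen Interchange φ ψ) : Represents ψ d

/-! ## Denotational semantics -/

/-- An assignment of morphisms of the category presented by `Sem(MLLu)` to derivations. -/
abbrev Interpretation (Atom : Type u) : Type u :=
  (Γ : List (Formula Atom)) → Derivation Γ →
    ((⟨[]⟩ : SemCategory Atom) ⟶ ⟨sequent Γ⟩)

/-- `sem` sends a derivation to the class of an arbitrary proof diagram that represents it. -/
def IsDiagramInterpretation {Atom : Type u} (sem : Interpretation Atom) : Prop :=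
  ∀ (Γ : List (Formula Atom)) (d : Derivation Γ),
    (∃ φ : Diagram [] (sequent Γ), Represents φ.1 d) ∧
    ∀ φ : Diagram [] (sequent Γ), Represents φ.1 d → sem Γ d = semClass φ

/-- `sem` is a denotational semantics: the equivalence `sem Γ d = sem Γ d'` of derivations is
invariant under cut elimination, non-degenerate, and a congruence for the inference rules. -/
structure IsDenotationalSemantics {Atom : Type u} (sem : Interpretation Atom) : Prop where
  cut_invariant : ∀ (Γ : List (Formula Atom)) (d d' : Derivation Γ),
    CutStep d d' → sem Γ d = sem Γ d'
  nondegenerate : ∃ (A : Formula Atom) (d d' : Derivation [A]), sem [A] d ≠ sem [A] d'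
  congr_cut : ∀ (Γ Δ : List (Formula Atom)) (A B : Formula Atom) (h : B = A.neg)
    (d d' : Derivation (Γ ++ [A])) (e e' : Derivation (B :: Δ)),
    sem _ d = sem _ d' → sem _ e = sem _ e' →
    sem _ (Derivation.cut A B h d e) = sem _ (Derivation.cut A B h d' e')
  congr_tensor : ∀ (Γ Δ : List (Formula Atom)) (A B : Formula Atom)
    (d d' : Derivation (Γ ++ [A])) (e e' : Derivation (B :: Δ)),
    sem _ d = sem _ d' → sem _ e = sem _ e' →
    sem _ (Derivation.tensor A B d e) = sem _ (Derivation.tensor A B d' e')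
  congr_par : ∀ (Γ : List (Formula Atom)) (A B : Formula Atom)
    (d d' : Derivation (Γ ++ [A, B])), sem _ d = sem _ d' →
    sem _ (Derivation.par A B d) = sem _ (Derivation.par A B d')
  congr_bot : ∀ (Γ : List (Formula Atom)) (d d' : Derivation Γ), sem _ d = sem _ d' →
    sem _ (Derivation.bot d) = sem _ (Derivation.bot d')
  congr_exch : ∀ (Γ Δ : List (Formula Atom)) (σ : Exch Γ Δ) (d d' : Derivation Γ),
    sem _ d = sem _ d' → sem _ (Derivation.exch σ d) = sem _ (Derivation.exch σ d')

end ProofDiagrams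

namespace ProofDiagrams

variable {Atom : Type u}

/-! ## Typing of diagrams -/

/-! A `big` gate only transposes two proofs that do not interact, so it can always be erased. What
remains are ordinary diagrams with crossings, and the cut relations on them follow the
cut-elimination steps.

Uniqueness. Every derivation has a canonical diagram without `big` gates, `Derivation.diagram`, and
`Represents.spec` shows that each diagram representing the derivation equals it. Two choices have to
be neutralized. The first is the choice of crossings for an exchange rule: crossing diagrams with
the same permutation are equal (`Twisting.seq`). This is the coherence theorem for symmetries,
proved on strings with distinct tags by normalizing one string at a time (`Twist.exists_front`). The
second is the use of `big` gates. All words inside a representing diagram are juxtapositions of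
blocks `L, Γ, R`, which a two-state automaton recognizes. The output of a control gate has no block
boundary in its interior, so a diagram without `big` gates that starts from the empty word splits at
every boundary (`Plain.split`). Its gates slide one by one through a `big` gate beneath it, the
lowest first, until the gate that creates the sheaf is reached, and there the `big` gate vanishes
(`Plain.slide`). This gives `Placed.exists_plain` and `seq_big`.

Congruence then costs nothing: the canonical diagram of a conclusion is a composite of those of the
premises with fixed gates.

Invariance. Exchange rules around a cut move beneath it (`seq_joined_exch`), and a `⅋` or `⊥` gate
moves to the front of its sequent by naturality of crossings. Each principal step is then a cut
relation, except for `⅋/⊗`: the relation cuts on `B` first, the step on `A` first. Hence two cuts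
against the same sequent must commute (`seq_cut_cut`). This is an instance of the introduction
relation. Its premises must be irreducible, and irreducible forms exist because the control
rewriting terminates (`exists_irreducible`); the `big` gate which it creates is removed by
`seq_big`.

Non-degeneracy. In a relational model every formula denotes the set of binary trees and negation is
mirror image; `⊗` and `⅋` both form pairs, axioms and cuts are the graph of mirror image, units are
the leaf, and `L`, `R` carry nothing. All relations hold there (`SemRule.sameDen`, `SEq.den_iff`).
On `1 ⅋ ⊥` the axiom produces all pairs of mirror trees, the unit rules only the pair of leaves. -/

theorem isDiagram_append_iff {w w'' : Word Atom} {φ ψ : List (Layer Atom)} :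
    IsDiagram w (φ ++ ψ) w'' ↔ ∃ w', IsDiagram w φ w' ∧ IsDiagram w' ψ w'' := by
  constructor
  · intro h
    induction φ generalizing w with
    | nil => exact ⟨w, rfl, h⟩
    | cons a φ ih =>
      obtain ⟨w', h₁, h₂⟩ := ih h.2
      exact ⟨w', ⟨h.1, h₁⟩, h₂⟩
  · rintro ⟨w', h₁, h₂⟩
    exact h₁.append h₂

theorem isDiagram_singleton {l r : Word Atom} {g : Gate Atom} :
    IsDiagram (l ++ g.src ++ r) [⟨l, g, r⟩] (l ++ g.tgt ++ r) :=
  ⟨rfl, rfl⟩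

@[simp] theorem whisk_nil (l r : Word Atom) : whisk l r [] = [] := rfl

@[simp] theorem whisk_cons (l r : Word Atom) (a : Layer Atom) (φ : List (Layer Atom)) :
    whisk l r (a :: φ) = ⟨l ++ a.left, a.gate, a.right ++ r⟩ :: whisk l r φ := rfl

@[simp] theorem whisk_append (l r : Word Atom) (φ ψ : List (Layer Atom)) :
    whisk l r (φ ++ ψ) = whisk l r φ ++ whisk l r ψ := List.map_append

@[simp] theorem whisk_whisk (l r l' r' : Word Atom) (φ : List (Layer Atom)) :
    whisk l r (whisk l' r' φ) = whisk (l ++ l') (r' ++ r) φ := by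
  simp [whisk]

@[simp] theorem whisk_nil_nil (φ : List (Layer Atom)) : whisk [] [] φ = φ := by
  induction φ with
  | nil => rfl
  | cons a φ ih => simp [ih]

theorem IsDiagram.whisk {u v : Word Atom} {φ : List (Layer Atom)} (h : IsDiagram u φ v)
    (l r : Word Atom) : IsDiagram (l ++ u ++ r) (whisk l r φ) (l ++ v ++ r) := by
  induction φ generalizing u with
  | nil =>
    have h : u = v := h
    subst h
    rfl
  | cons a φ ih =>
    obtain ⟨rfl, h⟩ := h
    have h' := ih h
    simp only [whisk_cons]
    refine ⟨by simp, ?_⟩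
    simpa only [List.append_assoc] using h'

/-- The first layer spells out its whole source word. The empty list of layers is the identity of
every word and has to be excluded. -/
theorem IsDiagram.src_unique {u u' v v' : Word Atom} {φ : List (Layer Atom)} (hφ : φ ≠ [])
    (h : IsDiagram u φ v) (h' : IsDiagram u' φ v') : u = u' := by
  cases φ with
  | nil => exact absurd rfl hφ
  | cons a φ => exact h.1.trans h'.1.symm

theorem IsDiagram.tgt_unique {u v v' : Word Atom} {φ : List (Layer Atom)}
    (h : IsDiagram u φ v) (h' : IsDiagram u φ v') : v = v' := by
  induction φ generalizing u with
  | nil => exact (show u = v from h).symm.trans h'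
  | cons a φ ih => exact ih h.2 h'.2

theorem whisk_eq_nil {l r : Word Atom} {φ : List (Layer Atom)} :
    whisk l r φ = [] ↔ φ = [] := List.map_eq_nil_iff

@[simp] theorem fms_nil : fms ([] : List (Formula Atom)) = [] := rfl

@[simp] theorem fms_cons (A : Formula Atom) (Γ : List (Formula Atom)) :
    fms (A :: Γ) = .fm A :: fms Γ := rfl

@[simp] theorem fms_append (Γ Δ : List (Formula Atom)) : fms (Γ ++ Δ) = fms Γ ++ fms Δ :=
  List.map_append

theorem Interchange.isDiagram_iff {φ ψ : List (Layer Atom)} (h : Interchange φ ψ)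
    {w w' : Word Atom} : IsDiagram w φ w' ↔ IsDiagram w ψ w' := by
  obtain ⟨p, q, l, x, r, g, g'⟩ := h
  simp only [isDiagram_append_iff]
  refine exists_congr fun m => and_congr_left fun _ => exists_congr fun n => and_congr_right
    fun _ => ?_
  simp [IsDiagram]

theorem eqvGen_interchange_isDiagram_iff {φ ψ : List (Layer Atom)}
    (h : Relation.EqvGen Interchange φ ψ) {w w' : Word Atom} :
    IsDiagram w φ w' ↔ IsDiagram w ψ w' := by
  induction h with
  | rel _ _ h => exact h.isDiagram_iff
  | refl => exact Iff.rfl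
  | symm _ _ _ ih => exact ih.symm
  | trans _ _ _ _ _ ih₁ ih₂ => exact ih₁.trans ih₂

/-! ## Equality of diagrams in the presented category -/

theorem Interchange.whisk {φ ψ : List (Layer Atom)} (h : Interchange φ ψ) (l r : Word Atom) :
    Interchange (whisk l r φ) (whisk l r ψ) := by
  obtain ⟨p, q, l', x, r', g, g'⟩ := h
  simpa using Interchange.mk (ProofDiagrams.whisk l r p) (ProofDiagrams.whisk l r q) (l ++ l') x
    (r' ++ r) g g'

theorem Rewrites.whisk {Rule : List (Layer Atom) → List (Layer Atom) → Prop}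
    {φ ψ : List (Layer Atom)} (h : Rewrites Rule φ ψ) (l r : Word Atom) :
    Rewrites Rule (whisk l r φ) (whisk l r ψ) := by
  obtain ⟨p, q, l', r', x, y, h⟩ := h
  simpa using Rewrites.mk (ProofDiagrams.whisk l r p) (ProofDiagrams.whisk l r q) (l ++ l')
    (r' ++ r) x y h

/-- The diagram `id_l * φ * id_r`, with its typing. -/
def Diagram.whisk {u v : Word Atom} (l r : Word Atom) (φ : Diagram u v) :
    Diagram (l ++ u ++ r) (l ++ v ++ r) :=
  ⟨ProofDiagrams.whisk l r φ.1, φ.2.whisk l r⟩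

theorem Related.whisk {Rule : List (Layer Atom) → List (Layer Atom) → Prop} {u v : Word Atom}
    {φ ψ : Diagram u v} (h : Related Rule φ ψ) (l r : Word Atom) :
    Related Rule (φ.whisk l r) (ψ.whisk l r) :=
  h.imp (fun h => h.whisk l r) fun h => h.whisk l r

/-- `φ` and `ψ` are diagrams `w ⇒ w'` with the same class in the presented category. -/
def SEq (w w' : Word Atom) (φ ψ : List (Layer Atom)) : Prop :=
  ∃ (hφ : IsDiagram w φ w') (hψ : IsDiagram w ψ w'),
    semClass (⟨φ, hφ⟩ : Diagram w w') = semClass ⟨ψ, hψ⟩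

namespace SEq

variable {w w' w'' : Word Atom} {φ ψ χ φ' ψ' : List (Layer Atom)}

theorem left (h : SEq w w' φ ψ) : IsDiagram w φ w' := h.1

theorem right (h : SEq w w' φ ψ) : IsDiagram w ψ w' := h.2.1

theorem refl (h : IsDiagram w φ w') : SEq w w' φ φ := ⟨h, h, rfl⟩

theorem symm (h : SEq w w' φ ψ) : SEq w w' ψ φ := ⟨h.2.1, h.1, h.2.2.symm⟩

theorem trans (h : SEq w w' φ ψ) (h' : SEq w w' ψ χ) : SEq w w' φ χ :=
  ⟨h.1, h'.2.1, h.2.2.trans h'.2.2⟩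

theorem append (h : SEq w w' φ φ') (h' : SEq w' w'' ψ ψ') :
    SEq w w'' (φ ++ ψ) (φ' ++ ψ') := by
  refine ⟨h.left.append h'.left, h.right.append h'.right, ?_⟩
  exact congrArg₂ (fun (f : (⟨w⟩ : SemCategory Atom) ⟶ ⟨w'⟩)
    (g : (⟨w'⟩ : SemCategory Atom) ⟶ ⟨w''⟩) => f ≫ g)
    h.2.2 h'.2.2

theorem whisk (h : SEq w w' φ ψ) (l r : Word Atom) :
    SEq (l ++ w ++ r) (l ++ w' ++ r) (whisk l r φ) (whisk l r ψ) := by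
  refine ⟨h.left.whisk l r, h.right.whisk l r, ?_⟩
  exact congrArg (Quot.map (Diagram.whisk l r) fun _ _ h => h.whisk l r) h.2.2

theorem ctx (h : SEq w w' φ ψ) {a b l r : Word Atom} {p q : List (Layer Atom)}
    (hp : IsDiagram a p (l ++ w ++ r)) (hq : IsDiagram (l ++ w' ++ r) q b) :
    SEq a b (p ++ ProofDiagrams.whisk l r φ ++ q) (p ++ ProofDiagrams.whisk l r ψ ++ q) :=
  ((refl hp).append (h.whisk l r)).append (refl hq)

/-- Replacement in a context whose typing is known from the whole diagram. -/
theorem subst (h : SEq w w' φ ψ) (hφ : φ ≠ []) {a b : Word Atom} (l r : Word Atom)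
    (p q : List (Layer Atom)) (hd : IsDiagram a (p ++ ProofDiagrams.whisk l r φ ++ q) b) :
    SEq a b (p ++ ProofDiagrams.whisk l r φ ++ q) (p ++ ProofDiagrams.whisk l r ψ ++ q) := by
  obtain ⟨m, h₁, hq⟩ := isDiagram_append_iff.1 hd
  obtain ⟨n, hp, h₂⟩ := isDiagram_append_iff.1 h₁
  -- The typing of the whole fixes the words at both ends of the replaced part: its first layer
  -- determines the source, and the source determines the target.
  have e := IsDiagram.src_unique (mt whisk_eq_nil.1 hφ) h₂ (h.left.whisk l r)
  subst e
  have e := IsDiagram.tgt_unique h₂ (h.left.whisk l r)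
  subst e
  exact h.ctx hp hq

theorem of_interchange (h : Interchange φ ψ) (hφ : IsDiagram w φ w') : SEq w w' φ ψ :=
  ⟨hφ, h.isDiagram_iff.1 hφ, Quot.sound (Or.inl h)⟩

theorem of_eqvGen (h : Relation.EqvGen Interchange φ ψ) (hφ : IsDiagram w φ w') :
    SEq w w' φ ψ := by
  induction h with
  | rel _ _ h => exact of_interchange h hφ
  | refl => exact refl hφ
  | symm _ _ h ih => exact (ih ((eqvGen_interchange_isDiagram_iff h).2 hφ)).symm
  | trans _ _ _ h _ ih₁ ih₂ =>
    exact (ih₁ hφ).trans (ih₂ ((eqvGen_interchange_isDiagram_iff h).1 hφ))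

theorem of_rule (h : SemRule φ ψ) (hφ : IsDiagram w φ w') (hψ : IsDiagram w ψ w') :
    SEq w w' φ ψ := by
  refine ⟨hφ, hψ, Quot.sound (Or.inr ?_)⟩
  simpa using Rewrites.mk [] [] [] [] φ ψ h

theorem of_control (h : ControlRule φ ψ) (hφ : IsDiagram w φ w') (hψ : IsDiagram w ψ w') :
    SEq w w' φ ψ :=
  of_rule (.proof (.control h)) hφ hψ

end SEq

/-- The interchange rule exchanges neighbouring layers only, so one gate is lifted past the layers
of `φ` one after the other. -/
theorem seq_interchange_layer {u v : Word Atom} {φ : List (Layer Atom)} (h : IsDiagram u φ v)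
    (g : Gate Atom) (l r x y : Word Atom) :
    SEq (x ++ u ++ (l ++ g.src ++ r) ++ y) (x ++ v ++ (l ++ g.tgt ++ r) ++ y)
      (whisk x (l ++ g.src ++ r ++ y) φ ++ [⟨x ++ v ++ l, g, r ++ y⟩])
      (⟨x ++ u ++ l, g, r ++ y⟩ :: whisk x (l ++ g.tgt ++ r ++ y) φ) := by
  induction φ generalizing u with
  | nil =>
    have h : u = v := h
    subst h
    apply SEq.refl
    simp [IsDiagram]
  | cons a φ ih =>
    obtain ⟨rfl, h⟩ := h
    have h1 := ih h
    have h2 : SEq (x ++ (a.left ++ a.gate.src ++ a.right) ++ (l ++ g.src ++ r) ++ y)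
        (x ++ (a.left ++ a.gate.tgt ++ a.right) ++ (l ++ g.src ++ r) ++ y)
        (whisk x (l ++ g.src ++ r ++ y) [a]) (whisk x (l ++ g.src ++ r ++ y) [a]) := by
      apply SEq.refl
      simp [IsDiagram]
    have h3 := h2.append h1
    refine SEq.trans (ψ := whisk x (l ++ g.src ++ r ++ y) [a] ++
      ⟨x ++ (a.left ++ a.gate.tgt ++ a.right) ++ l, g, r ++ y⟩ ::
        whisk x (l ++ g.tgt ++ r ++ y) φ) (by simpa using h3) ?_
    apply SEq.of_interchange _ (by simpa using h3.right)
    simpa using Interchange.mk [] (whisk x (l ++ g.tgt ++ r ++ y) φ) (x ++ a.left)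
      (a.right ++ l) (r ++ y) a.gate g

/-- Two diagrams side by side may be applied in either order. -/
theorem seq_interchange {u v u' v' : Word Atom} {φ ψ : List (Layer Atom)}
    (hφ : IsDiagram u φ v) (hψ : IsDiagram u' ψ v') :
    SEq (u ++ u') (v ++ v') (whisk [] u' φ ++ whisk v [] ψ) (whisk u [] ψ ++ whisk [] v' φ) := by
  induction ψ generalizing u' with
  | nil =>
    have h : u' = v' := hψ
    subst h
    simpa using SEq.refl (hφ.whisk [] u')
  | cons a ψ ih =>
    obtain ⟨rfl, h⟩ := hψ
    have h1 := ih h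
    have h2 := seq_interchange_layer hφ a.gate a.left a.right [] []
    have h3 : IsDiagram (v ++ (a.left ++ a.gate.tgt ++ a.right)) (whisk v [] ψ) (v ++ v') := by
      simpa using h.whisk v []
    have h4 : IsDiagram (u ++ (a.left ++ a.gate.src ++ a.right))
      (whisk u [] [a]) (u ++ (a.left ++ a.gate.tgt ++ a.right)) := by
      simp [IsDiagram]
    have h5 := h2.append (SEq.refl (by simpa using h3))
    have h6 := (SEq.refl h4).append h1
    refine SEq.trans (by simpa using h5) (by simpa using h6)

/-- Two diagrams side by side, in a context. -/
theorem seq_interchange_whisk {u v u' v' : Word Atom} {φ ψ : List (Layer Atom)}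
    (hφ : IsDiagram u φ v) (hψ : IsDiagram u' ψ v') (l x r : Word Atom) :
    SEq (l ++ u ++ x ++ u' ++ r) (l ++ v ++ x ++ v' ++ r)
      (whisk l (x ++ u' ++ r) φ ++ whisk (l ++ v ++ x) r ψ)
      (whisk (l ++ u ++ x) r ψ ++ whisk l (x ++ v' ++ r) φ) := by
  have h := (seq_interchange (hφ.whisk [] x) hψ).whisk l r
  simpa using h

/-! ## Crossings -/

@[simp] theorem cross_nil_left (Δ : List (Formula Atom)) : cross [] Δ = [] := rfl

@[simp] theorem cross_nil_right (Γ : List (Formula Atom)) : cross Γ [] = [] := by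
  induction Γ with
  | nil => rfl
  | cons A Γ ih => simp [cross, ih, crossOne]

theorem cross_singleton (A : Formula Atom) (Δ : List (Formula Atom)) :
    cross [A] Δ = crossOne A Δ := by
  simp [cross]

/-- `Γ'` stands next to `Δ`, so it has to cross first. -/
theorem cross_append_left (Γ Γ' Δ : List (Formula Atom)) :
    cross (Γ ++ Γ') Δ = whisk (fms Γ) [] (cross Γ' Δ) ++ whisk [] (fms Γ') (cross Γ Δ) := by
  induction Γ with
  | nil => simp
  | cons A Γ ih => simp [cross, ih]

/-! ## Crossing diagrams between lists of tagged formulas -/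

/-- `Twist s τ t`: the diagram `τ`, made of crossings, sends the list `s` of tagged formulas
to `t`. -/
inductive Twist {ι : Type*} :
    List (ι × Formula Atom) → List (Layer Atom) → List (ι × Formula Atom) → Prop
  | nil (s : List (ι × Formula Atom)) : Twist s [] s
  | snoc {s : List (ι × Formula Atom)} {τ : List (Layer Atom)} (l r : List (ι × Formula Atom))
      (x y : ι × Formula Atom) (h : Twist s τ (l ++ x :: y :: r)) :
      Twist s (τ ++ [⟨fms (l.map Prod.snd), .swap x.2 y.2, fms (r.map Prod.snd)⟩])
        (l ++ y :: x :: r)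

namespace Twist

variable {ι : Type*} {s t v : List (ι × Formula Atom)} {τ τ' : List (Layer Atom)}

theorem isDiagram (h : Twist s τ t) :
    IsDiagram (fms (s.map Prod.snd)) τ (fms (t.map Prod.snd)) := by
  induction h with
  | nil => rfl
  | snoc l r x y _ ih =>
    refine ih.append ?_
    simp [IsDiagram, Gate.src, Gate.tgt]

theorem append (h : Twist s τ t) (h' : Twist t τ' v) : Twist s (τ ++ τ') v := by
  induction h' with
  | nil => simpa using h
  | snoc l r x y _ ih =>
    rw [← List.append_assoc]
    exact .snoc l r x y ih

theorem whisk (h : Twist s τ t) (l r : List (ι × Formula Atom)) :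
    Twist (l ++ s ++ r) (whisk (fms (l.map Prod.snd)) (fms (r.map Prod.snd)) τ)
      (l ++ t ++ r) := by
  induction h with
  | nil => exact .nil _
  | snoc l' r' x y _ ih =>
    have := Twist.snoc (l ++ l') (r' ++ r) x y (by simpa using ih)
    simpa using this

theorem single (x y : ι × Formula Atom) : Twist [x, y] [⟨[], .swap x.2 y.2, []⟩] [y, x] := by
  simpa using Twist.snoc [] [] x y (Twist.nil [x, y])

theorem exists_of_perm (h : s.Perm t) : ∃ τ, Twist s τ t := by
  induction h with
  | nil => exact ⟨[], .nil _⟩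
  | cons x _ ih =>
    obtain ⟨τ, h⟩ := ih
    exact ⟨_, by simpa using h.whisk [x] []⟩
  | swap x y l => exact ⟨_, by simpa using (Twist.single y x).whisk [] l⟩
  | trans _ _ ih₁ ih₂ =>
    obtain ⟨τ, h⟩ := ih₁
    obtain ⟨τ', h'⟩ := ih₂
    exact ⟨_, h.append h'⟩

theorem crossOne (x : ι × Formula Atom) (s : List (ι × Formula Atom)) :
    Twist (x :: s) (crossOne x.2 (s.map Prod.snd)) (s ++ [x]) := by
  induction s with
  | nil => exact .nil _
  | cons y s ih =>
    have h₁ := (Twist.single x y).whisk [] s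
    have h₂ := ih.whisk [y] []
    simpa [ProofDiagrams.crossOne] using h₁.append (by simpa using h₂)

theorem cross (s t : List (ι × Formula Atom)) :
    Twist (s ++ t) (cross (s.map Prod.snd) (t.map Prod.snd)) (t ++ s) := by
  induction s with
  | nil => simpa using Twist.nil t
  | cons x s ih =>
    have h₁ := ih.whisk [x] []
    have h₂ := (Twist.crossOne x t).whisk [] s
    simpa [ProofDiagrams.cross] using h₁.append (by simpa using h₂)

end Twist

theorem isDiagram_cross (Γ Δ : List (Formula Atom)) :
    IsDiagram (fms (Γ ++ Δ)) (cross Γ Δ) (fms (Δ ++ Γ)) := by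
  have h := (Twist.cross (Γ.map fun A => ((), A)) (Δ.map fun A => ((), A))).isDiagram
  simpa [Function.comp_def] using h

theorem isDiagram_crossOne (A : Formula Atom) (Δ : List (Formula Atom)) :
    IsDiagram (fms (A :: Δ)) (crossOne A Δ) (fms (Δ ++ [A])) := by
  rw [← cross_singleton]
  exact isDiagram_cross [A] Δ

theorem seq_involution (A B : Formula Atom) :
    SEq [.fm A, .fm B] [.fm A, .fm B] [⟨[], .swap A B, []⟩, ⟨[], .swap B A, []⟩] [] :=
  .of_control (.involution A B) (by simp [IsDiagram, Gate.src, Gate.tgt]) rfl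

/-- A crossing slides through the crossing of a block with a string. -/
theorem seq_swap_cross (p q : List (Formula Atom)) (A B C : Formula Atom) :
    SEq (fms (p ++ A :: B :: q ++ [C])) (fms (C :: (p ++ B :: A :: q)))
      (cross (p ++ A :: B :: q) [C] ++ [⟨fms (C :: p), .swap A B, fms q⟩])
      (⟨fms p, .swap A B, fms (q ++ [C])⟩ :: cross (p ++ B :: A :: q) [C]) := by
  -- The crossing factors through `q`, the two strings, and `p`, in this order. Lifting the gate, it
  -- passes the crossing of `p` by interchange (`h₁`), that of the two strings by Yang–Baxter
  -- (`h₂`), and that of `q` by interchange (`h₃`).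
  have e : ∀ A B : Formula Atom, cross (p ++ A :: B :: q) [C] =
      whisk (fms (p ++ [A, B])) [] (cross q [C]) ++ whisk (fms p) (fms q) (cross [A, B] [C]) ++
        whisk [] (fms (A :: B :: q)) (cross p [C]) := by
    intro A B
    have : p ++ A :: B :: q = p ++ ([A, B] ++ q) := by simp
    rw [this, cross_append_left, cross_append_left]
    simp
  have hs : IsDiagram (fms [A, B]) [⟨[], .swap A B, []⟩] (fms [B, A]) := by
    simp [IsDiagram, Gate.src, Gate.tgt]
  have h₁ := seq_interchange_whisk (isDiagram_cross p [C]) hs [] [] (fms q)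
  have h₂ : SEq (fms [A, B, C]) (fms [C, B, A])
      (cross [A, B] [C] ++ [⟨[.fm C], .swap A B, []⟩])
      (⟨[], .swap A B, [.fm C]⟩ :: cross [B, A] [C]) := by
    refine (SEq.of_control ?_ ?_ ?_).symm
    · simpa [cross, crossOne] using ControlRule.yangBaxter A B C
    · simp [IsDiagram, Gate.src, Gate.tgt, cross, crossOne]
    · simp [IsDiagram, Gate.src, Gate.tgt, cross, crossOne]
  have h₃ := seq_interchange_whisk hs (isDiagram_cross q [C]) (fms p) [] []
  have k₁ := (SEq.refl ((isDiagram_cross q [C]).whisk (fms (p ++ [A, B])) [])).append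
    (SEq.append (w'' := fms (C :: (p ++ B :: A :: q)))
      (SEq.refl (by simpa using (isDiagram_cross [A, B] [C]).whisk (fms p) (fms q)))
      (by simpa using h₁))
  have k₂ := (SEq.refl ((isDiagram_cross q [C]).whisk (fms (p ++ [A, B])) [])).append
    (SEq.append (by simpa using h₂.whisk (fms p) (fms q))
      (SEq.refl (by simpa using (isDiagram_cross p [C]).whisk [] (fms (B :: A :: q)))))
  have k₃ := h₃.symm.append (SEq.append
      (SEq.refl (by simpa using (isDiagram_cross [B, A] [C]).whisk (fms p) (fms q)))
      (SEq.refl (by simpa using (isDiagram_cross p [C]).whisk [] (fms (B :: A :: q)))))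
  rw [e, e]
  refine SEq.trans (by simpa using k₁) (SEq.trans (by simpa using k₂) (by simpa using k₃))

/-- A diagram of crossings slides through the crossing of a block with a string. -/
theorem Twist.seq_cross {ι : Type*} {s t : List (ι × Formula Atom)} {τ : List (Layer Atom)}
    (h : Twist s τ t) (C : Formula Atom) :
    SEq (fms (s.map Prod.snd ++ [C])) (fms (C :: t.map Prod.snd))
      (ProofDiagrams.cross (s.map Prod.snd) [C] ++ ProofDiagrams.whisk [.fm C] [] τ)
      (ProofDiagrams.whisk [] [.fm C] τ ++ ProofDiagrams.cross (t.map Prod.snd) [C]) := by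
  induction h with
  | nil =>
    simpa using SEq.refl (isDiagram_cross (s.map Prod.snd) [C])
  | snoc l r x y h ih =>
    have h₁ := seq_swap_cross (l.map Prod.snd) (r.map Prod.snd) x.2 y.2 C
    have h₂ : SEq (fms (C :: (l ++ x :: y :: r).map Prod.snd))
        (fms (C :: (l ++ y :: x :: r).map Prod.snd)) _ _ :=
      SEq.refl (φ := [⟨.fm C :: fms (l.map Prod.snd), .swap x.2 y.2, fms (r.map Prod.snd)⟩])
        (by simp [IsDiagram, Gate.src, Gate.tgt])
    have h₃ := ih.append h₂
    have h₄ := (SEq.refl (h.isDiagram.whisk [] [.fm C])).append (by simpa using h₁)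
    refine SEq.trans (by simpa using h₃) (by simpa using h₄)

theorem Twist.target_ne_nil {ι : Type*} {s : List (ι × Formula Atom)} {τ : List (Layer Atom)}
    (h : Twist s τ []) : s = [] ∧ τ = [] := by
  generalize ht : ([] : List (ι × Formula Atom)) = t at h
  cases h with
  | nil => exact ⟨rfl, rfl⟩
  | snoc l r x y h => simp at ht

/-- A diagram of crossings may first bring the string that ends up leftmost to the left. -/
theorem Twist.exists_front {ι : Type*} (n : ℕ) :
    ∀ {s t : List (ι × Formula Atom)} {x : ι × Formula Atom} {τ : List (Layer Atom)},
      t.length = n → Twist s τ (x :: t) →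
      ∃ l r τ', s = l ++ x :: r ∧ Twist (l ++ r) τ' t ∧
        SEq (fms (s.map Prod.snd)) (fms ((x :: t).map Prod.snd)) τ
          (ProofDiagrams.whisk [] (fms (r.map Prod.snd))
            (ProofDiagrams.cross (l.map Prod.snd) [x.2]) ++
            ProofDiagrams.whisk [.fm x.2] [] τ') := by
  -- The outer induction is on the number of strings, the inner one on the diagram. A last crossing
  -- away from the leftmost string joins the residual diagram. If it exchanges `a` and `x` at the
  -- left end, the inner hypothesis brings `a` to the front, and the outer one, applied to the
  -- residual diagram with one string fewer, brings `x` to the front of the rest.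
  induction n using Nat.strong_induction_on with
  | _ n ihn =>
  intro s t x τ hn h
  generalize ht : x :: t = t' at h
  induction h generalizing x t with
  | nil =>
    subst ht
    exact ⟨[], t, [], rfl, .nil _, SEq.refl rfl⟩
  | snoc l₀ r₀ a b h ih =>
    rename_i τ
    cases l₀ with
    | cons z l₀ =>
      obtain ⟨rfl, rfl⟩ : x = z ∧ t = l₀ ++ b :: a :: r₀ := by simpa using ht
      obtain ⟨l, r, τ', rfl, h', e⟩ := ih (t := l₀ ++ a :: b :: r₀) (by simpa using hn) rfl
      refine ⟨l, r, _, rfl, .snoc l₀ r₀ a b h', ?_⟩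
      have k : SEq (fms ((x :: (l₀ ++ a :: b :: r₀)).map Prod.snd))
        (fms ((x :: (l₀ ++ b :: a :: r₀)).map Prod.snd)) _ _ :=
        SEq.refl (φ := [⟨fms ((x :: l₀).map Prod.snd), .swap a.2 b.2, fms (r₀.map Prod.snd)⟩])
          (by simp [IsDiagram, Gate.src, Gate.tgt])
      simpa using e.append k
    | nil =>
      obtain ⟨rfl, rfl⟩ : x = b ∧ t = a :: r₀ := by simpa using ht
      obtain ⟨l, r, τ', rfl, h', e⟩ := ih (t := x :: r₀) (x := a) (by simpa using hn) rfl
      obtain ⟨l', r', τ'', e', h'', e''⟩ := ihn r₀.length (by simp at hn; omega) rfl h'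
      have hsw : IsDiagram (fms [a.2, x.2]) [⟨[], .swap a.2 x.2, []⟩] (fms [x.2, a.2]) := by
        simp [IsDiagram, Gate.src, Gate.tgt]
      -- the crossing of `a` and `x` is performed before the remaining strings are permuted
      have dsw := hsw.whisk [] (fms (r₀.map Prod.snd))
      have dl := (isDiagram_cross (l.map Prod.snd) [a.2]).whisk [] (fms (r.map Prod.snd))
      have dl' := (isDiagram_cross (l'.map Prod.snd) [x.2]).whisk [.fm a.2]
        (fms (r'.map Prod.snd))
      have er : fms (l.map Prod.snd) ++ fms (r.map Prod.snd) =
          fms (l'.map Prod.snd) ++ .fm x.2 :: fms (r'.map Prod.snd) := by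
        simpa using congrArg (fun z => fms (z.map Prod.snd)) e'
      have k₁ := e.append (SEq.refl (by simpa using dsw))
      have k₂ := (SEq.refl (by simpa using dl)).append
        ((e''.whisk [.fm a.2] []).append (SEq.refl (by simpa using dsw)))
      have k₃ := (SEq.refl (w' := .fm a.2 :: (fms (l.map Prod.snd) ++ fms (r.map Prod.snd)))
        (by simpa using dl)).append
        ((SEq.refl (w' := [.fm a.2, .fm x.2] ++ fms ((l' ++ r').map Prod.snd))
          (by simpa [er] using dl')).append
        (by simpa using (seq_interchange_whisk hsw h''.isDiagram [] [] []).symm))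
      have k : SEq (fms ((l ++ a :: r).map Prod.snd)) (fms ((x :: a :: r₀).map Prod.snd))
          (τ ++ [⟨[], .swap a.2 x.2, fms (r₀.map Prod.snd)⟩])
          (ProofDiagrams.whisk [] (fms (r.map Prod.snd))
              (ProofDiagrams.cross (l.map Prod.snd) [a.2]) ++
            (ProofDiagrams.whisk [.fm a.2] (fms (r'.map Prod.snd))
              (ProofDiagrams.cross (l'.map Prod.snd) [x.2]) ++
            (⟨[], .swap a.2 x.2, fms (l'.map Prod.snd) ++ fms (r'.map Prod.snd)⟩ ::
            ProofDiagrams.whisk [.fm x.2, .fm a.2] [] τ''))) := by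
        refine SEq.trans (by simpa using k₁) (SEq.trans (by simpa using k₂) (by simpa using k₃))
      have dτ := SEq.refl (h''.isDiagram.whisk [.fm x.2, .fm a.2] [])
      -- Here `x` starts to the right of `a`, so the two cross once. By `Twist.seq_cross` the string
      -- `x` may travel to the left end before `l` and `a` cross.
      have after (m : List (ι × Formula Atom)) (hl : l' = l ++ m) (hr : r = m ++ x :: r') :
          ∃ p q ρ, l ++ a :: r = p ++ x :: q ∧ Twist (p ++ q) ρ (a :: r₀) ∧
            SEq (fms ((l ++ a :: r).map Prod.snd)) (fms ((x :: a :: r₀).map Prod.snd))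
              (τ ++ [⟨[], .swap a.2 x.2, fms (r₀.map Prod.snd)⟩])
              (ProofDiagrams.whisk [] (fms (q.map Prod.snd))
                (ProofDiagrams.cross (p.map Prod.snd) [x.2]) ++
                ProofDiagrams.whisk [.fm x.2] [] ρ) := by
        subst hl hr
        refine ⟨l ++ a :: m, r', _, by simp, Twist.append
          (by simpa using (Twist.cross l [a]).whisk [] (m ++ r'))
          (by simpa using h''.whisk [a] []), k.trans ?_⟩
        have j := ((((Twist.cross l [a]).whisk [] m).seq_cross x.2).symm.whisk []
          (fms (r'.map Prod.snd))).append (by simpa using dτ)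
        simpa [ProofDiagrams.cross, ProofDiagrams.crossOne] using j
      rcases List.append_eq_append_iff.1 e' with ⟨m, hl, hr⟩ | ⟨m, hl, hr⟩
      · exact after m hl hr
      · cases m with
        | nil => exact after [] (by simpa using hl.symm) (by simpa using hr.symm)
        | cons z m =>
          -- Here `x` starts to the left of `a`. In the diagram `k` the two strings cross twice, and
          -- once the crossings are adjacent the involution relation removes them.
          obtain ⟨rfl, rfl⟩ : x = z ∧ r' = m ++ r := by simpa using hr
          subst hl
          refine ⟨l', m ++ a :: r, _, by simp, Twist.append
            (by simpa using (Twist.cross (l' ++ m) [a]).whisk [] r)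
            (by simpa using h''.whisk [a] []), k.trans ?_⟩
          have dsw' : IsDiagram (fms [a.2, x.2] ++ fms ((l' ++ m ++ r).map Prod.snd))
              (⟨[], .swap a.2 x.2, fms ((l' ++ m ++ r).map Prod.snd)⟩ ::
                ProofDiagrams.whisk [.fm x.2, .fm a.2] [] τ'') _ :=
            ⟨rfl, by simpa [Gate.tgt] using h''.isDiagram.whisk [.fm x.2, .fm a.2] []⟩
          have j₁ := ((((Twist.cross l' [x]).whisk [] m).seq_cross a.2).whisk []
            (fms (r.map Prod.snd))).append (by simpa using SEq.refl dsw')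
          have d₁ := (isDiagram_cross (l'.map Prod.snd) [x.2]).whisk []
            (fms ((m ++ a :: r).map Prod.snd))
          have d₂ := (isDiagram_cross ((l' ++ m).map Prod.snd) [a.2]).whisk [.fm x.2]
            (fms (r.map Prod.snd))
          have j₂ := (SEq.refl d₁).append (SEq.append (by simpa using SEq.refl d₂)
            (((seq_involution x.2 a.2).whisk [] (fms ((l' ++ m ++ r).map Prod.snd))).append
              (by simpa using dτ)))
          refine SEq.trans
            (by simpa [ProofDiagrams.cross, ProofDiagrams.crossOne] using j₁)
            (by simpa [ProofDiagrams.cross, ProofDiagrams.crossOne] using j₂)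

/-- Diagrams of crossings that realize the same permutation are equal. -/
theorem Twist.seq {ι : Type*} {s t : List (ι × Formula Atom)} {τ τ' : List (Layer Atom)}
    (hs : s.Nodup) (h : Twist s τ t) (h' : Twist s τ' t) :
    SEq (fms (s.map Prod.snd)) (fms (t.map Prod.snd)) τ τ' := by
  induction t generalizing s τ τ' with
  | nil =>
    obtain ⟨rfl, rfl⟩ := h.target_ne_nil
    obtain ⟨-, rfl⟩ := h'.target_ne_nil
    exact SEq.refl rfl
  | cons x t ih =>
    obtain ⟨l, r, ρ, rfl, k, e⟩ := Twist.exists_front _ rfl h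
    obtain ⟨l', r', ρ', e', k', e''⟩ := Twist.exists_front _ rfl h'
    -- The tagged string `x` occurs only once in the source, so both normal forms pull it from the
    -- same place. Without tags, repeated formulas would make this false.
    obtain ⟨rfl, rfl⟩ : l = l' ∧ r = r' := by
      have hs' : x ∉ l ++ r ∧ (l ++ r).Nodup := List.nodup_middle.1 hs |> List.nodup_cons.1
      have hs'' : x ∉ l' ++ r' ∧ (l' ++ r').Nodup :=
        List.nodup_middle.1 (e' ▸ hs) |> List.nodup_cons.1
      simp only [List.mem_append, not_or] at hs' hs''
      rcases List.append_eq_append_iff.1 e' with ⟨m, rfl, hm⟩ | ⟨m, rfl, hm⟩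
      · cases m with
        | nil => simpa using hm
        | cons z m => simp at hm hs''; exact absurd hm.1 hs''.1.1.2.1
      · cases m with
        | nil => simpa [eq_comm] using hm
        | cons z m => simp at hm hs'; exact absurd hm.1 hs'.1.1.2.1
    have i := ih (List.nodup_cons.1 (List.nodup_middle.1 hs)).2 k k'
    refine e.trans (SEq.trans ?_ e''.symm)
    refine SEq.append (w' := fms ((x :: (l ++ r)).map Prod.snd))
      (SEq.refl ?_) ?_
    · simpa using (isDiagram_cross (l.map Prod.snd) [x.2]).whisk [] (fms (r.map Prod.snd))
    · simpa using i.whisk [.fm x.2] []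

/-! ## Permutations of positions and crossing diagrams -/

namespace Exch

variable {α : Type*} {Γ Δ Θ Γ' Δ' : List (Formula Atom)}

/-- The permutation `σ` sends the list `s` of tags of positions to `t`. -/
structure Maps (σ : Exch Γ Δ) (s t : List α) : Prop where
  length_left : s.length = Γ.length
  length_right : t.length = Δ.length
  getElem_eq : ∀ i : Fin Δ.length, t[(i : ℕ)]? = s[(σ.toEquiv i : ℕ)]?

theorem Maps.refl (s : List α) (h : s.length = Γ.length) : (Exch.refl Γ).Maps s s :=
  ⟨h, h, fun _ => rfl⟩

theorem Maps.trans {σ : Exch Γ Δ} {τ : Exch Δ Θ} {s t v : List α} (h : σ.Maps s t)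
    (h' : τ.Maps t v) : (σ.trans τ).Maps s v :=
  ⟨h.1, h'.2, fun i => (h'.3 i).trans (h.3 _)⟩

theorem appendPos_inl_val (Γ Δ : List (Formula Atom)) (i : Fin Γ.length) :
    (appendPos Γ Δ (Sum.inl i) : ℕ) = i := by
  simp [appendPos]

theorem appendPos_inr_val (Γ Δ : List (Formula Atom)) (i : Fin Δ.length) :
    (appendPos Γ Δ (Sum.inr i) : ℕ) = Γ.length + i := by
  simp [appendPos]

theorem Maps.append {σ : Exch Γ Γ'} {τ : Exch Δ Δ'} {s s' t t' : List α} (h : σ.Maps s s')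
    (h' : τ.Maps t t') : (σ.append τ).Maps (s ++ t) (s' ++ t') := by
  refine ⟨by simp [h.1, h'.1], by simp [h.2, h'.2], fun i => ?_⟩
  obtain ⟨j, rfl⟩ := (appendPos Γ' Δ').surjective i
  rcases j with j | j
  · have e : (σ.append τ).toEquiv (appendPos Γ' Δ' (Sum.inl j)) =
        appendPos Γ Δ (Sum.inl (σ.toEquiv j)) := by simp [Exch.append]
    rw [e, appendPos_inl_val, appendPos_inl_val,
      List.getElem?_append_left (by rw [h.2]; exact j.2),
      List.getElem?_append_left (by rw [h.1]; exact (σ.toEquiv j).2), h.3]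
  · have e : (σ.append τ).toEquiv (appendPos Γ' Δ' (Sum.inr j)) =
        appendPos Γ Δ (Sum.inr (τ.toEquiv j)) := by simp [Exch.append]
    rw [e, appendPos_inr_val, appendPos_inr_val, ← h.1, ← h.2,
      List.getElem?_append_right (by simp), List.getElem?_append_right (by simp)]
    simpa using h'.3 j

theorem Maps.comm {s t : List α} (hs : s.length = Γ.length) (ht : t.length = Δ.length) :
    (Exch.comm Γ Δ).Maps (s ++ t) (t ++ s) := by
  refine ⟨by simp [hs, ht], by simp [hs, ht], fun i => ?_⟩
  obtain ⟨j, rfl⟩ := (appendPos Δ Γ).surjective i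
  rcases j with j | j
  · have e : (Exch.comm Γ Δ).toEquiv (appendPos Δ Γ (Sum.inl j)) =
        appendPos Γ Δ (Sum.inr j) := by simp [Exch.comm]
    rw [e, appendPos_inl_val, appendPos_inr_val, ← hs,
      List.getElem?_append_left (by rw [ht]; exact j.2), List.getElem?_append_right (by simp)]
    simp
  · have e : (Exch.comm Γ Δ).toEquiv (appendPos Δ Γ (Sum.inr j)) =
        appendPos Γ Δ (Sum.inl j) := by simp [Exch.comm]
    rw [e, appendPos_inl_val, appendPos_inr_val, ← ht, List.getElem?_append_right (by simp),
      List.getElem?_append_left (by rw [hs]; exact j.2)]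
    simp

theorem Maps.adjacent {l r : List (Formula Atom)} {A B : Formula Atom} {s t : List α} {x y : α}
    (hs : s.length = l.length) (ht : t.length = r.length) :
    (Exch.adjacent l A B r).Maps (s ++ x :: y :: t) (s ++ y :: x :: t) :=
  (Maps.refl s hs).append
    ((Maps.comm (s := [x]) (t := [y]) rfl rfl).append (Maps.refl t ht))

/-- Distinct tags record where each position comes from. Equality of permutations can therefore be
tested by running both on a single list. -/
theorem Maps.eq {σ σ' : Exch Γ Δ} {s t : List α} (hs : s.Nodup) (h : σ.Maps s t)
    (h' : σ'.Maps s t) : σ = σ' := by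
  ext i
  have e := (h.3 i).symm.trans (h'.3 i)
  have h₁ : (σ.toEquiv i : ℕ) < s.length := by rw [h.1]; exact (σ.toEquiv i).2
  have h₂ : (σ'.toEquiv i : ℕ) < s.length := by rw [h.1]; exact (σ'.toEquiv i).2
  rw [List.getElem?_eq_getElem h₁, List.getElem?_eq_getElem h₂, Option.some_inj] at e
  exact (List.Nodup.getElem_inj_iff hs).1 e

theorem Maps.target_eq {σ : Exch Γ Δ} {s t t' : List α} (h : σ.Maps s t) (h' : σ.Maps s t') :
    t = t' := by
  apply List.ext_getElem? fun n => ?_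
  by_cases hn : n < Δ.length
  · exact (h.3 ⟨n, hn⟩).trans (h'.3 ⟨n, hn⟩).symm
  · rw [List.getElem?_eq_none (by rw [h.2]; omega), List.getElem?_eq_none (by rw [h'.2]; omega)]

theorem exists_maps (σ : Exch Γ Δ) (s : List α) (hs : s.length = Γ.length) :
    ∃ t, σ.Maps s t := by
  refine ⟨List.ofFn fun i => s.get ((σ.toEquiv i).cast hs.symm), hs, by simp, fun i => ?_⟩
  simp

end Exch

namespace Twisting

variable {Γ Δ Θ Γ' Δ' : List (Formula Atom)}

/-- A crossing diagram with permutation `σ` can be run on tagged formulas. -/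
theorem twist {ι : Type*} {τ : List (Layer Atom)} {σ : Exch Γ Δ} (h : Twisting τ σ)
    (s : List (ι × Formula Atom)) (hs : s.map Prod.snd = Γ) :
    ∃ t, t.map Prod.snd = Δ ∧ σ.Maps s t ∧ Twist s τ t := by
  induction h with
  | nil => exact ⟨s, hs, Exch.Maps.refl s (by simp [← hs]), .nil s⟩
  | snoc l r A B h ih =>
    obtain ⟨t, ht, hm, hτ⟩ := ih
    obtain ⟨t₁, t', rfl, rfl, ht₁⟩ := List.map_eq_append_iff.1 ht
    obtain ⟨x, t', rfl, rfl, ht₂⟩ := List.map_eq_cons_iff.1 ht₁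
    obtain ⟨y, t₂, rfl, rfl, rfl⟩ := List.map_eq_cons_iff.1 ht₂
    exact ⟨t₁ ++ y :: x :: t₂, by simp, hm.trans (Exch.Maps.adjacent (by simp) (by simp)),
      .snoc t₁ t₂ x y hτ⟩

theorem of_twist {ι : Type*} {s t : List (ι × Formula Atom)} {τ : List (Layer Atom)}
    (h : Twist s τ t) :
    ∃ σ : Exch (s.map Prod.snd) (t.map Prod.snd), Twisting τ σ ∧ σ.Maps s t := by
  induction h with
  | nil => exact ⟨_, .nil _, Exch.Maps.refl _ (by simp)⟩
  | snoc l r x y h ih =>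
    obtain ⟨σ, hσ, hm⟩ := ih
    -- The mapped lists occur in the type of `σ`; they become variables so that the maps can be
    -- computed without transport.
    generalize hΔ : (l ++ x :: y :: r).map Prod.snd = Δ at σ hσ hm
    generalize hΔ' : (l ++ y :: x :: r).map Prod.snd = Δ'
    simp only [List.map_append, List.map_cons] at hΔ hΔ'
    subst hΔ hΔ'
    exact ⟨_, .snoc _ _ _ _ hσ, hm.trans (Exch.Maps.adjacent (by simp) (by simp))⟩

/-- The formulas of a sequent, tagged by their positions. -/
def tags (Γ : List (Formula Atom)) : List (ℕ × Formula Atom) :=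
  List.ofFn fun i : Fin Γ.length => ((i : ℕ), Γ.get i)

theorem tags_snd (Γ : List (Formula Atom)) : (tags Γ).map Prod.snd = Γ := by
  simp [tags, Function.comp_def]

theorem tags_nodup (Γ : List (Formula Atom)) : (tags Γ).Nodup :=
  List.nodup_ofFn.2 fun _ _ h => Fin.ext (Prod.ext_iff.1 h).1

theorem isDiagram {τ : List (Layer Atom)} {σ : Exch Γ Δ} (h : Twisting τ σ) :
    IsDiagram (fms Γ) τ (fms Δ) := by
  obtain ⟨t, rfl, -, ht⟩ := h.twist (tags Γ) (tags_snd Γ)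
  simpa [tags_snd] using ht.isDiagram

/-- Crossing diagrams that realize the same permutation are equal. -/
theorem seq {τ τ' : List (Layer Atom)} {σ : Exch Γ Δ} (h : Twisting τ σ)
    (h' : Twisting τ' σ) : SEq (fms Γ) (fms Δ) τ τ' := by
  obtain ⟨t, rfl, hm, ht⟩ := h.twist (tags Γ) (tags_snd Γ)
  obtain ⟨t', -, hm', ht'⟩ := h'.twist (tags Γ) (tags_snd Γ)
  obtain rfl := hm.target_eq hm'
  simpa [tags_snd] using Twist.seq (tags_nodup Γ) ht ht'

/-- The test used to recognize the permutation of a crossing diagram: run both on distinct tags and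
compare the results. It replaces computations with composites of `Exch`. -/
theorem of_maps {ι : Type*} {s t : List (ι × Formula Atom)} {τ : List (Layer Atom)}
    {σ : Exch Γ Δ} (hs : s.map Prod.snd = Γ) (ht : t.map Prod.snd = Δ) (hn : s.Nodup)
    (h : Twist s τ t) (hm : σ.Maps s t) : Twisting τ σ := by
  subst hs ht
  obtain ⟨σ', h', hm'⟩ := of_twist h
  rwa [hm.eq hn hm']

theorem maps_snd {ι : Type*} {σ : Exch Γ Δ} {s t : List (ι × Formula Atom)}
    (hs : s.map Prod.snd = Γ) (h : σ.Maps s t) : t.map Prod.snd = Δ := by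
  apply List.ext_getElem? fun n => ?_
  by_cases hn : n < Δ.length
  · have h₁ := h.3 ⟨n, hn⟩
    have h₂ := σ.get_eq ⟨n, hn⟩
    subst hs
    simp only [List.get_eq_getElem] at h₁ h₂
    have h₃ : (σ.toEquiv ⟨n, hn⟩ : ℕ) < s.length := by rw [h.1]; exact (σ.toEquiv _).2
    rw [List.getElem?_map, h₁, List.getElem?_eq_getElem hn, h₂, List.getElem?_eq_getElem h₃]
    simp
  · rw [List.getElem?_eq_none (by rw [List.length_map, h.2]; omega),
      List.getElem?_eq_none (by omega)]

theorem maps_perm {σ : Exch Γ Δ} {α : Type*} {s t : List α} (h : σ.Maps s t) : s.Perm t := by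
  have hn : Δ.length = s.length := by
    simpa [h.1] using Fintype.card_congr σ.toEquiv
  let c : Fin Δ.length ≃ Fin s.length := finCongr hn
  let e : Equiv.Perm (Fin Δ.length) := (σ.toEquiv.trans (finCongr h.1.symm)).trans c.symm
  have h₁ : s = List.ofFn (s.get ∘ c) := by
    apply List.ext_getElem (by simp [hn]) fun n _ _ => ?_
    simp [c]
  have h₂ : t = List.ofFn ((s.get ∘ c) ∘ e) := by
    apply List.ext_getElem (by simp [h.2]) fun n k _ => ?_
    have h₃ := h.3 ⟨n, by rwa [h.2] at k⟩
    rw [List.getElem?_eq_getElem k, List.getElem?_eq_getElem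
      (by rw [h.1]; exact (σ.toEquiv _).2), Option.some_inj] at h₃
    simpa [c, e] using h₃
  have h₃ := (Equiv.Perm.ofFn_comp_perm e (s.get ∘ c)).symm
  rwa [← h₁, ← h₂] at h₃

/-- Every permutation is realized by crossings. -/
theorem exists_twisting (σ : Exch Γ Δ) : ∃ τ, Twisting τ σ := by
  obtain ⟨t, hm⟩ := σ.exists_maps (tags Γ) (by simp [tags])
  obtain ⟨τ, h⟩ := Twist.exists_of_perm (maps_perm hm)
  exact ⟨τ, of_maps (tags_snd Γ) (maps_snd (tags_snd Γ) hm) (tags_nodup Γ) h hm⟩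

theorem trans {τ τ' : List (Layer Atom)} {σ : Exch Γ Δ} {σ' : Exch Δ Θ} (h : Twisting τ σ)
    (h' : Twisting τ' σ') : Twisting (τ ++ τ') (σ.trans σ') := by
  obtain ⟨t, ht, hm, k⟩ := h.twist (tags Γ) (tags_snd Γ)
  obtain ⟨v, hv, hm', k'⟩ := h'.twist t ht
  exact of_maps (tags_snd Γ) hv (tags_nodup Γ) (k.append k') (hm.trans hm')

/-- Cutting one list of distinct tags in two keeps the tags of the two blocks disjoint, which is
what `of_maps` requires of a juxtaposition. -/
theorem exists_tags (Γ Δ : List (Formula Atom)) :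
    ∃ s t : List (ℕ × Formula Atom),
      s.map Prod.snd = Γ ∧ t.map Prod.snd = Δ ∧ (s ++ t).Nodup := by
  obtain ⟨s, t, e, hs, ht⟩ := List.map_eq_append_iff.1 (tags_snd (Γ ++ Δ))
  exact ⟨s, t, hs, ht, e ▸ tags_nodup _⟩

theorem append {τ τ' : List (Layer Atom)} {σ : Exch Γ Γ'} {σ' : Exch Δ Δ'} (h : Twisting τ σ)
    (h' : Twisting τ' σ') :
    Twisting (whisk [] (fms Δ) τ ++ whisk (fms Γ') [] τ') (σ.append σ') := by
  obtain ⟨s, t, hs, ht, hn⟩ := exists_tags Γ Δ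
  obtain ⟨s', hs', hm, k⟩ := h.twist s hs
  obtain ⟨t', ht', hm', k'⟩ := h'.twist t ht
  subst hs ht hs' ht'
  exact of_maps (by simp) (by simp) hn
    (Twist.append (by simpa using k.whisk [] t) (by simpa using k'.whisk s' []))
    (hm.append hm')

theorem comm (Γ Δ : List (Formula Atom)) : Twisting (cross Γ Δ) (Exch.comm Γ Δ) := by
  obtain ⟨s, t, rfl, rfl, hn⟩ := exists_tags Γ Δ
  exact of_maps (by simp) (by simp) hn (Twist.cross s t) (Exch.Maps.comm (by simp) (by simp))

theorem ofEq (h : Γ = Δ) : Twisting [] (Exch.ofEq h) := by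
  subst h
  exact .nil Γ

end Twisting

/-- Crossing two blocks back and forth. -/
theorem seq_cross_cross (Γ Δ : List (Formula Atom)) :
    SEq (fms (Γ ++ Δ)) (fms (Γ ++ Δ)) (cross Γ Δ ++ cross Δ Γ) [] := by
  have h := (Twisting.comm Γ Δ).trans (Twisting.comm Δ Γ)
  have e : (Exch.comm Γ Δ).trans (Exch.comm Δ Γ) = Exch.refl _ := by
    ext i
    simp [Exch.comm, Exch.trans, Exch.refl]
  rw [e] at h
  exact h.seq (.nil _)

/-! ## Words that are juxtapositions of sequents -/

/-- The automaton that reads words: the state tells whether we are between `L` and `R`. -/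
def readLabel : Bool → Label Atom → Option Bool
  | false, .L => some true
  | true, .R => some false
  | true, .fm _ => some true
  | _, _ => none

/-- Reading a word from a given state. -/
def read : Bool → Word Atom → Option Bool
  | b, [] => some b
  | b, a :: w => (readLabel b a).bind (read · w)

@[simp] theorem read_nil (b : Bool) : read b ([] : Word Atom) = some b := rfl

@[simp] theorem read_true_fm (A : Formula Atom) (w : Word Atom) :
    read true (.fm A :: w) = read true w := rfl

@[simp] theorem read_true_R (w : Word Atom) : read true (.R :: w) = read false w := rfl

@[simp] theorem read_false_L (w : Word Atom) : read false (.L :: w) = read true w := rfl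

@[simp] theorem read_false_fm (A : Formula Atom) (w : Word Atom) :
    read false (.fm A :: w) = none := rfl

@[simp] theorem read_false_R (w : Word Atom) : read false (.R :: w) = none := rfl

@[simp] theorem read_true_L (w : Word Atom) : read true (.L :: w) = none := rfl

theorem read_append (b : Bool) (u v : Word Atom) :
    read b (u ++ v) = (read b u).bind (read · v) := by
  induction u generalizing b with
  | nil => rfl
  | cons a u ih =>
    simp only [List.cons_append, read]
    cases readLabel b a <;> simp [ih]

theorem read_append_of {b c : Bool} {u : Word Atom} (h : read b u = some c) (v : Word Atom) :
    read b (u ++ v) = read c v := by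
  simp [read_append, h]

@[simp] theorem read_fms (Γ : List (Formula Atom)) : read true (fms Γ) = some true := by
  induction Γ with
  | nil => rfl
  | cons A Γ ih => simpa using ih

@[simp] theorem read_fms_append (Γ : List (Formula Atom)) (w : Word Atom) :
    read true (fms Γ ++ w) = read true w :=
  read_append_of (read_fms Γ) w

@[simp] theorem read_sequent (Γ : List (Formula Atom)) : read false (sequent Γ) = some false := by
  simp [sequent]

/-- The word of a list of formulas and of blocks `R, L`, followed by `R`. -/
def sheafTail (W : List (Option (Formula Atom))) : Word Atom := (sheaf W).tail

theorem sheaf_eq (W : List (Option (Formula Atom))) : sheaf W = .L :: sheafTail W := rfl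

@[simp] theorem sheafTail_nil : sheafTail ([] : List (Option (Formula Atom))) = [.R] := rfl

@[simp] theorem sheafTail_some (A : Formula Atom) (W : List (Option (Formula Atom))) :
    sheafTail (some A :: W) = .fm A :: sheafTail W := rfl

@[simp] theorem sheafTail_none (W : List (Option (Formula Atom))) :
    sheafTail (none :: W) = .R :: .L :: sheafTail W := rfl

theorem sheafTail_map_some (Γ : List (Formula Atom)) :
    sheafTail (Γ.map some) = fms Γ ++ [.R] := by
  induction Γ with
  | nil => rfl
  | cons A Γ ih => simp [ih]

theorem sheaf_map_some (Γ : List (Formula Atom)) : sheaf (Γ.map some) = sequent Γ := by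
  rw [sheaf_eq, sheafTail_map_some, sequent]

@[simp] theorem read_sheaf (W : List (Option (Formula Atom))) :
    read false (sheaf W) = some false := by
  rw [sheaf_eq, read_false_L]
  induction W with
  | nil => rfl
  | cons o W ih => cases o <;> simpa using ih

/-- An `R` that does not end the word must be followed by `L`, and the two letters are read together
as one block. A step may thus consume two letters, hence the strong induction on length. -/
theorem exists_sheafTail (n : ℕ) : ∀ w : Word Atom, w.length = n → read true w = some false →
    ∃ W, w = sheafTail W := by
  induction n using Nat.strong_induction_on with
  | _ n ih =>
  rintro (_ | ⟨a, w⟩) hn h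
  · simp at h
  · rcases a with A | _ | _
    · obtain ⟨W, rfl⟩ := ih w.length (by simp at hn; omega) w rfl (by simpa using h)
      exact ⟨some A :: W, rfl⟩
    · simp at h
    · rcases w with _ | ⟨b, w⟩
      · exact ⟨[], rfl⟩
      · rcases b with B | _ | _
        · simp at h
        · obtain ⟨W, rfl⟩ := ih w.length (by simp at hn; omega) w rfl (by simpa using h)
          exact ⟨none :: W, rfl⟩
        · simp at h

/-- A nonempty juxtaposition of sequents is a sheaf. -/
theorem exists_sheaf {w : Word Atom} (hw : w ≠ []) (h : read false w = some false) :
    ∃ W, w = sheaf W := by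
  rcases w with _ | ⟨a, w⟩
  · exact absurd rfl hw
  · rcases a with A | _ | _
    · simp at h
    · obtain ⟨W, rfl⟩ := exists_sheafTail _ w rfl (by simpa using h)
      exact ⟨W, rfl⟩
    · simp at h

/-! ## Well placed gates -/

/-- The state of the automaton in which a gate has to be placed. -/
def Gate.level : Gate Atom → Bool
  | ax _ => false
  | one => false
  | big _ _ => false
  | _ => true

-- Source and target of a gate both lead from the state of the gate back to that state. A placed
-- gate therefore does not disturb the reading of the word around it, and the words in a placed
-- diagram remain juxtapositions of sequents.
@[simp] theorem Gate.read_src (g : Gate Atom) : read g.level g.src = some g.level := by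
  cases g <;> simp [level, src, read_append]

@[simp] theorem Gate.read_tgt (g : Gate Atom) : read g.level g.tgt = some g.level := by
  cases g <;> simp [level, tgt, read_append]

/-- The gate of the layer is placed at its state of the automaton. -/
def Layer.Placed (a : Layer Atom) : Prop :=
  read false a.left = some a.gate.level ∧ read a.gate.level a.right = some false

/-- All gates are well placed. -/
def Placed (φ : List (Layer Atom)) : Prop := ∀ a ∈ φ, a.Placed

@[simp] theorem placed_nil : Placed ([] : List (Layer Atom)) := by simp [Placed]

@[simp] theorem placed_cons {a : Layer Atom} {φ : List (Layer Atom)} :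
    Placed (a :: φ) ↔ a.Placed ∧ Placed φ := by simp [Placed]

@[simp] theorem placed_append {φ ψ : List (Layer Atom)} :
    Placed (φ ++ ψ) ↔ Placed φ ∧ Placed ψ := by simp [Placed, or_imp, forall_and]

theorem Placed.whiskered {φ : List (Layer Atom)} (h : Placed φ) {l r : Word Atom}
    (hl : read false l = some false) (hr : read false r = some false) : Placed (whisk l r φ) := by
  induction φ with
  | nil => simp
  | cons a φ ih =>
    simp only [placed_cons] at h
    simp only [whisk_cons, placed_cons, ih h.2, and_true]
    exact ⟨(read_append_of hl _).trans h.1.1, (read_append_of h.1.2 _).trans hr⟩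

theorem Layer.Placed.read_src {a : Layer Atom} (h : a.Placed) :
    read false (a.left ++ a.gate.src ++ a.right) = some false := by
  rw [List.append_assoc, read_append_of h.1, read_append_of a.gate.read_src, h.2]

/-- The side words of a layer change only by trading the source of the other gate for its target,
which the automaton cannot distinguish. -/
theorem Interchange.placed_iff {φ ψ : List (Layer Atom)} (h : Interchange φ ψ) :
    Placed φ ↔ Placed ψ := by
  obtain ⟨p, q, l, x, r, g, g'⟩ := h
  simp only [placed_append, placed_cons, Layer.Placed, placed_nil, and_true]
  refine and_congr_left fun _ => and_congr_right fun _ => ?_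
  by_cases hl : read false l = some g.level
  · simp only [List.append_assoc, read_append_of hl, read_append_of g.read_src,
      read_append_of g.read_tgt, hl]
    by_cases hx : read g.level x = some g'.level
    · simp [hx, read_append_of hx, read_append_of g'.read_src, read_append_of g'.read_tgt]
    · simp [hx]
  · simp [hl]

theorem eqvGen_interchange_placed_iff {φ ψ : List (Layer Atom)}
    (h : Relation.EqvGen Interchange φ ψ) : Placed φ ↔ Placed ψ := by
  induction h with
  | rel _ _ h => exact h.placed_iff
  | refl => exact Iff.rfl
  | symm _ _ _ ih => exact ih.symm
  | trans _ _ _ _ _ ih₁ ih₂ => exact ih₁.trans ih₂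

/-! ## Elimination of the gates that exchange sheaves -/

/-- A diagram without `big` gates whose gates are well placed. -/
structure Plain (φ : List (Layer Atom)) : Prop where
  placed : Placed φ
  control : ∀ a ∈ φ, a.gate.IsControl

theorem plain_nil : Plain ([] : List (Layer Atom)) := ⟨by simp, by simp⟩

theorem plain_append {φ ψ : List (Layer Atom)} : Plain (φ ++ ψ) ↔ Plain φ ∧ Plain ψ :=
  ⟨fun h => ⟨⟨(placed_append.1 h.1).1, fun a ha => h.2 a (List.mem_append_left _ ha)⟩,
    (placed_append.1 h.1).2, fun a ha => h.2 a (List.mem_append_right _ ha)⟩,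
    fun h => ⟨placed_append.2 ⟨h.1.1, h.2.1⟩, fun a ha =>
      (List.mem_append.1 ha).elim (h.1.2 a) (h.2.2 a)⟩⟩

theorem plain_singleton {a : Layer Atom} : Plain [a] ↔ a.Placed ∧ a.gate.IsControl :=
  ⟨fun h => ⟨h.1 a (by simp), h.2 a (by simp)⟩, fun h => ⟨by simpa using h.1, by simpa using h.2⟩⟩

theorem Plain.whiskered {φ : List (Layer Atom)} (h : Plain φ) {l r : Word Atom}
    (hl : read false l = some false) (hr : read false r = some false) : Plain (whisk l r φ) := by
  refine ⟨h.1.whiskered hl hr, fun a ha => ?_⟩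
  obtain ⟨b, hb, rfl⟩ := List.mem_map.1 ha
  exact h.2 b hb

/-- The output of a control gate lies on one side of any boundary between two sequents. -/
theorem tgt_split {a : Layer Atom} (ha : a.Placed) (hc : a.gate.IsControl) {u v : Word Atom}
    (hu : read false u = some false) (e : a.left ++ a.gate.tgt ++ a.right = u ++ v) :
    (∃ r, a.right = r ++ v ∧ u = a.left ++ a.gate.tgt ++ r) ∨
      ∃ l, a.left = u ++ l ∧ v = l ++ a.gate.tgt ++ a.right := by
  obtain ⟨l, g, r⟩ := a
  have hl : read false l = some g.level := ha.1
  simp only [List.append_assoc] at e hc ⊢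
  rcases List.append_eq_append_iff.1 e with ⟨m, rfl, hm⟩ | ⟨m, rfl, hm⟩
  · rw [read_append_of hl] at hu
    rcases List.append_eq_append_iff.1 hm with ⟨k, rfl, rfl⟩ | ⟨k, hk, rfl⟩
    · exact Or.inl ⟨k, rfl, by simp⟩
    -- The boundary lies within the output of the gate, ends included, and reading the part `m`
    -- before it must end in the state `false`. For `ax` and `one` this happens at the two ends
    -- only, for the other control gates nowhere. A `big` gate does have such a boundary between its
    -- two output sheaves.
    · cases g with
      | big => exact hc.elim
      | cut => simp_all [Gate.level, Gate.tgt]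
      | ax A =>
        rcases m with _ | ⟨m₁, _ | ⟨m₂, _ | ⟨m₃, _ | ⟨m₄, m⟩⟩⟩⟩ <;>
          simp_all [Gate.tgt, Gate.level]
        all_goals
          obtain ⟨rfl, rfl, rfl, -⟩ := hk
          simp at hu
      | one =>
        rcases m with _ | ⟨m₁, _ | ⟨m₂, _ | ⟨m₃, m⟩⟩⟩ <;> simp_all [Gate.tgt, Gate.level]
        all_goals
          obtain ⟨rfl, rfl, rfl, -⟩ := hk
          simp at hu
      | _ =>
        rcases m with _ | ⟨m₁, _ | ⟨m₂, m⟩⟩ <;> simp_all [Gate.tgt, Gate.level]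
        all_goals
          obtain ⟨rfl, rfl, rfl, -⟩ := hk
          simp at hu
  · exact Or.inr ⟨m, rfl, by simpa using hm⟩

/-- A diagram without `big` gates from the empty word splits at each boundary between two
sequents of its output. -/
theorem Plain.split {φ : List (Layer Atom)} (h : Plain φ) {u v : Word Atom}
    (hd : IsDiagram [] φ (u ++ v)) (hu : read false u = some false) :
    ∃ ψ χ, Plain ψ ∧ Plain χ ∧ IsDiagram [] ψ u ∧ IsDiagram [] χ v ∧
      SEq [] (u ++ v) φ (ψ ++ whisk u [] χ) := by
  induction φ using List.reverseRecOn generalizing u v with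
  | nil =>
    have hd : [] = u ++ v := hd
    obtain ⟨rfl, rfl⟩ := List.append_eq_nil_iff.1 hd.symm
    exact ⟨[], [], plain_nil, plain_nil, rfl, rfl, SEq.refl rfl⟩
  | append_singleton φ a ih =>
    obtain ⟨h', ha⟩ := plain_append.1 h
    obtain ⟨hp, hc⟩ := plain_singleton.1 ha
    obtain ⟨m, hd', rfl, e⟩ := isDiagram_append_iff.1 hd
    have e : _ = u ++ v := e
    rcases tgt_split hp hc hu e with ⟨r, hr, rfl⟩ | ⟨l, hl, rfl⟩
    · obtain ⟨l, g, r'⟩ := a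
      obtain rfl : r' = r ++ v := hr
      have hl : read false l = some g.level := hp.1
      have hr : read g.level r = some false := by
        simpa [List.append_assoc, read_append_of hl, read_append_of g.read_tgt] using hu
      have hu' : read false (l ++ g.src ++ r) = some false := by
        simpa [List.append_assoc, read_append_of hl, read_append_of g.read_src] using hr
      obtain ⟨ψ, χ, pψ, pχ, dψ, dχ, s⟩ := ih (u := l ++ g.src ++ r) (v := v) h'
        (by simpa using hd') hu'
      refine ⟨ψ ++ [⟨l, g, r⟩], χ, plain_append.2 ⟨pψ, plain_singleton.2 ⟨⟨hp.1, hr⟩, hc⟩⟩, pχ,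
        dψ.append isDiagram_singleton, dχ, ?_⟩
      have k₁ := s.append (SEq.refl (φ := [⟨l, g, r ++ v⟩]) (w := l ++ g.src ++ r ++ v)
        (w' := l ++ g.tgt ++ r ++ v) (by simp [IsDiagram]))
      -- The last gate lies to the left of the boundary, so it may be applied before `χ`.
      have k₂ := seq_interchange (φ := [⟨l, g, r⟩]) (isDiagram_singleton) dχ
      have k₃ := (SEq.refl dψ).append (by simpa using k₂.symm)
      exact SEq.trans (by simpa using k₁) (by simpa using k₃)
    · obtain ⟨l', g, r⟩ := a
      obtain rfl : l' = u ++ l := hl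
      obtain ⟨ψ, χ, pψ, pχ, dψ, dχ, s⟩ := ih (u := u) (v := l ++ g.src ++ r) h'
        (by simpa using hd') hu
      refine ⟨ψ, χ ++ [⟨l, g, r⟩], pψ, plain_append.2 ⟨pχ, plain_singleton.2 ⟨⟨?_, hp.2⟩, hc⟩⟩,
        dψ, dχ.append isDiagram_singleton, ?_⟩
      · simpa [read_append_of hu] using hp.1
      have k₁ := s.append (SEq.refl (φ := [⟨u ++ l, g, r⟩]) (w := u ++ (l ++ g.src ++ r))
        (w' := u ++ (l ++ g.tgt ++ r)) (by simp [IsDiagram]))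
      simpa using k₁

/-- A diagram without `big` gates slides through a `big` gate. -/
theorem Plain.slide {φ : List (Layer Atom)} (h : Plain φ) {W : List (Option (Formula Atom))}
    (hd : IsDiagram [] φ (sheaf W)) (W' : List (Option (Formula Atom))) :
    SEq (sheaf W') (sheaf W' ++ sheaf W)
      (whisk [] (sheaf W') φ ++ [⟨[], .big W W', []⟩]) (whisk (sheaf W') [] φ) := by
  induction φ using List.reverseRecOn generalizing W with
  | nil =>
    have hd : [] = sheaf W := hd
    simp [sheaf_eq] at hd
  | append_singleton φ a ih =>
    obtain ⟨h', ha⟩ := plain_append.1 h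
    obtain ⟨hp, hc⟩ := plain_singleton.1 ha
    have hs := hp.read_src
    obtain ⟨l, g, r⟩ := a
    obtain ⟨m, hd', rfl, e⟩ := isDiagram_append_iff.1 hd
    have e : l ++ g.tgt ++ r = sheaf W := e
    have dbig : IsDiagram (sheaf W ++ sheaf W') [⟨[], .big W W', []⟩] (sheaf W' ++ sheaf W) := by
      simp [IsDiagram, Gate.src, Gate.tgt]
    -- The word above the last gate is either empty, and then this gate creates the whole sheaf and
    -- makes the `big` gate disappear, or again a sheaf, and then the gate slides through and the
    -- induction continues.
    by_cases hw : l ++ g.src ++ r = []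
    · simp only [List.append_eq_nil_iff] at hw
      obtain ⟨⟨rfl, hg⟩, rfl⟩ := hw
      -- A control gate with empty output is a cut, and a cut placed between `L` and `R` cannot have
      -- an empty word on its left.
      have hφ : φ = [] := by
        rcases List.eq_nil_or_concat φ with rfl | ⟨ψ, a, rfl⟩
        · rfl
        · rw [List.concat_eq_append] at h' hd'
          obtain ⟨hp, hc⟩ := plain_singleton.1 (plain_append.1 h').2
          obtain ⟨m, -, -, e⟩ := isDiagram_append_iff.1 hd'
          have e : a.left ++ a.gate.tgt ++ a.right = [] ++ g.src ++ [] := e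
          simp only [hg, List.append_nil, List.append_eq_nil_iff] at e
          have h1 := hp.1
          rw [e.1.1] at h1
          obtain ⟨l, g', r⟩ := a
          cases g' <;> simp_all [Gate.tgt, Gate.level, Gate.IsControl, sheaf_eq]
      subst hφ
      have e' : g.tgt = sheaf W := by simpa using e
      refine SEq.of_rule (.proof ?_) ?_ ?_
      · simpa using ProofRule.untangle_left_new g hc W W' hg e'
      · refine IsDiagram.append (w' := sheaf W ++ sheaf W') ?_ dbig
        simp [IsDiagram, hg, e']
      · simp [IsDiagram, hg, e']
    · obtain ⟨W₀, hW₀⟩ := exists_sheaf hw hs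
      rw [hW₀] at hd'
      have k₁ : SEq (sheaf W₀ ++ sheaf W') (sheaf W' ++ sheaf W)
          [⟨l, g, r ++ sheaf W'⟩, ⟨[], .big W W', []⟩]
          [⟨[], .big W₀ W', []⟩, ⟨sheaf W' ++ l, g, r⟩] := by
        refine SEq.of_rule (.proof (.untangle_left g hc l r W₀ W W' hW₀ e)) ?_ ?_
        · simp [IsDiagram, Gate.src, Gate.tgt, ← hW₀, ← e]
        · simp [IsDiagram, Gate.src, Gate.tgt, ← hW₀, ← e]
      have k₂ := (SEq.refl (hd'.whisk [] (sheaf W'))).append (by simpa using k₁)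
      have k₃ := (ih h' hd').append (SEq.refl (φ := [⟨sheaf W' ++ l, g, r⟩])
        (w := sheaf W' ++ sheaf W₀)
        (w' := sheaf W' ++ sheaf W) (by simp [IsDiagram, ← hW₀, ← e]))
      exact SEq.trans (by simpa using k₂) (by simpa using k₃)

/-- The `big` gates of a well placed diagram from the empty word can be eliminated. -/
theorem Placed.exists_plain {φ : List (Layer Atom)} (h : Placed φ) {w : Word Atom}
    (hd : IsDiagram [] φ w) : ∃ ψ, Plain ψ ∧ SEq [] w φ ψ := by
  induction φ using List.reverseRecOn generalizing w with
  | nil => exact ⟨[], plain_nil, SEq.refl hd⟩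
  | append_singleton φ a ih =>
    obtain ⟨h, ha⟩ := placed_append.1 h
    have ha : a.Placed := by simpa using ha
    obtain ⟨m, hd', rfl, e⟩ := isDiagram_append_iff.1 hd
    have e : a.left ++ a.gate.tgt ++ a.right = w := e
    subst e
    obtain ⟨ψ, hψ, s⟩ := ih h hd'
    have k := s.append (SEq.refl (isDiagram_singleton (l := a.left) (r := a.right) (g := a.gate)))
    by_cases hc : a.gate.IsControl
    · exact ⟨_, plain_append.2 ⟨hψ, plain_singleton.2 ⟨ha, hc⟩⟩, k⟩
    · obtain ⟨l, g, r⟩ := a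
      obtain ⟨W, W', rfl⟩ : ∃ W W', g = .big W W' := by
        cases g <;> simp_all [Gate.IsControl]
      have hl : read false l = some false := ha.1
      have hr : read false r = some false := ha.2
      -- By induction all layers above are plain, so they split into four independent diagrams: `α`
      -- on the left, `γ` and `ε` for the two sheaves, `ζ` on the right. The `big` gate concerns `γ`
      -- and `ε` only.
      obtain ⟨α, β, pα, pβ, dα, dβ, s₁⟩ := hψ.split (u := l) (v := sheaf W ++ (sheaf W' ++ r))
        (by simpa [Gate.src] using s.right) hl
      obtain ⟨γ, δ, pγ, pδ, dγ, dδ, s₂⟩ := pβ.split dβ (read_sheaf W)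
      obtain ⟨ε, ζ, pε, pζ, dε, dζ, s₃⟩ := pδ.split dδ (read_sheaf W')
      refine ⟨α ++ whisk l [] ε ++ whisk (l ++ sheaf W') [] γ ++
        whisk (l ++ sheaf W' ++ sheaf W) [] ζ, ?_, ?_⟩
      · simp only [plain_append]
        exact ⟨⟨⟨pα, pε.whiskered hl rfl⟩, pγ.whiskered (by simp [read_append, hl]) rfl⟩,
          pζ.whiskered (by simp [read_append, hl]) rfl⟩
      have dbig : IsDiagram (sheaf W ++ sheaf W') [⟨[], .big W W', []⟩]
          (sheaf W' ++ sheaf W) := by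
        simp [IsDiagram, Gate.src, Gate.tgt]
      have q₁ : SEq [] (sheaf W ++ sheaf W' ++ r)
          β (γ ++ whisk (sheaf W) [] ε ++ whisk (sheaf W ++ sheaf W') [] ζ) := by
        have := (SEq.refl dγ).append (by simpa using s₃.whisk (sheaf W) [])
        exact SEq.trans (by simpa using s₂) (by simpa using this)
      -- After `ε` has been moved to the top, `γ` is directly above the `big` gate and slides
      -- through it completely.
      have q₂ : SEq [] (sheaf W' ++ sheaf W) (γ ++ whisk (sheaf W) [] ε ++ [⟨[], .big W W', []⟩])
          (ε ++ whisk (sheaf W') [] γ) := by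
        have j₁ := (seq_interchange dγ dε).append (SEq.refl dbig)
        have j₂ := (SEq.refl dε).append (pγ.slide dγ W')
        exact SEq.trans (by simpa using j₁) (by simpa using j₂)
      have q₃ : SEq [] (sheaf W' ++ sheaf W ++ r) (β ++ [⟨[], .big W W', r⟩])
          (ε ++ whisk (sheaf W') [] γ ++ whisk (sheaf W' ++ sheaf W) [] ζ) := by
        have j₁ := q₁.append (SEq.refl (by simpa using dbig.whisk [] r))
        have j₂ := (SEq.refl (dγ.append (by simpa using dε.whisk (sheaf W) []))).append
          (by simpa using (seq_interchange dbig dζ).symm)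
        have j₃ := q₂.append (SEq.refl (by simpa using dζ.whisk (sheaf W' ++ sheaf W) []))
        refine SEq.trans (by simpa using j₁) (SEq.trans (by simpa using j₂) (by simpa using j₃))
      have q₄ := (SEq.refl dα).append (by simpa using q₃.whisk l [])
      have q₅ := s₁.append (SEq.refl (by simpa using dbig.whisk l r))
      refine k.trans ?_
      refine SEq.trans (by simpa [Gate.src, Gate.tgt] using q₅)
        (by simpa [Gate.src, Gate.tgt] using q₄)

/-- A `big` gate beneath two diagrams from the empty word exchanges them. -/
theorem seq_big {φ ψ : List (Layer Atom)} {W W' : List (Option (Formula Atom))}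
    (hφ : IsDiagram [] φ (sheaf W)) (hψ : IsDiagram [] ψ (sheaf W')) (pφ : Placed φ) :
    SEq [] (sheaf W' ++ sheaf W) (φ ++ whisk (sheaf W) [] ψ ++ [⟨[], .big W W', []⟩])
      (ψ ++ whisk (sheaf W') [] φ) := by
  -- Only the diagram that slides has to be free of `big` gates. It is replaced by a plain one for
  -- the passage and restored afterwards; `ψ` can be arbitrary.
  obtain ⟨χ, hχ, s⟩ := pφ.exists_plain hφ
  have dbig : IsDiagram (sheaf W ++ sheaf W') [⟨[], .big W W', []⟩] (sheaf W' ++ sheaf W) := by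
    simp [IsDiagram, Gate.src, Gate.tgt]
  have j₀ := (s.append (SEq.refl (by simpa using hψ.whisk (sheaf W) []))).append (SEq.refl dbig)
  have j₁ := (seq_interchange s.right hψ).append (SEq.refl dbig)
  have j₂ := (SEq.refl hψ).append (hχ.slide s.right W')
  have j₃ := (SEq.refl hψ).append (by simpa using s.symm.whisk (sheaf W') [])
  refine SEq.trans (by simpa using j₀) (SEq.trans (by simpa using j₁)
    (SEq.trans (by simpa using j₂) (by simpa using j₃)))

/-! ## The diagrams that represent a derivation -/

/-- A diagram of crossings that realizes `σ`. -/
noncomputable def Exch.twisting {Γ Δ : List (Formula Atom)} (σ : Exch Γ Δ) : List (Layer Atom) :=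
  (Twisting.exists_twisting σ).choose

theorem Exch.twisting_spec {Γ Δ : List (Formula Atom)} (σ : Exch Γ Δ) : Twisting σ.twisting σ :=
  (Twisting.exists_twisting σ).choose_spec

/-- The diagrams of the premises of a binary rule side by side, with the gate `g` beneath. -/
def joined (Γ Δ : List (Formula Atom)) (A : Formula Atom) (g : Gate Atom)
    (φ ψ : List (Layer Atom)) : List (Layer Atom) :=
  φ ++ whisk (sequent (Γ ++ [A])) [] ψ ++ [⟨.L :: fms Γ, g, fms Δ ++ [.R]⟩]

/-- The diagram of a derivation without `big` gates. -/
noncomputable def Derivation.diagram {Γ : List (Formula Atom)} :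
    Derivation Γ → List (Layer Atom)
  | .ax A _ _ => [⟨[], .ax A, []⟩]
  | .cut (Γ := Γ) (Δ := Δ) A _ _ d e => joined Γ Δ A (.cut A) d.diagram e.diagram
  | .tensor (Γ := Γ) (Δ := Δ) A B d e => joined Γ Δ A (.tensor A B) d.diagram e.diagram
  | .par (Γ := Γ) A B d => d.diagram ++ [⟨.L :: fms Γ, .par A B, [.R]⟩]
  | .bot (Γ := Γ) d => d.diagram ++ [⟨.L :: fms Γ, .bot, [.R]⟩]
  | .one => [⟨[], .one, []⟩]
  | .exch σ d => d.diagram ++ whisk [.L] [.R] σ.twisting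

theorem Derivation.represents_diagram {Γ : List (Formula Atom)} (d : Derivation Γ) :
    Represents d.diagram d := by
  induction d with
  | ax A B h => exact .ax A B h
  | cut A B h d e hd he => exact .cut A B h hd he
  | tensor A B d e hd he => exact .tensor A B hd he
  | par A B d hd => exact .par A B hd
  | bot d hd => exact .bot hd
  | one => exact .one
  | exch σ d hd => exact .exch hd σ.twisting_spec

theorem isDiagram_join {Γ Δ : List (Formula Atom)} {A B : Formula Atom} {g : Gate Atom}
    {a : List (Formula Atom)} (hg : IsSplit A B g a) :
    IsDiagram (sequent (Γ ++ [A]) ++ sequent (B :: Δ)) [⟨.L :: fms Γ, g, fms Δ ++ [.R]⟩]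
      (sequent (Γ ++ a ++ Δ)) := by
  cases hg <;> simp [IsDiagram, Gate.src, Gate.tgt, sequent]

theorem isDiagram_joined {Γ Δ : List (Formula Atom)} {A B : Formula Atom} {g : Gate Atom}
    {a : List (Formula Atom)} (hg : IsSplit A B g a) {φ ψ : List (Layer Atom)}
    (hφ : IsDiagram [] φ (sequent (Γ ++ [A]))) (hψ : IsDiagram [] ψ (sequent (B :: Δ))) :
    IsDiagram [] (joined Γ Δ A g φ ψ) (sequent (Γ ++ a ++ Δ)) :=
  (hφ.append (by simpa using hψ.whisk (sequent (Γ ++ [A])) [])).append (isDiagram_join hg)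

theorem IsSplit.level {A B : Formula Atom} {g : Gate Atom} {a : List (Formula Atom)}
    (hg : IsSplit A B g a) : g.level = true := by
  cases hg <;> rfl

theorem IsSplit.isControl {A B : Formula Atom} {g : Gate Atom} {a : List (Formula Atom)}
    (hg : IsSplit A B g a) : g.IsControl := by
  cases hg <;> trivial

theorem placed_join {Γ Δ : List (Formula Atom)} {A B : Formula Atom} {g : Gate Atom}
    {a : List (Formula Atom)} (hg : IsSplit A B g a) :
    (⟨.L :: fms Γ, g, fms Δ ++ [.R]⟩ : Layer Atom).Placed := by
  simp [Layer.Placed, hg.level]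

theorem Twisting.mem_swap {Γ Δ : List (Formula Atom)} {τ : List (Layer Atom)} {σ : Exch Γ Δ}
    (h : Twisting τ σ) : ∀ a ∈ τ, ∃ (l r : List (Formula Atom)) (A B : Formula Atom),
      a = ⟨fms l, .swap A B, fms r⟩ := by
  induction h with
  | nil => simp
  | snoc l r A B h ih =>
    intro a ha
    rcases List.mem_append.1 ha with ha | ha
    · exact ih a ha
    · exact ⟨l, r, A, B, by simpa using ha⟩

theorem Twisting.plain {Γ Δ : List (Formula Atom)} {τ : List (Layer Atom)} {σ : Exch Γ Δ}
    (h : Twisting τ σ) : Plain (whisk [.L] [.R] τ) := by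
  constructor
  all_goals
    intro a ha
    obtain ⟨b, hb, rfl⟩ := List.mem_map.1 ha
    obtain ⟨l, r, A, B, rfl⟩ := h.mem_swap b hb
  · simp [Layer.Placed, Gate.level]
  · trivial

theorem Twisting.isDiagram_sequent {Γ Δ : List (Formula Atom)} {τ : List (Layer Atom)}
    {σ : Exch Γ Δ} (h : Twisting τ σ) :
    IsDiagram (sequent Γ) (whisk [.L] [.R] τ) (sequent Δ) := by
  simpa [sequent] using h.isDiagram.whisk [.L] [.R]

theorem Twisting.seq_sequent {Γ Δ : List (Formula Atom)} {τ τ' : List (Layer Atom)}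
    {σ : Exch Γ Δ} (h : Twisting τ σ) (h' : Twisting τ' σ) :
    SEq (sequent Γ) (sequent Δ) (whisk [.L] [.R] τ) (whisk [.L] [.R] τ') := by
  simpa [sequent] using (h.seq h').whisk [.L] [.R]

theorem plain_joined {Γ Δ : List (Formula Atom)} {A B : Formula Atom} {g : Gate Atom}
    {a : List (Formula Atom)} (hg : IsSplit A B g a) {φ ψ : List (Layer Atom)}
    (hφ : Plain φ) (hψ : Plain ψ) : Plain (joined Γ Δ A g φ ψ) := by
  simp only [joined, plain_append, plain_singleton]
  exact ⟨⟨hφ, hψ.whiskered (by simp) rfl⟩, placed_join hg, hg.isControl⟩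

theorem Derivation.isDiagram {Γ : List (Formula Atom)} (d : Derivation Γ) :
    IsDiagram [] d.diagram (sequent Γ) := by
  induction d with
  | ax A B h => subst h; simp [diagram, IsDiagram, sequent, Gate.src, Gate.tgt]
  | cut A B h d e hd he => subst h; simpa [diagram] using isDiagram_joined (.cut A) hd he
  | tensor A B d e hd he => simpa [diagram] using isDiagram_joined (.tensor A B) hd he
  | par A B d hd =>
    refine hd.append ?_
    simp [IsDiagram, Gate.src, Gate.tgt, sequent]
  | bot d hd =>
    refine hd.append ?_
    simp [IsDiagram, Gate.src, Gate.tgt, sequent]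
  | one => simp [diagram, IsDiagram, sequent, Gate.src, Gate.tgt]
  | exch σ d hd => exact hd.append σ.twisting_spec.isDiagram_sequent

theorem Derivation.plain {Γ : List (Formula Atom)} (d : Derivation Γ) : Plain d.diagram := by
  induction d with
  | ax A B h => exact plain_singleton.2 ⟨by simp [Layer.Placed, Gate.level], trivial⟩
  | cut A B h d e hd he => subst h; exact plain_joined (.cut A) hd he
  | tensor A B d e hd he => exact plain_joined (.tensor A B) hd he
  | par A B d hd =>
    exact plain_append.2 ⟨hd, plain_singleton.2 ⟨by simp [Layer.Placed, Gate.level], trivial⟩⟩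
  | bot d hd =>
    exact plain_append.2 ⟨hd, plain_singleton.2 ⟨by simp [Layer.Placed, Gate.level], trivial⟩⟩
  | one => exact plain_singleton.2 ⟨by simp [Layer.Placed, Gate.level], trivial⟩
  | exch σ d hd => exact plain_append.2 ⟨hd, σ.twisting_spec.plain⟩

theorem SEq.joined {Γ Δ : List (Formula Atom)} {A B : Formula Atom} {g : Gate Atom}
    {a : List (Formula Atom)} (hg : IsSplit A B g a) {φ ψ φ' ψ' : List (Layer Atom)}
    (hφ : SEq [] (sequent (Γ ++ [A])) φ φ') (hψ : SEq [] (sequent (B :: Δ)) ψ ψ') :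
    SEq [] (sequent (Γ ++ a ++ Δ)) (joined Γ Δ A g φ ψ) (joined Γ Δ A g φ' ψ') :=
  (hφ.append (by simpa using hψ.whisk (sequent (Γ ++ [A])) [])).append
    (SEq.refl (isDiagram_join hg))

/-- The `big` gate restores the order of the two upper halves by `seq_big`; then `φ₂'` passes `φ₁`
by interchange, so that each lower half stands beneath its own upper half. -/
theorem seq_joined_big {Γ Δ : List (Formula Atom)} {A B : Formula Atom} {g : Gate Atom}
    {a : List (Formula Atom)} (hg : IsSplit A B g a) {W₁ W₂ : List (Option (Formula Atom))}
    {φ₁ φ₁' φ₂ φ₂' : List (Layer Atom)}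
    (h₁ : IsDiagram [] φ₁ (sheaf W₁)) (h₁' : IsDiagram (sheaf W₁) φ₁' (sequent (B :: Δ)))
    (h₂ : IsDiagram [] φ₂ (sheaf W₂)) (h₂' : IsDiagram (sheaf W₂) φ₂' (sequent (Γ ++ [A])))
    (p₁ : Placed φ₁) :
    SEq [] (sequent (Γ ++ a ++ Δ))
      (φ₁ ++ whisk (sheaf W₁) [] φ₂ ++ [⟨[], .big W₁ W₂, []⟩]
        ++ whisk [] (sheaf W₁) φ₂' ++ whisk (sequent (Γ ++ [A])) [] φ₁'
        ++ [⟨.L :: fms Γ, g, fms Δ ++ [.R]⟩])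
      (joined Γ Δ A g (φ₂ ++ φ₂') (φ₁ ++ φ₁')) := by
  have k₁ := (seq_big h₁ h₂ p₁).append ((SEq.refl (h₂'.whisk [] (sheaf W₁))).append
    ((SEq.refl (by simpa using h₁'.whisk (sequent (Γ ++ [A])) [])).append
      (SEq.refl (isDiagram_join hg))))
  have i : SEq (sheaf W₂) (sequent (Γ ++ [A]) ++ sheaf W₁)
      (whisk (sheaf W₂) [] φ₁ ++ whisk [] (sheaf W₁) φ₂')
      (φ₂' ++ whisk (sequent (Γ ++ [A])) [] φ₁) := by
    simpa using (seq_interchange h₂' h₁).symm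
  have k₂ := (SEq.refl h₂).append (i.append
    ((SEq.refl (by simpa using h₁'.whisk (sequent (Γ ++ [A])) [])).append
      (SEq.refl (isDiagram_join hg))))
  refine SEq.trans (by simpa using k₁) (by simpa [joined] using k₂)

/-- All diagrams that represent a derivation are equal. -/
theorem Represents.spec {Γ : List (Formula Atom)} {d : Derivation Γ} {φ : List (Layer Atom)}
    (h : Represents φ d) : Placed φ ∧ SEq [] (sequent Γ) φ d.diagram := by
  -- Placement is proved along with the equality, because `seq_joined_big` needs it for the upper
  -- half of the second premise.
  induction h with
  | ax A B h => exact ⟨(Derivation.ax A B h).plain.1, .refl (Derivation.ax A B h).isDiagram⟩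
  | one => exact ⟨Derivation.one.plain.1, .refl Derivation.one.isDiagram⟩
  | par A B h ih =>
    refine ⟨placed_append.2 ⟨ih.1, by simp [Layer.Placed, Gate.level]⟩, ih.2.append (.refl ?_)⟩
    simp [IsDiagram, Gate.src, Gate.tgt, sequent]
  | bot h ih =>
    refine ⟨placed_append.2 ⟨ih.1, by simp [Layer.Placed, Gate.level]⟩, ih.2.append (.refl ?_)⟩
    simp [IsDiagram, Gate.src, Gate.tgt, sequent]
  | exch h hτ ih =>
    exact ⟨placed_append.2 ⟨ih.1, hτ.plain.1⟩,
      ih.2.append (hτ.seq_sequent (Exch.twisting_spec _))⟩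
  | tensor A B _ _ hd he =>
    refine ⟨?_, by simpa [joined, Derivation.diagram] using SEq.joined (.tensor A B) hd.2 he.2⟩
    simp only [placed_append, placed_cons, placed_nil, and_true]
    exact ⟨⟨hd.1, he.1.whiskered (by simp) rfl⟩, placed_join (.tensor A B)⟩
  | cut A B hB _ _ hd he =>
    subst hB
    refine ⟨?_, by simpa [joined, Derivation.diagram] using SEq.joined (.cut A) hd.2 he.2⟩
    simp only [placed_append, placed_cons, placed_nil, and_true]
    exact ⟨⟨hd.1, he.1.whiskered (by simp) rfl⟩, placed_join (.cut A)⟩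
  | tensor_big A B W₁ W₂ h₁ h₁' h₂ h₂' _ _ hd he =>
    obtain ⟨p₂, p₂'⟩ := placed_append.1 hd.1
    obtain ⟨p₁, p₁'⟩ := placed_append.1 he.1
    refine ⟨?_, ?_⟩
    · simp only [placed_append, placed_cons, placed_nil, and_true]
      exact ⟨⟨⟨⟨⟨p₁, p₂.whiskered (by simp) rfl⟩, by simp [Layer.Placed, Gate.level]⟩,
        p₂'.whiskered rfl (by simp)⟩, p₁'.whiskered (by simp) rfl⟩, placed_join (.tensor A B)⟩
    · simpa [joined, Derivation.diagram] using
        (seq_joined_big (.tensor A B) h₁ h₁' h₂ h₂' p₁).trans (SEq.joined (.tensor A B) hd.2 he.2)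
  | cut_big A B hB W₁ W₂ h₁ h₁' h₂ h₂' _ _ hd he =>
    subst hB
    obtain ⟨p₂, p₂'⟩ := placed_append.1 hd.1
    obtain ⟨p₁, p₁'⟩ := placed_append.1 he.1
    refine ⟨?_, ?_⟩
    · simp only [placed_append, placed_cons, placed_nil, and_true]
      exact ⟨⟨⟨⟨⟨p₁, p₂.whiskered (by simp) rfl⟩, by simp [Layer.Placed, Gate.level]⟩,
        p₂'.whiskered rfl (by simp)⟩, p₁'.whiskered (by simp) rfl⟩, placed_join (.cut A)⟩
    · simpa [joined, Derivation.diagram] using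
        (seq_joined_big (.cut A) h₁ h₁' h₂ h₂' p₁).trans (SEq.joined (.cut A) hd.2 he.2)
  | interchange h hφ ih =>
    exact ⟨(eqvGen_interchange_placed_iff hφ).1 ih.1,
      (SEq.of_eqvGen hφ ih.2.left).symm.trans ih.2⟩

/-- Exchange rules act by crossings. -/
theorem ExchOf.seq {Γ Δ : List (Formula Atom)} {σ : Exch Γ Δ} {d : Derivation Γ}
    {e : Derivation Δ} (h : ExchOf σ d e) {τ : List (Layer Atom)} (hτ : Twisting τ σ) :
    SEq [] (sequent Δ) e.diagram (d.diagram ++ whisk [.L] [.R] τ) := by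
  induction h generalizing τ with
  | refl d =>
    simpa using (SEq.refl d.isDiagram).append ((Twisting.nil _).seq_sequent hτ)
  | step τ' h ih =>
    rename_i σ d e
    have k₁ := (ih σ.twisting_spec).append (SEq.refl τ'.twisting_spec.isDiagram_sequent)
    have k₂ := (SEq.refl d.isDiagram).append
      ((σ.twisting_spec.trans τ'.twisting_spec).seq_sequent hτ)
    exact SEq.trans k₁ (by simpa using k₂)

/-! ## The interpretation -/

/-- The class of the diagrams that represent a derivation. -/
noncomputable def interpretation : Interpretation Atom :=
  fun _ d => semClass ⟨d.diagram, d.isDiagram⟩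

theorem isDiagramInterpretation_interpretation :
    IsDiagramInterpretation (interpretation (Atom := Atom)) := fun _ d =>
  ⟨⟨⟨d.diagram, d.isDiagram⟩, d.represents_diagram⟩, fun φ hφ => by
    obtain ⟨-, h₁, h₂, h⟩ := hφ.spec
    exact h.symm⟩

theorem IsDiagramInterpretation.eq {sem : Interpretation Atom}
    (h : IsDiagramInterpretation sem) : sem = interpretation := by
  funext Γ d
  exact (h Γ d).2 ⟨d.diagram, d.isDiagram⟩ d.represents_diagram

theorem interpretation_eq_iff {Γ : List (Formula Atom)} {d e : Derivation Γ} :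
    interpretation Γ d = interpretation Γ e ↔ SEq [] (sequent Γ) d.diagram e.diagram :=
  ⟨fun h => ⟨d.isDiagram, e.isDiagram, h⟩, fun h => h.2.2⟩

/-! ## Termination of the control polygraph -/

/-- The weight of a string: the number of strings that may be joined into it by `⅋` gates,
counted with the gates. -/
def Formula.weight : Formula Atom → ℕ
  | .par A B => A.weight + B.weight + 1
  | _ => 1

theorem Formula.weight_pos (A : Formula Atom) : 0 < A.weight := by
  cases A <;> simp [weight]

/-- The weight of a gate: the product of the weights of the strings for a crossing. -/
def Gate.weight : Gate Atom → ℕ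
  | .swap A B => A.weight * B.weight
  | _ => 0

/-- The sum of the weights of the gates. -/
def totalWeight (φ : List (Layer Atom)) : ℕ := (φ.map fun a => a.gate.weight).sum

@[simp] theorem totalWeight_nil : totalWeight ([] : List (Layer Atom)) = 0 := rfl

@[simp] theorem totalWeight_cons (a : Layer Atom) (φ : List (Layer Atom)) :
    totalWeight (a :: φ) = a.gate.weight + totalWeight φ := by simp [totalWeight]

@[simp] theorem totalWeight_append (φ ψ : List (Layer Atom)) :
    totalWeight (φ ++ ψ) = totalWeight φ + totalWeight ψ := by simp [totalWeight]

@[simp] theorem totalWeight_whisk (l r : Word Atom) (φ : List (Layer Atom)) :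
    totalWeight (whisk l r φ) = totalWeight φ := by
  induction φ with
  | nil => rfl
  | cons a φ ih => simp [ih]

/-! ### Values on strings and a cost that orients Yang–Baxter -/

/-- How a gate transforms values carried by its strings: the string that a crossing moves to
the left gains one. -/
def Gate.transform : Gate Atom → List ℕ → List ℕ
  | .swap _ _, [x, y] => [y + 1, x]
  | g, _ => List.replicate g.tgt.length 0

/-- The cost of a gate: for a crossing, the value of its left string. -/
def Gate.cost : Gate Atom → List ℕ → ℕ
  | .swap _ _, [x, _] => x
  | _, _ => 0

theorem Gate.length_transform (g : Gate Atom) (s : List ℕ) :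
    (g.transform s).length = g.tgt.length := by
  unfold transform
  split <;> simp [tgt]

/-- The inputs of the gate of a layer. -/
def Layer.inputs (a : Layer Atom) (s : List ℕ) : List ℕ :=
  (s.drop a.left.length).take a.gate.src.length

/-- The values beneath a layer. -/
def Layer.transform (a : Layer Atom) (s : List ℕ) : List ℕ :=
  s.take a.left.length ++ a.gate.transform (a.inputs s) ++
    s.drop (a.left.length + a.gate.src.length)

/-- The values beneath a diagram. -/
def transform : List ℕ → List (Layer Atom) → List ℕ
  | s, [] => s
  | s, a :: φ => transform (a.transform s) φ

/-- The sum of the costs of the gates. -/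
def totalCost : List ℕ → List (Layer Atom) → ℕ
  | _, [] => 0
  | s, a :: φ => a.gate.cost (a.inputs s) + totalCost (a.transform s) φ

theorem totalCost_append (s : List ℕ) (φ ψ : List (Layer Atom)) :
    totalCost s (φ ++ ψ) = totalCost s φ + totalCost (transform s φ) ψ := by
  induction φ generalizing s with
  | nil => simp [totalCost, transform]
  | cons a φ ih => simp [totalCost, transform, ih, Nat.add_assoc]

theorem Layer.inputs_append {l r : Word Atom} {g : Gate Atom} {x y z : List ℕ}
    (hx : x.length = l.length) (hy : y.length = g.src.length) :
    (⟨l, g, r⟩ : Layer Atom).inputs (x ++ (y ++ z)) = y := by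
  simp [inputs, ← hx, ← hy]

theorem Layer.transform_append {l r : Word Atom} {g : Gate Atom} {x y z : List ℕ}
    (hx : x.length = l.length) (hy : y.length = g.src.length) :
    (⟨l, g, r⟩ : Layer Atom).transform (x ++ (y ++ z)) = x ++ (g.transform y ++ z) := by
  simp [transform, inputs_append hx hy]
  simp [← hx, ← hy]

theorem exists_append_of_length {α : Type*} {s : List α} {m n : ℕ} (h : s.length = m + n) :
    ∃ x y, s = x ++ y ∧ x.length = m ∧ y.length = n :=
  ⟨s.take m, s.drop m, by simp, by simp [h], by simp [h]⟩

theorem length_transform {w w' : Word Atom} {φ : List (Layer Atom)} (h : IsDiagram w φ w')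
    {s : List ℕ} (hs : s.length = w.length) : (transform s φ).length = w'.length := by
  induction φ generalizing w s with
  | nil =>
    have h : w = w' := h
    rw [← h, ← hs]
    rfl
  | cons a φ ih =>
    obtain ⟨rfl, h⟩ := h
    refine ih h ?_
    simp only [List.length_append] at hs
    simp [Layer.transform, Gate.length_transform, hs]
    omega

/-- The cost and the output of a gate depend on the values of its own strings alone, so the order of
two disjoint gates does not matter. The cost is thus a measure on diagrams up to interchange, as
irreducibility requires. -/
theorem Interchange.totalCost_eq {φ ψ : List (Layer Atom)} (h : Interchange φ ψ)
    {w w' : Word Atom} (hd : IsDiagram w φ w') {s : List ℕ} (hs : s.length = w.length) :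
    totalCost s φ = totalCost s ψ := by
  obtain ⟨p, q, l, x, r, g, g'⟩ := h
  rw [List.append_assoc] at hd
  obtain ⟨m, hp, hd⟩ := isDiagram_append_iff.1 hd
  obtain ⟨rfl, -⟩ := hd
  have hl := length_transform hp hs
  simp only [List.append_assoc, totalCost_append]
  generalize transform s p = t at hl
  simp only [List.length_append, Nat.add_assoc] at hl
  obtain ⟨t₁, t, rfl, h₁, hl⟩ := exists_append_of_length hl
  obtain ⟨t₂, t, rfl, h₂, hl⟩ := exists_append_of_length hl
  obtain ⟨t₃, t, rfl, h₃, hl⟩ := exists_append_of_length hl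
  obtain ⟨t₄, t₅, rfl, h₄, h₅⟩ := exists_append_of_length hl
  have e₁ : (t₁ ++ (t₂ ++ t₃)).length = (l ++ (g.src ++ x)).length := by simp [h₁, h₂, h₃]
  have e₂ : (t₁ ++ (g.transform t₂ ++ t₃)).length = (l ++ (g.tgt ++ x)).length := by
    simp [h₁, h₃, Gate.length_transform]
  have a₁ := Layer.inputs_append (r := r) (z := t₅) e₁ h₄
  have a₂ := Layer.transform_append (r := r) (z := t₅) e₁ h₄
  have a₃ := Layer.inputs_append (r := r) (z := t₅) e₂ h₄
  have a₄ := Layer.transform_append (r := r) (z := t₅) e₂ h₄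
  simp only [List.append_assoc] at a₁ a₂ a₃ a₄
  simp only [transform, totalCost,
    Layer.inputs_append h₁ h₂, Layer.transform_append h₁ h₂, a₁, a₂, a₃, a₄]
  omega

theorem eqvGen_interchange_totalCost_eq {φ ψ : List (Layer Atom)}
    (h : Relation.EqvGen Interchange φ ψ) {w w' : Word Atom} (hd : IsDiagram w φ w')
    {s : List ℕ} (hs : s.length = w.length) : totalCost s φ = totalCost s ψ := by
  induction h with
  | rel _ _ h => exact h.totalCost_eq hd hs
  | refl => rfl
  | symm _ _ h ih => exact (ih ((eqvGen_interchange_isDiagram_iff h).2 hd)).symm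
  | trans _ _ _ h _ ih₁ ih₂ =>
    exact (ih₁ hd).trans (ih₂ ((eqvGen_interchange_isDiagram_iff h).1 hd))

theorem eqvGen_interchange_totalWeight_eq {φ ψ : List (Layer Atom)}
    (h : Relation.EqvGen Interchange φ ψ) : totalWeight φ = totalWeight ψ := by
  induction h with
  | rel _ _ h =>
    obtain ⟨p, q, l, x, r, g, g'⟩ := h
    simp
    omega
  | refl => rfl
  | symm _ _ h ih => exact ih.symm
  | trans _ _ _ h _ ih₁ ih₂ => exact ih₁.trans ih₂

theorem eqvGen_interchange_isControl {φ ψ : List (Layer Atom)}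
    (h : Relation.EqvGen Interchange φ ψ) :
    (∀ a ∈ φ, a.gate.IsControl) ↔ ∀ a ∈ ψ, a.gate.IsControl := by
  induction h with
  | rel _ _ h =>
    obtain ⟨p, q, l, x, r, g, g'⟩ := h
    simp only [List.mem_append, or_imp, forall_and, List.forall_mem_cons]
    tauto
  | refl => rfl
  | symm _ _ h ih => exact ih.symm
  | trans _ _ _ h _ ih₁ ih₂ => exact ih₁.trans ih₂

/-- Besides the common typing of both sides, the source is nonempty; this makes the word at which a
rule is applied recoverable from the surrounding diagram. -/
theorem ControlRule.exists_isDiagram {φ ψ : List (Layer Atom)} (h : ControlRule φ ψ) :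
    ∃ u v, IsDiagram u φ v ∧ IsDiagram u ψ v ∧ φ ≠ [] := by
  cases h with
  | involution A B => refine ⟨[.fm A, .fm B], [.fm A, .fm B], ?_, ?_, by simp⟩ <;>
      simp [IsDiagram, Gate.src, Gate.tgt]
  | yangBaxter A B C =>
    refine ⟨[.fm A, .fm B, .fm C], [.fm C, .fm B, .fm A], ?_, ?_, by simp⟩ <;>
      simp [IsDiagram, Gate.src, Gate.tgt]
  | par_left A B C =>
    refine ⟨[.fm A, .fm B, .fm C], [.fm C, .fm (.par A B)], ?_, ?_, by simp⟩ <;>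
      simp [IsDiagram, Gate.src, Gate.tgt]
  | par_right A B C =>
    refine ⟨[.fm A, .fm B, .fm C], [.fm (.par B C), .fm A], ?_, ?_, by simp⟩ <;>
      simp [IsDiagram, Gate.src, Gate.tgt]
  | ax A => refine ⟨[], [.L, .fm A.neg, .fm A, .R], ?_, ?_, by simp⟩ <;>
      simp [IsDiagram, Gate.src, Gate.tgt, Formula.neg_neg]
  | bot_left A => refine ⟨[.fm A], [.fm A, .fm .bot], ?_, ?_, by simp⟩ <;>
      simp [IsDiagram, Gate.src, Gate.tgt]
  | bot_right A => refine ⟨[.fm A], [.fm .bot, .fm A], ?_, ?_, by simp⟩ <;>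
      simp [IsDiagram, Gate.src, Gate.tgt]

theorem ControlRule.isControl {φ ψ : List (Layer Atom)} (h : ControlRule φ ψ) :
    ∀ a ∈ ψ, a.gate.IsControl := by
  cases h <;> simp [Gate.IsControl]

/-- Each rule lowers the weight, or keeps the weight and the values and lowers the cost. -/
theorem ControlRule.decreases {φ ψ : List (Layer Atom)} (h : ControlRule φ ψ) :
    totalWeight ψ < totalWeight φ ∨ totalWeight ψ = totalWeight φ ∧
      ∀ (u v l r : Word Atom) (s : List ℕ), IsDiagram u φ v →
        s.length = (l ++ u ++ r).length →
        transform s (whisk l r ψ) = transform s (whisk l r φ) ∧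
          totalCost s (whisk l r ψ) < totalCost s (whisk l r φ) := by
  cases h with
  | yangBaxter A B C =>
    -- Each pair of strings crosses once on both sides, so the weight is constant. On values `a, b,
    -- c` the source costs `a + a + (b + 1)` and the target `b + a + a`, and both end with `c + 2, b
    -- + 1, a`. The increment in `Gate.transform` is there to create this difference.
    refine Or.inr ⟨by simp [Gate.weight]; ring, fun u v l r s hd hs => ?_⟩
    obtain ⟨rfl, -⟩ := hd
    simp only [List.length_append, Gate.src, Nat.add_assoc, List.length_cons,
      List.length_nil] at hs
    obtain ⟨t₁, t, rfl, h₁, hs⟩ := exists_append_of_length hs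
    obtain ⟨a, t, rfl⟩ : ∃ a t', t = a :: t' := List.exists_cons_of_length_pos (by omega)
    obtain ⟨b, t, rfl⟩ : ∃ a t', t = a :: t' :=
      List.exists_cons_of_length_pos (by simp at hs; omega)
    obtain ⟨c, t, rfl⟩ : ∃ a t', t = a :: t' :=
      List.exists_cons_of_length_pos (by simp at hs; omega)
    have k₁ (A B : Formula Atom) (r : Word Atom) (x y : ℕ) (z : List ℕ) :=
      Layer.inputs_append (l := l) (g := .swap A B) (r := r) (x := t₁) (y := [x, y]) (z := z)
        h₁ rfl
    have k₂ (A B : Formula Atom) (r : Word Atom) (x y : ℕ) (z : List ℕ) :=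
      Layer.transform_append (l := l) (g := .swap A B) (r := r) (x := t₁) (y := [x, y]) (z := z)
        h₁ rfl
    have k₃ (A B C : Formula Atom) (r : Word Atom) (x y z : ℕ) (t : List ℕ) :=
      Layer.inputs_append (l := l ++ [.fm C]) (g := .swap A B) (r := r) (x := t₁ ++ [x])
        (y := [y, z]) (z := t) (by simp [h₁]) rfl
    have k₄ (A B C : Formula Atom) (r : Word Atom) (x y z : ℕ) (t : List ℕ) :=
      Layer.transform_append (l := l ++ [.fm C]) (g := .swap A B) (r := r) (x := t₁ ++ [x])
        (y := [y, z]) (z := t) (by simp [h₁]) rfl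
    simp only [List.append_assoc, List.cons_append, List.nil_append, Gate.transform]
      at k₁ k₂ k₃ k₄
    simp [transform, totalCost, k₁, k₂, k₃, k₄, Gate.cost]
    omega
  | par_left A B C =>
    -- The crossing in the source weighs `(|A| + |B| + 1) * |C|`, the two in the target `(|A| + |B|)
    -- * |C|` together.
    have := C.weight_pos
    left
    simp [Gate.weight, Formula.weight]
    nlinarith
  | par_right A B C =>
    have := A.weight_pos
    left
    simp [Gate.weight, Formula.weight]
    nlinarith
  | _ =>
    left
    simp [Gate.weight, Formula.weight_pos]

/-- Each diagram of control gates from the empty word is equal to an irreducible one. -/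
theorem exists_irreducible {φ : List (Layer Atom)} {w : Word Atom} (hd : IsDiagram [] φ w)
    (hc : ∀ a ∈ φ, a.gate.IsControl) : ∃ ψ, IrreducibleDiagram ψ ∧ SEq [] w φ ψ := by
  -- Lexicographic induction on the total weight and then on the total cost. No input values are
  -- needed, as the diagram starts from the empty word.
  generalize hm : totalWeight φ = m
  induction m using Nat.strong_induction_on generalizing φ with
  | _ m ihm =>
  generalize hn : totalCost [] φ = n
  induction n using Nat.strong_induction_on generalizing φ with
  | _ n ihn =>
  by_cases hi : IrreducibleDiagram φ
  · exact ⟨φ, hi, .refl hd⟩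
  · simp only [IrreducibleDiagram, not_and, not_forall, not_not] at hi
    obtain ⟨ψ, ψ', he, hr⟩ := hi hc
    have s := SEq.of_eqvGen he hd
    have hc' := (eqvGen_interchange_isControl he).1 hc
    rw [eqvGen_interchange_totalWeight_eq he] at hm
    rw [eqvGen_interchange_totalCost_eq he hd rfl] at hn
    obtain ⟨p, q, l, r, x, y, hr⟩ := hr
    obtain ⟨u, v, dx, dy, hx⟩ := hr.exists_isDiagram
    have s' := s.trans ((SEq.of_control hr dx dy).subst hx l r p q s.right)
    have hc'' : ∀ a ∈ p ++ whisk l r y ++ q, a.gate.IsControl := by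
      simp only [List.mem_append, or_imp, forall_and] at hc' ⊢
      refine ⟨⟨hc'.1.1, fun a ha => ?_⟩, hc'.2⟩
      obtain ⟨b, hb, rfl⟩ := List.mem_map.1 ha
      exact hr.isControl b hb
    rcases hr.decreases with h | ⟨h, h'⟩
    · obtain ⟨χ, hχ, s''⟩ := ihm (totalWeight (p ++ whisk l r y ++ q))
        (by rw [← hm]; simpa using h) s'.right hc'' rfl
      exact ⟨χ, hχ, s'.trans s''⟩
    -- This is a Yang–Baxter step: it leaves the values beneath it unchanged, hence also the cost of
    -- the layers `q`, and the drop is local.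
    · obtain ⟨m', hd₁, hd₂⟩ := isDiagram_append_iff.1 s.right
      obtain ⟨m'', hd₁, hd₃⟩ := isDiagram_append_iff.1 hd₁
      obtain rfl := IsDiagram.src_unique (mt whisk_eq_nil.1 hx) hd₃ (dx.whisk l r)
      obtain ⟨h₁, h₂⟩ := h' u v l r _ dx (length_transform (s := []) hd₁ rfl)
      obtain ⟨χ, hχ, s''⟩ := ihn (totalCost [] (p ++ whisk l r y ++ q))
        (by rw [← hn]; simpa [totalCost_append, h₁] using h₂) s'.right hc''
        (by rw [← hm]; simpa using h) rfl
      exact ⟨χ, hχ, s'.trans s''⟩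

/-! ### Composition with automatic matching of the intermediate words -/

/-- Composition of diagrams up to a computation of the intermediate word. -/
theorem IsDiagram.comp {w m m' w' : Word Atom} {φ ψ : List (Layer Atom)}
    (h : IsDiagram w φ m) (h' : IsDiagram m' ψ w')
    (e : m = m' := by simp [sequent, Gate.src, Gate.tgt, Formula.neg, Formula.neg_neg]) :
    IsDiagram w (φ ++ ψ) w' := by
  subst e
  exact h.append h'

/-- Composition of equalities up to a computation of the intermediate word. -/
theorem SEq.comp {w m m' w' : Word Atom} {φ ψ φ' ψ' : List (Layer Atom)}
    (h : SEq w m φ φ') (h' : SEq m' w' ψ ψ')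
    (e : m = m' := by simp [sequent, Gate.src, Gate.tgt, Formula.neg, Formula.neg_neg]) :
    SEq w w' (φ ++ ψ) (φ' ++ ψ') := by
  subst e
  exact h.append h'

/-- A rule whose sides are typed up to a computation of their words. -/
theorem SEq.of_rule_of {w w' v v' : Word Atom} {φ ψ : List (Layer Atom)} (h : SemRule φ ψ)
    (hφ : IsDiagram w φ w') (hψ : IsDiagram v ψ v')
    (e : v = w := by simp [sequent, Gate.src, Gate.tgt, Formula.neg, Formula.neg_neg])
    (e' : v' = w' := by simp [sequent, Gate.src, Gate.tgt, Formula.neg, Formula.neg_neg]) :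
    SEq w w' φ ψ := by
  subst e e'
  exact .of_rule h hφ hψ

theorem isDiagram_gate (l r : Word Atom) (g : Gate Atom) :
    IsDiagram (l ++ g.src ++ r) [⟨l, g, r⟩] (l ++ g.tgt ++ r) :=
  ⟨rfl, rfl⟩

/-! ## Naturality of crossings -/

/-- A gate that slides through single strings slides through blocks. -/
theorem seq_gate_cross {g : Gate Atom} {Δ : List (Formula Atom)} {X : Formula Atom}
    (hs : g.src = fms Δ) (ht : g.tgt = [.fm X])
    (hg : ∀ A, SEq (fms (A :: Δ)) (fms [X, A]) [⟨[.fm A], g, []⟩, ⟨[], .swap A X, []⟩]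
      (crossOne A Δ ++ [⟨[], g, [.fm A]⟩])) (Γ : List (Formula Atom)) :
    SEq (fms (Γ ++ Δ)) (fms (X :: Γ)) (⟨fms Γ, g, []⟩ :: cross Γ [X])
      (cross Γ Δ ++ [⟨[], g, fms Γ⟩]) := by
  induction Γ with
  | nil =>
    refine SEq.refl ?_
    simp [IsDiagram, hs, ht]
  | cons A Γ ih =>
    have k₁ := (ih.whisk [.fm A] []).append (w'' := fms (X :: A :: Γ))
      (SEq.refl (φ := [⟨[], .swap A X, fms Γ⟩]) (by simp [IsDiagram, Gate.src, Gate.tgt]))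
    have k₂ := (SEq.refl ((isDiagram_cross Γ Δ).whisk [.fm A] [])).append
      (by simpa using (hg A).whisk [] (fms Γ))
    exact SEq.trans (by simpa [cross, crossOne] using k₁) (by simpa [cross] using k₂)

/-- The rule introduces its formula at the end of the sequent, while the right premise of a cut has
its active formula in front. This lemma makes the gate act at the front. -/
theorem seq_par_cross (Γ : List (Formula Atom)) (A B : Formula Atom) :
    SEq (fms (Γ ++ [A, B])) (fms (.par A B :: Γ)) (⟨fms Γ, .par A B, []⟩ :: cross Γ [.par A B])
      (cross Γ [A, B] ++ [⟨[], .par A B, fms Γ⟩]) :=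
  seq_gate_cross rfl rfl (fun C => SEq.of_control (by simpa [crossOne] using .par_right C A B)
    (by simp [IsDiagram, Gate.src, Gate.tgt])
    (by simp [IsDiagram, Gate.src, Gate.tgt, crossOne])) Γ

/-- A gate without inputs leaves no strings to cross, so the crossings disappear. -/
theorem seq_bot_cross (Γ : List (Formula Atom)) :
    SEq (fms Γ) (fms (.bot :: Γ)) (⟨fms Γ, .bot, []⟩ :: cross Γ [.bot])
      [⟨[], .bot, fms Γ⟩] := by
  simpa using seq_gate_cross (g := .bot) (Δ := []) (X := .bot) rfl rfl
    (fun C => SEq.of_control (by simpa [crossOne] using .bot_right C)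
    (by simp [IsDiagram, Gate.src, Gate.tgt])
    (by simp [IsDiagram, Gate.src, Gate.tgt, crossOne])) Γ

theorem IsSplit.src_eq {A B : Formula Atom} {g : Gate Atom} {a : List (Formula Atom)}
    (hg : IsSplit A B g a) : g.src = [.fm A, .R, .L, .fm B] := by
  cases hg <;> rfl

theorem IsSplit.tgt_eq {A B : Formula Atom} {g : Gate Atom} {a : List (Formula Atom)}
    (hg : IsSplit A B g a) : g.tgt = fms a := by
  cases hg <;> rfl

/-- Permutations of the side formulas of a binary rule. -/
theorem seq_joined_exch {Γ Δ Θ Θ' : List (Formula Atom)} {A B : Formula Atom} {g : Gate Atom}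
    {a : List (Formula Atom)} (hg : IsSplit A B g a) {φ ψ ρ ρ' : List (Layer Atom)}
    (hφ : IsDiagram [] φ (sequent (Γ ++ [A]))) (hψ : IsDiagram [] ψ (sequent (B :: Δ)))
    (hρ : IsDiagram (fms Γ) ρ (fms Θ)) (hρ' : IsDiagram (fms Δ) ρ' (fms Θ')) :
    SEq [] (sequent (Θ ++ a ++ Θ'))
      (joined Θ Θ' A g (φ ++ whisk [.L] [.fm A, .R] ρ) (ψ ++ whisk [.L, .fm B] [.R] ρ'))
      (joined Γ Δ A g φ ψ ++ whisk [.L] [.R]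
        (whisk [] (fms a ++ fms Δ) ρ ++ whisk (fms Θ ++ fms a) [] ρ')) := by
  have dg : IsDiagram [.fm A, .R, .L, .fm B] [⟨[], g, []⟩] (fms a) := by
    simp [IsDiagram, hg.src_eq, hg.tgt_eq]
  -- `ρ` passes `ψ` and then the gate `g`, and `ρ'` passes `g`; none of these act on common strings.
  have i₁ := seq_interchange_whisk dg hρ' (.L :: fms Θ) [] [.R]
  have i₂ := seq_interchange_whisk hρ dg [.L] [] (fms Δ ++ [.R])
  have i₃ := seq_interchange (hρ.whisk [.L] [.fm A, .R]) hψ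
  have dρ := hρ.whisk [.L] ([.fm A, .R, .L, .fm B] ++ fms Δ ++ [.R])
  have dρ₂ := hρ'.whisk (.L :: (fms Θ ++ [.fm A, .R, .L, .fm B])) [.R]
  have dρ₃ := hρ'.whisk (.L :: (fms Θ ++ fms a)) [.R]
  have dg' := dg.whisk (.L :: fms Θ) (fms Θ' ++ [.R])
  have dψ := hψ.whisk (sequent (Γ ++ [A])) []
  have j₁ := (SEq.refl (by simpa [sequent] using hφ)).append (i₃.append (w'' :=
    sequent (Θ ++ a ++ Θ')) (SEq.refl
      (φ := whisk (.L :: (fms Θ ++ [.fm A, .R, .L, .fm B])) [.R] ρ' ++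
        [⟨.L :: fms Θ, g, fms Θ' ++ [.R]⟩])
      (IsDiagram.append (by simpa [sequent] using dρ₂) (by simpa [sequent] using dg'))))
  have j₂ := (SEq.refl (hφ.append (by simpa using dψ))).append (w'' := sequent (Θ ++ a ++ Θ'))
    (SEq.append (SEq.refl (by simpa [sequent] using dρ)) (by simpa [sequent] using i₁.symm))
  have j₃ := (SEq.refl (hφ.append (by simpa using dψ))).append (w'' := sequent (Θ ++ a ++ Θ'))
    (SEq.append (by simpa [sequent] using i₂)
      (SEq.refl (by simpa [sequent] using dρ₃)))
  refine SEq.trans (by simpa [joined, sequent] using j₁) (SEq.trans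
    (by simpa [joined, sequent] using j₂) (by simpa [joined, sequent] using j₃))

/-! ## Cuts -/

/-- A permutation of two positions is the identity or the transposition, and the transposition is
absorbed by the axiom relation. In both cases the result is the axiom whose first formula is `B`. -/
theorem ExchOf.seq_ax {X Y A B : Formula Atom} {hX : Y = X.neg} {σ : Exch [X, Y] [B, A]}
    {e : Derivation [B, A]} (h : ExchOf σ (.ax X Y hX) e) :
    SEq [] (sequent [B, A]) e.diagram [⟨[], .ax B, []⟩] := by
  subst hX
  have g₀ := σ.get_eq 0
  have g₁ := σ.get_eq 1
  have hne : σ.toEquiv 0 ≠ σ.toEquiv 1 := fun h => by simpa using σ.toEquiv.injective h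
  obtain ⟨f, hf⟩ : ∃ f : Fin [B, A].length → Fin [X, X.neg].length, ∀ i, σ.toEquiv i = f i :=
    ⟨_, fun _ => rfl⟩
  have hcases : ∀ i : Fin 2, i = 0 ∨ i = 1 := by decide
  rcases hcases (σ.toEquiv 0) with h₀ | h₀ <;> rcases hcases (σ.toEquiv 1) with h₁ | h₁
  · exact absurd (h₀.trans h₁.symm) hne
  · rw [h₀] at g₀
    rw [h₁] at g₁
    obtain rfl : B = X := g₀
    obtain rfl : A = B.neg := g₁
    have : σ = Exch.refl _ := by
      ext i
      rcases hcases i with rfl | rfl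
      · rw [h₀]; rfl
      · rw [h₁]; rfl
    subst this
    simpa [Derivation.diagram] using h.seq (.nil _)
  · rw [h₀] at g₀
    rw [h₁] at g₁
    obtain rfl : B = X.neg := g₀
    obtain rfl : A = X := g₁
    have : σ = Exch.comm [A] [A.neg] := by
      ext i
      rcases hcases i with rfl | rfl
      · rw [h₀]; rfl
      · rw [h₁]; rfl
    subst this
    refine (h.seq (.comm [A] [A.neg])).trans (SEq.of_control ?_ ?_ ?_)
    · simpa [Derivation.diagram, cross, crossOne] using ControlRule.ax A
    · exact (h.seq (.comm [A] [A.neg])).right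
    · simp [IsDiagram, Gate.src, Gate.tgt, sequent, Formula.neg_neg]
  · exact absurd (h₀.trans h₁.symm) hne

theorem seq_cut_ax_right {Γ : List (Formula Atom)} (A : Formula Atom) {φ : List (Layer Atom)}
    (hφ : IsDiagram [] φ (sequent (Γ ++ [A]))) :
    SEq [] (sequent (Γ ++ [A])) (joined Γ [A] A (.cut A) φ [⟨[], .ax A.neg, []⟩]) φ := by
  have s : SEq [.fm A, .R] [.fm A, .R]
      [⟨[.fm A, .R], .ax A.neg, []⟩, ⟨[], .cut A, [.fm A, .R]⟩] [] :=
    .of_rule (.ax_right A) (by simp [IsDiagram, Gate.src, Gate.tgt, Formula.neg_neg]) rfl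
  have k := (SEq.refl hφ).comp (s.whisk (.L :: fms Γ) [])
  simpa only [joined, sequent, whisk_nil, List.append_nil, whisk_cons, List.append_assoc,
    List.cons_append, fms_append, fms_cons, fms_nil, List.nil_append] using k

theorem seq_cut_ax_left {Δ : List (Formula Atom)} (B : Formula Atom) {φ : List (Layer Atom)}
    (hφ : IsDiagram [] φ (sequent (B :: Δ))) :
    SEq [] (sequent (B :: Δ)) (joined [B] Δ B.neg (.cut B.neg) [⟨[], .ax B, []⟩] φ) φ := by
  have s : SEq [.L, .fm B] [.L, .fm B]
      [⟨[], .ax B, [.L, .fm B]⟩, ⟨[.L, .fm B], .cut B.neg, []⟩] [] :=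
    .of_rule (.ax_left B) (by simp [IsDiagram, Gate.src, Gate.tgt, Formula.neg_neg]) rfl
  have dax : IsDiagram [] [⟨[], .ax B, []⟩] (sequent [B, B.neg]) := by
    simp [IsDiagram, Gate.src, Gate.tgt, sequent]
  have dcut : IsDiagram (sequent [B, B.neg] ++ sequent (B :: Δ))
      [⟨[.L, .fm B], .cut B.neg, fms Δ ++ [.R]⟩] (sequent (B :: Δ)) := by
    simp [IsDiagram, Gate.src, Gate.tgt, sequent, Formula.neg_neg]
  -- The axiom is created before `φ`; it is moved down next to the cut, where the relation applies.
  have k₁ := (seq_interchange dax hφ).comp (SEq.refl dcut)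
  have k₂ := (SEq.refl hφ).comp (s.whisk [] (fms Δ ++ [.R]))
  refine SEq.trans (by simpa [joined, sequent] using k₁) (by simpa [sequent] using k₂)

/-- When the three premises are created before all gates and crossings between them, what follows on
each side contains one side of the `⊗/⅋` relation. Interchange with `φ₃` achieves this: once for the
`⊗` gate with its crossing, once for the crossing of `B` with `Δ`. -/
theorem seq_cut_tensor_par {Γ Δ Ξ : List (Formula Atom)} {A B : Formula Atom}
    {φ₁ φ₂ φ₃ : List (Layer Atom)} (h₁ : IsDiagram [] φ₁ (sequent (Γ ++ [A])))
    (h₂ : IsDiagram [] φ₂ (sequent (B :: Δ)))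
    (h₃ : IsDiagram [] φ₃ (sequent (B.neg :: A.neg :: Ξ))) :
    SEq [] (sequent (Γ ++ Δ ++ Ξ))
      (joined (Γ ++ Δ) Ξ (.tensor A B) (.cut (.tensor A B))
        (joined Γ Δ A (.tensor A B) φ₁ φ₂ ++
          whisk (.L :: fms Γ) [.R] (cross [.tensor A B] Δ))
        (φ₃ ++ [⟨[.L], .par B.neg A.neg, fms Ξ ++ [.R]⟩]))
      (joined Γ (Δ ++ Ξ) A (.cut A) φ₁
        (joined Δ (A.neg :: Ξ) B (.cut B) (φ₂ ++ whisk [.L] [.R] (cross [B] Δ)) φ₃ ++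
          whisk [.L] (fms Ξ ++ [.R]) (cross Δ [A.neg]))) := by
  have dtens : IsDiagram (sequent (Γ ++ [A]) ++ sequent (B :: Δ))
      (⟨.L :: fms Γ, .tensor A B, fms Δ ++ [.R]⟩ ::
        whisk (.L :: fms Γ) [.R] (cross [.tensor A B] Δ)) (sequent (Γ ++ Δ ++ [.tensor A B])) :=
    ⟨by simp [sequent, Gate.src], by
      simpa [sequent, Gate.tgt] using (isDiagram_cross [.tensor A B] Δ).whisk (.L :: fms Γ) [.R]⟩
  have dM := h₁.comp (h₂.whisk (sequent (Γ ++ [A])) [])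
  have s := SEq.of_rule_of (SemRule.tensor_par A B Δ)
    ((((isDiagram_gate [] (fms Δ ++ [.R, .L, .fm B.neg, .fm A.neg]) (.tensor A B)).comp
      ((isDiagram_crossOne (.tensor A B) Δ).whisk [] [.R, .L, .fm B.neg, .fm A.neg]))).comp
      ((isDiagram_gate (fms Δ ++ [.fm (.tensor A B), .R, .L]) [] (.par B.neg A.neg)).comp
        (isDiagram_gate (fms Δ) [] (.cut (.tensor A B)))))
    (((((isDiagram_crossOne B Δ).whisk [.fm A, .R, .L] [.R, .L, .fm B.neg, .fm A.neg]).comp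
      (isDiagram_gate ([.fm A, .R, .L] ++ fms Δ) [.fm A.neg] (.cut B))).comp
      ((isDiagram_cross Δ [A.neg]).whisk [.fm A, .R, .L] [])).comp
      (isDiagram_gate [] (fms Δ) (.cut A)))
  have dX : IsDiagram (sequent (Γ ++ Δ ++ [.tensor A B]) ++ sequent (B.neg :: A.neg :: Ξ))
      [⟨.L :: (fms (Γ ++ Δ ++ [.tensor A B]) ++ [.R, .L]), .par B.neg A.neg, fms Ξ ++ [.R]⟩,
        ⟨.L :: fms (Γ ++ Δ), .cut (.tensor A B), fms Ξ ++ [.R]⟩] (sequent (Γ ++ Δ ++ Ξ)) := by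
    simp [IsDiagram, Gate.src, Gate.tgt, sequent, Formula.neg]
  have k₁ := (SEq.refl dM).comp ((seq_interchange dtens h₃).comp (SEq.refl dX))
  have k₂ := ((SEq.refl dM).comp (SEq.refl (h₃.whisk
    (sequent (Γ ++ [A]) ++ sequent (B :: Δ)) []))).comp (s.whisk (.L :: fms Γ) (fms Ξ ++ [.R]))
  have dcr : IsDiagram (sequent (B :: Δ)) (whisk [.L] [.R] (cross [B] Δ))
      (sequent (Δ ++ [B])) := by
    simpa [sequent] using (isDiagram_cross [B] Δ).whisk [.L] [.R]
  have dY := ((isDiagram_gate (.L :: (fms (Γ ++ [A]) ++ .R :: .L :: fms Δ))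
    (.fm A.neg :: fms Ξ ++ [.R]) (.cut B)).comp
    ((isDiagram_cross Δ [A.neg]).whisk (.L :: (fms (Γ ++ [A]) ++ [.R, .L])) (fms Ξ ++ [.R]))).comp
    (isDiagram_gate (.L :: fms Γ) (fms (Δ ++ Ξ) ++ [.R]) (.cut A))
  have k₃ := (SEq.refl dM).comp (((seq_interchange dcr h₃).whisk (sequent (Γ ++ [A])) []).comp
    (SEq.refl dY))
  simp only [joined, sequent, cross_singleton, whisk_append, whisk_cons, whisk_nil, whisk_whisk,
    List.append_assoc, List.cons_append, List.nil_append, List.append_nil, fms_append, fms_cons,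
    fms_nil, Gate.tgt] at k₁ k₂ k₃ ⊢
  exact k₁.trans (k₂.trans k₃.symm)

/-- Serves the instance of the introduction relation in which both joining diagrams `N` and `N'` are
empty. -/
theorem irreducibleDiagram_nil : IrreducibleDiagram ([] : List (Layer Atom)) := by
  refine ⟨by simp, fun ψ ψ' h hr => ?_⟩
  have e : ∀ φ ψ : List (Layer Atom), Relation.EqvGen Interchange φ ψ → (φ = [] ↔ ψ = []) := by
    intro φ ψ h
    induction h with
    | rel _ _ h => obtain ⟨p, q, l, x, r, g, g'⟩ := h; simp
    | refl => rfl
    | symm _ _ _ ih => exact ih.symm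
    | trans _ _ _ _ _ ih₁ ih₂ => exact ih₁.trans ih₂
  have h := (e _ _ h).1 rfl
  obtain ⟨p, q, l, r, x, y, hr⟩ := hr
  obtain ⟨-, -, -, -, hx⟩ := hr.exists_isDiagram
  simp [whisk_eq_nil, hx] at h

/-- Two cuts against formulas of the same sequent may be performed in either order. -/
theorem seq_cut_cut {Γ Δ Ξ : List (Formula Atom)} {A B : Formula Atom}
    {φ φ₁ φ₂ : List (Layer Atom)} (hφ : IsDiagram [] φ (sequent (Γ ++ [B, A])))
    (h₁ : IsDiagram [] φ₁ (sequent (A.neg :: Ξ))) (h₂ : IsDiagram [] φ₂ (sequent (B.neg :: Δ)))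
    (pφ : Plain φ) (p₁ : Plain φ₁) (p₂ : Plain φ₂) :
    SEq [] (sequent (Γ ++ Ξ ++ Δ))
      (joined (Γ ++ Ξ) Δ B (.cut B) (joined (Γ ++ [B]) Ξ A (.cut A) φ φ₁ ++
        whisk (.L :: fms Γ) [.R] (cross [B] Ξ)) φ₂)
      (joined (Γ ++ Δ) Ξ A (.cut A) (joined (Γ ++ [A]) Δ B (.cut B)
        (φ ++ whisk (.L :: fms Γ) [.R] (cross [B] [A])) φ₂ ++
        whisk (.L :: fms Γ) [.R] (cross [A] Δ)) φ₁ ++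
        whisk (.L :: fms Γ) [.R] (cross Δ Ξ)) := by
  -- The introduction relation is imposed for irreducible premises only. They are replaced by
  -- irreducible equals before it is applied (`k₂`) and put back afterwards (`k₃`).
  obtain ⟨ψ, iψ, e⟩ := exists_irreducible hφ pφ.2
  obtain ⟨ψ₁, i₁, e₁⟩ := exists_irreducible h₁ p₁.2
  obtain ⟨ψ₂, i₂, e₂⟩ := exists_irreducible h₂ p₂.2
  have eM := (e.comp (e₁.whisk (sequent (Γ ++ [B, A])) [])).comp
    (e₂.whisk (sequent (Γ ++ [B, A]) ++ sequent (A.neg :: Ξ)) [])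
  have dZ := (isDiagram_gate (.L :: fms (Γ ++ [B])) (fms Ξ ++ [.R]) (.cut A)).comp
    ((isDiagram_cross [B] Ξ).whisk (.L :: fms Γ) [.R])
  have dcut := isDiagram_gate (.L :: fms (Γ ++ Ξ)) (fms Δ ++ [.R]) (.cut B)
  have dK₁ := (dZ.whisk [] (sequent (B.neg :: Δ))).comp dcut
  have dY := (isDiagram_gate (.L :: fms (Γ ++ [A])) (fms Δ ++ [.R]) (.cut B)).comp
    ((isDiagram_cross [A] Δ).whisk (.L :: fms Γ) [.R])
  have dcut' := (isDiagram_gate (.L :: fms (Γ ++ Δ)) (fms Ξ ++ [.R]) (.cut A)).comp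
    ((isDiagram_cross Δ Ξ).whisk (.L :: fms Γ) [.R])
  have dX := (isDiagram_cross [B] [A]).whisk (.L :: fms Γ) [.R]
  have dbig := isDiagram_gate (sequent (Γ ++ [A, B])) []
    (.big ((A.neg :: Ξ).map some) ((B.neg :: Δ).map some))
  simp only [Gate.src, Gate.tgt, sheaf_map_some] at dbig
  have dK₂ := ((dX.whisk [] (sequent (A.neg :: Ξ) ++ sequent (B.neg :: Δ))).comp dbig).comp
    ((dY.whisk [] (sequent (A.neg :: Ξ))).comp dcut')
  -- The instance with two cuts as gates: `M = [A]` and `G₂ = [B]` are single strings and `G₃` is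
  -- empty, so nothing has to be joined and `N`, `N'` are identities.
  have r := SEq.of_rule_of (.proof (.intro_left Γ [B] [] [A] Ξ Δ A A.neg B B.neg (.cut A) (.cut B)
    [] [] (.cut A) (.cut B) ψ ψ ψ₁ ψ₂ [] [] (by simpa using e.right) rfl (by simp) (by simp)
    e₁.right e₂.right rfl (by simp) iψ i₁ i₂ irreducibleDiagram_nil irreducibleDiagram_nil))
    (w := []) (w' := sequent (Γ ++ Ξ ++ Δ))
    (by simpa [sequent, Gate.tgt] using eM.right.comp dK₁)
    (by simpa [sequent, Gate.tgt] using eM.right.comp dK₂)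
  -- the source of the rule
  have k₁ := ((SEq.refl hφ).comp ((SEq.refl (h₁.whisk (sequent (Γ ++ [B, A])) [])).comp
    (seq_interchange dZ h₂))).comp (SEq.refl dcut)
  have k₂ := eM.comp (SEq.refl dK₁)
  have k₃ := eM.symm.comp (SEq.refl dK₂)
  -- the target of the rule
  have k₄ := ((SEq.refl hφ).comp (seq_interchange dX (h₁.comp
    (h₂.whisk (sequent (A.neg :: Ξ)) []))).symm).comp ((SEq.refl dbig).comp (SEq.refl
      ((dY.whisk [] (sequent (A.neg :: Ξ))).comp dcut')))
  -- The two diagrams above the new `big` gate start from the empty word, so the gate merely changes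
  -- their order and is gone. In `k₆` the cut on `B` then moves above the premise of the cut on `A`.
  have hbig := seq_big (W := (A.neg :: Ξ).map some) (W' := (B.neg :: Δ).map some)
    (by rwa [sheaf_map_some]) (by rwa [sheaf_map_some]) p₁.1
  simp only [sheaf_map_some] at hbig
  have k₅ := ((SEq.refl (hφ.comp dX)).comp (hbig.whisk (sequent (Γ ++ [A, B])) [])).comp
    (SEq.refl ((dY.whisk [] (sequent (A.neg :: Ξ))).comp dcut'))
  have k₆ := ((SEq.refl ((hφ.comp dX).comp (h₂.whisk (sequent (Γ ++ [A, B])) []))).comp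
    (seq_interchange dY h₁).symm).comp (SEq.refl dcut')
  simp only [joined, sequent, cross_singleton, whisk_append, whisk_cons, whisk_nil, whisk_whisk,
    List.append_assoc, List.cons_append, List.nil_append, List.append_nil, fms_append, fms_cons,
    fms_nil, Gate.src, Gate.tgt, cross_nil_right, crossOne, List.map_cons] at k₁ k₂ k₃ k₄ k₅ k₆ r ⊢
  exact k₁.trans (k₂.trans (r.trans (k₃.trans (k₄.trans (k₅.trans k₆)))))

/-- The relation yields the cut on `B` above the cut on `A`, the opposite of the order in
`CutStep.par_tensor`; `seq_cut_cut` bridges the difference. -/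
theorem seq_cut_par_tensor {Γ Δ Ξ : List (Formula Atom)} {A B : Formula Atom}
    {φ₁ φ₂ φ₃ : List (Layer Atom)} (h₁ : IsDiagram [] φ₁ (sequent (Γ ++ [A, B])))
    (h₂ : IsDiagram [] φ₂ (sequent (Δ ++ [B.neg])))
    (h₃ : IsDiagram [] φ₃ (sequent (A.neg :: Ξ))) :
    SEq [] (sequent (Γ ++ Δ ++ Ξ))
      (joined Γ (Δ ++ Ξ) (.par A B) (.cut (.par A B))
        (φ₁ ++ [⟨.L :: fms Γ, .par A B, [.R]⟩])
        (joined Δ Ξ B.neg (.tensor B.neg A.neg) φ₂ φ₃ ++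
          whisk [.L] (fms Ξ ++ [.R]) (cross Δ [.tensor B.neg A.neg])))
      (joined (Γ ++ Δ) Ξ A (.cut A) (joined (Γ ++ [A]) Δ B (.cut B)
        φ₁ (φ₂ ++ whisk [.L] [.R] (cross Δ [B.neg])) ++
        whisk (.L :: fms Γ) [.R] (cross [A] Δ)) φ₃) := by
  have s := SEq.of_rule_of (SemRule.par_tensor A B Δ)
    ((((isDiagram_gate ([.fm A, .fm B, .R, .L] ++ fms Δ) [] (.tensor B.neg A.neg)).comp
      (isDiagram_gate [] ([.R, .L] ++ fms Δ ++ [.fm (.tensor B.neg A.neg)]) (.par A B))).comp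
      ((isDiagram_cross Δ [.tensor B.neg A.neg]).whisk [.fm (.par A B), .R, .L] [])).comp
      (isDiagram_gate [] (fms Δ) (.cut (.par A B))))
    (((((isDiagram_cross Δ [B.neg]).whisk [.fm A, .fm B, .R, .L] [.R, .L, .fm A.neg]).comp
      (isDiagram_gate [.fm A] (fms Δ ++ [.R, .L, .fm A.neg]) (.cut B))).comp
      ((isDiagram_crossOne A Δ).whisk [] [.R, .L, .fm A.neg])).comp
      (isDiagram_gate (fms Δ) [] (.cut A)))
  have dQ := (h₂.comp (h₃.whisk (sequent (Δ ++ [B.neg])) [])).comp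
    (isDiagram_gate (.L :: fms Δ) (fms Ξ ++ [.R]) (.tensor B.neg A.neg))
  have dpar := isDiagram_gate (.L :: fms Γ) [.R] (.par A B)
  have dend := ((isDiagram_cross Δ [.tensor B.neg A.neg]).whisk
    (sequent (Γ ++ [.par A B]) ++ [.L]) (fms Ξ ++ [.R])).comp
    (isDiagram_gate (.L :: fms Γ) (fms (Δ ++ Ξ) ++ [.R]) (.cut (.par A B)))
  have k₁ := (SEq.refl h₁).comp ((seq_interchange dpar dQ).comp (SEq.refl dend))
  have dM := (h₁.comp (h₂.whisk (sequent (Γ ++ [A, B])) [])).comp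
    (h₃.whisk (sequent (Γ ++ [A, B]) ++ sequent (Δ ++ [B.neg])) [])
  have k₂ := (SEq.refl dM).comp (s.whisk (.L :: fms Γ) (fms Ξ ++ [.R]))
  have dX := (isDiagram_cross Δ [B.neg]).whisk [.L] [.R]
  have dY := (isDiagram_gate (.L :: fms (Γ ++ [A])) (fms Δ ++ [.R]) (.cut B)).comp
    ((isDiagram_cross [A] Δ).whisk (.L :: fms Γ) [.R])
  have dcut := isDiagram_gate (.L :: fms (Γ ++ Δ)) (fms Ξ ++ [.R]) (.cut A)
  have k₃ := ((SEq.refl (h₁.comp (h₂.whisk (sequent (Γ ++ [A, B])) []))).comp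
    ((seq_interchange dX h₃).symm.whisk (sequent (Γ ++ [A, B])) [])).comp
    ((SEq.refl (dY.whisk [] (sequent (A.neg :: Ξ)))).comp (SEq.refl dcut))
  have k₄ := ((SEq.refl (h₁.comp ((h₂.comp dX).whisk (sequent (Γ ++ [A, B])) []))).comp
    (seq_interchange dY h₃).symm).comp (SEq.refl dcut)
  simp only [joined, sequent, cross_singleton, whisk_append, whisk_cons, whisk_nil, whisk_whisk,
    List.append_assoc, List.cons_append, List.nil_append, List.append_nil, fms_append, fms_cons,
    fms_nil, Gate.src, Gate.tgt] at k₁ k₂ k₃ k₄ ⊢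
  exact k₁.trans (k₂.trans (k₃.trans k₄))

theorem seq_cut_bot_one {Γ : List (Formula Atom)} {φ : List (Layer Atom)}
    (hφ : IsDiagram [] φ (sequent Γ)) :
    SEq [] (sequent Γ) (joined Γ [] .bot (.cut .bot) (φ ++ [⟨.L :: fms Γ, .bot, [.R]⟩])
      [⟨[], .one, []⟩]) φ := by
  have s : SEq [.R] [.R] [⟨[], .bot, [.R]⟩, ⟨[.fm .bot, .R], .one, []⟩, ⟨[], .cut .bot, [.R]⟩]
      ([] : List (Layer Atom)) :=
    .of_rule .bot_one (by simp [IsDiagram, Gate.src, Gate.tgt, Formula.neg]) rfl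
  have k := (SEq.refl hφ).comp (s.whisk (.L :: fms Γ) [])
  simp only [joined, sequent, whisk_cons, whisk_nil, List.append_assoc, List.cons_append,
    List.nil_append, List.append_nil, fms_append, fms_cons, fms_nil] at k ⊢
  exact k

theorem seq_cut_one_bot {Γ : List (Formula Atom)} {φ : List (Layer Atom)}
    (hφ : IsDiagram [] φ (sequent Γ)) :
    SEq [] (sequent Γ) (joined [] Γ .one (.cut .one) [⟨[], .one, []⟩]
      (φ ++ [⟨[.L], .bot, fms Γ ++ [.R]⟩])) φ := by
  have s : SEq [.L] [.L] [⟨[], .one, [.L]⟩, ⟨[.L, .fm .one, .R, .L], .bot, []⟩,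
      ⟨[.L], .cut .one, []⟩] ([] : List (Layer Atom)) :=
    .of_rule .one_bot (by simp [IsDiagram, Gate.src, Gate.tgt, Formula.neg]) rfl
  have dend := (isDiagram_gate (sequent [.one] ++ [.L]) (fms Γ ++ [.R]) .bot).comp
    (isDiagram_gate [.L] (fms Γ ++ [.R]) (.cut .one))
  have k₁ := (seq_interchange (isDiagram_gate [] [] .one) hφ).comp (SEq.refl dend)
  have k₂ := (SEq.refl hφ).comp (s.whisk [] (fms Γ ++ [.R]))
  simp only [joined, sequent, whisk_append, whisk_cons, whisk_nil, whisk_nil_nil, List.append_assoc,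
    List.cons_append, List.nil_append, List.append_nil, fms_cons, fms_nil, Gate.src,
    Gate.tgt] at k₁ k₂ ⊢
  exact k₁.trans k₂

/-! ### Invariance under cut elimination -/

theorem IsDiagram.cast {w w' v : Word Atom} {φ : List (Layer Atom)} (h : IsDiagram w φ w')
    (e : w' = v := by simp [sequent, Gate.src, Gate.tgt, Formula.neg, Formula.neg_neg]) :
    IsDiagram w φ v := e ▸ h

theorem SEq.cast {w w' v : Word Atom} {φ ψ : List (Layer Atom)} (h : SEq w w' φ ψ)
    (e : w' = v := by simp [sequent, Gate.src, Gate.tgt, Formula.neg, Formula.neg_neg]) :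
    SEq w v φ ψ := e ▸ h

/-- Cut elimination does not change the diagram. -/
theorem CutStep.seq {Γ : List (Formula Atom)} {d d' : Derivation Γ} (h : CutStep d d') :
    SEq [] (sequent Γ) d.diagram d'.diagram := by
  induction h with
  | ax_right A B h d X Y hX σ e he =>
    subst h
    have k := SEq.joined (.cut A) (SEq.refl d.isDiagram) he.seq_ax
    simp only [List.append_nil] at k
    exact k.trans (seq_cut_ax_right A d.isDiagram)
  | ax_left A B h d X Y hX σ e he =>
    obtain rfl : A = B.neg := by rw [h, Formula.neg_neg]
    have hc : IsSplit B.neg B (.cut B.neg) [] := by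
      simpa [Formula.neg_neg] using IsSplit.cut B.neg
    have k := SEq.joined (Γ := [B]) hc he.seq_ax (SEq.refl d.isDiagram)
    simp only [List.append_nil] at k
    exact k.trans (seq_cut_ax_left B d.isDiagram)
  | tensor_par A B A' B' hA hB h d₁ d₂ d₃ ρ ρ' e₁ e₂ he₁ he₂ f₂ hf₂ f₃ hf₃ g hg t ht =>
    rename_i Γ Δ Ξ Θ Θ'
    subst hA hB
    have hc : IsSplit (.tensor A B) (.par B.neg A.neg) (.cut (.tensor A B)) [] :=
      IsSplit.cut (.tensor A B)
    have k₁ := he₁.seq ((((Twisting.nil Γ).append (.comm [.tensor A B] Δ)).trans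
      (.ofEq _)).trans (ρ.twisting_spec.append (.nil _)))
    have k₂ := he₂.seq ((Twisting.comm Ξ [.par B.neg A.neg]).trans
      ((Twisting.nil _).append ρ'.twisting_spec))
    have k₃ := hf₂.seq (.comm [B] Δ)
    have k₄ := hf₃.seq (.comm Ξ [B.neg, A.neg])
    have k₅ := hg.seq (((Twisting.ofEq _).trans ((Twisting.comm Δ [A.neg]).append
      (.nil Ξ))).trans (.ofEq _))
    have k₆ := ht.seq ((Twisting.ofEq _).trans (ρ.twisting_spec.append ρ'.twisting_spec))
    have n := ((SEq.refl d₃.isDiagram).comp ((seq_par_cross Ξ B.neg A.neg).whisk [.L] [.R])).comp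
      (SEq.refl (ρ'.twisting_spec.isDiagram.whisk [.L, .fm (.par B.neg A.neg)] [.R]))
    have a₁ : SEq [] (sequent (Θ ++ [.tensor A B])) e₁.diagram
        ((joined Γ Δ A (.tensor A B) d₁.diagram d₂.diagram ++
          whisk (.L :: fms Γ) [.R] (cross [.tensor A B] Δ)) ++
          whisk [.L] [.fm (.tensor A B), .R] ρ.twisting) := by
      simpa [joined, Derivation.diagram] using k₁
    have a₂ : SEq [] (sequent (.par B.neg A.neg :: Θ')) e₂.diagram
        (((d₃.diagram ++ whisk [.L] [.R] (cross Ξ [B.neg, A.neg])) ++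
          [⟨[.L], .par B.neg A.neg, fms Ξ ++ [.R]⟩]) ++
          whisk [.L, .fm (.par B.neg A.neg)] [.R] ρ'.twisting) := by
      refine SEq.trans (by simpa [Derivation.diagram] using k₂) ?_
      simpa [sequent] using n
    have d₄ : IsDiagram [] (d₃.diagram ++ whisk [.L] [.R] (cross Ξ [B.neg, A.neg]))
        (sequent (B.neg :: A.neg :: Ξ)) := k₄.right
    -- The permutations of the side formulas pass beneath the cut, which leaves the bare `⊗/⅋` cut
    -- to the relation.
    have p := ((SEq.joined hc a₁ a₂).trans (seq_joined_exch hc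
      ((isDiagram_joined (.tensor A B) d₁.isDiagram d₂.isDiagram).comp
        ((isDiagram_cross [.tensor A B] Δ).whisk (.L :: fms Γ) [.R]) |>.cast)
      (d₄.comp (isDiagram_gate [.L] (fms Ξ ++ [.R]) (.par B.neg A.neg)) |>.cast)
      ρ.twisting_spec.isDiagram ρ'.twisting_spec.isDiagram))
    have c := (seq_cut_tensor_par d₁.isDiagram d₂.isDiagram d₄)
    have k₅' : SEq [] (sequent (A.neg :: (Δ ++ Ξ))) g.diagram
        (joined Δ (A.neg :: Ξ) B (.cut B) f₂.diagram f₃.diagram ++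
          whisk [.L] (fms Ξ ++ [.R]) (cross Δ [A.neg])) := by
      simpa [joined, Derivation.diagram] using k₅
    have q := SEq.joined (.cut A) (SEq.refl d₁.isDiagram) (k₅'.trans
      ((SEq.joined (Γ := Δ) (Δ := A.neg :: Ξ) (.cut B) k₃ k₄).comp (SEq.refl
        ((isDiagram_cross Δ [A.neg]).whisk [.L] (fms Ξ ++ [.R]))) |>.cast))
    have dρ := (ρ.twisting_spec.append ρ'.twisting_spec).isDiagram_sequent
    have c' := c.comp (SEq.refl dρ)
    have q' := q.symm.comp (SEq.refl dρ)
    simp only [Derivation.diagram, whisk_append, whisk_whisk, List.append_assoc,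
      List.cons_append, List.nil_append, List.append_nil, fms_nil] at p c' q' k₆ ⊢
    exact p.trans (c'.trans (q'.trans k₆.symm))
  | par_tensor A B A' B' hA hB h d₁ d₂ d₃ ρ ρ' e₁ e₂ he₁ he₂ f₁ hf₁ g hg f₂ hf₂ t ht =>
    rename_i Γ Δ Ξ Θ Θ'
    subst hA hB
    have hc : IsSplit (.par A B) (.tensor B.neg A.neg) (.cut (.par A B)) [] :=
      IsSplit.cut (.par A B)
    have k₁ := he₁.seq (ρ.twisting_spec.append (.nil [.par A B]))
    have k₂ := he₂.seq ((((Twisting.ofEq _).trans ((Twisting.comm Δ [.tensor B.neg A.neg]).append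
      (.nil Ξ))).trans (.ofEq _)).trans ((Twisting.nil _).append ρ'.twisting_spec))
    have k₃ := hf₁.seq (((Twisting.nil Γ).append (.comm [A] [B])).trans (.ofEq _))
    have k₄ := hf₂.seq (.comm Δ [B.neg])
    have tg := ((Twisting.ofEq (List.append_assoc Γ [B] Ξ)).trans
      ((Twisting.nil Γ).append (.comm [B] Ξ))).trans
      (.ofEq (List.append_assoc Γ Ξ [B]).symm)
    have k₅ := hg.seq tg
    have k₆ := ht.seq (((Twisting.ofEq _).trans ((Twisting.nil Γ).append (.comm Ξ Δ))).trans
      (ρ.twisting_spec.append ρ'.twisting_spec))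
    have a₁ : SEq [] (sequent (Θ ++ [.par A B])) e₁.diagram
        ((d₁.diagram ++ [⟨.L :: fms Γ, .par A B, [.R]⟩]) ++
          whisk [.L] [.fm (.par A B), .R] ρ.twisting) := by
      simpa [Derivation.diagram] using k₁
    have a₂ : SEq [] (sequent (.tensor B.neg A.neg :: Θ')) e₂.diagram
        ((joined Δ Ξ B.neg (.tensor B.neg A.neg) d₂.diagram d₃.diagram ++
          whisk [.L] (fms Ξ ++ [.R]) (cross Δ [.tensor B.neg A.neg])) ++
          whisk [.L, .fm (.tensor B.neg A.neg)] [.R] ρ'.twisting) := by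
      simpa [joined, Derivation.diagram] using k₂
    have p := ((SEq.joined hc a₁ a₂).trans (seq_joined_exch hc
      (d₁.isDiagram.comp (isDiagram_gate (.L :: fms Γ) [.R] (.par A B)) |>.cast)
      ((isDiagram_joined (.tensor B.neg A.neg) d₂.isDiagram d₃.isDiagram).comp
        ((isDiagram_cross Δ [.tensor B.neg A.neg]).whisk [.L] (fms Ξ ++ [.R])) |>.cast)
      ρ.twisting_spec.isDiagram ρ'.twisting_spec.isDiagram))
    have c := seq_cut_par_tensor d₁.isDiagram d₂.isDiagram d₃.isDiagram
    have f₁' : IsDiagram [] f₁.diagram (sequent (Γ ++ [B, A])) := by simpa using f₁.isDiagram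
    -- The step cuts on `A` first, the relation on `B` first. The two results agree up to a crossing
    -- of `Δ` with `Ξ`, which is undone later by the opposite crossing.
    have j := seq_cut_cut f₁' d₃.isDiagram f₂.isDiagram f₁.plain d₃.plain f₂.plain
    have dAB := (isDiagram_cross [B] [A]).whisk (.L :: fms Γ) [.R]
    -- The derivation `f₁` exchanges `A` and `B` to prepare its cut on `A`; the crossing supplied by
    -- `seq_cut_cut` reverses this.
    have i : SEq [] (sequent ((Γ ++ [A]) ++ [B]))
        (f₁.diagram ++ whisk (.L :: fms Γ) [.R] (cross [B] [A])) d₁.diagram := by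
      have i₁ := k₃.comp (SEq.refl dAB)
      have i₂ := (SEq.refl d₁.isDiagram).comp ((seq_cross_cross [A] [B]).whisk (.L :: fms Γ) [.R])
      simp only [sequent, whisk_append, whisk_nil, whisk_whisk, List.append_assoc,
        List.cons_append, List.nil_append, List.append_nil, fms_append, fms_cons, fms_nil]
        at i₁ i₂ ⊢
      exact i₁.trans i₂
    have m₀ := (SEq.joined (Γ := Γ ++ [A]) (Δ := Δ) (.cut B) i k₄).comp
      (SEq.refl ((isDiagram_cross [A] Δ).whisk (.L :: fms Γ) [.R]))
    have m := (SEq.joined (Γ := Γ ++ Δ) (Δ := Ξ) (.cut A) m₀.cast (SEq.refl d₃.isDiagram)).comp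
      ((seq_cross_cross Δ Ξ).whisk (.L :: fms Γ) [.R])
    have k₅' : SEq [] (sequent ((Γ ++ Ξ) ++ [B])) g.diagram
        (joined (Γ ++ [B]) Ξ A (.cut A) f₁.diagram d₃.diagram ++
          whisk (.L :: fms Γ) [.R] (cross [B] Ξ)) := by
      simpa [joined, Derivation.diagram] using k₅
    have o := (SEq.joined (.cut B) k₅' (SEq.refl f₂.isDiagram)).comp
      (SEq.refl ((isDiagram_cross Ξ Δ).whisk (.L :: fms Γ) [.R]))
    have j' := j.comp (SEq.refl ((isDiagram_cross Ξ Δ).whisk (.L :: fms Γ) [.R]))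
    have dρ := (ρ.twisting_spec.append ρ'.twisting_spec).isDiagram_sequent
    have c' := c.comp (SEq.refl dρ)
    have o' := o.comp (SEq.refl dρ)
    have j'' := j'.comp (SEq.refl dρ)
    have m' := m.comp (SEq.refl dρ)
    simp only [joined, sequent, Derivation.diagram, whisk_append, whisk_cons, whisk_nil,
      whisk_whisk, List.append_assoc, List.cons_append, List.nil_append, List.append_nil,
      fms_append, fms_cons, fms_nil] at p c' o' j'' m' k₆ ⊢
    exact p.trans (c'.trans (m'.symm.trans (j''.symm.trans (o'.symm.trans k₆.symm))))
  | bot_one h d ρ e₁ e₂ he₁ he₂ t ht =>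
    rename_i Γ Θ
    have hc : IsSplit (Atom := Atom) .bot .one (.cut .bot) [] := IsSplit.cut .bot
    have k₁ := he₁.seq (ρ.twisting_spec.append (.nil [.bot]))
    have k₂ := he₂.seq (.nil [.one])
    have k₃ := ht.seq (ρ.twisting_spec.trans (.ofEq _))
    have dρ := ρ.twisting_spec.isDiagram_sequent
    have a₁ : SEq [] (sequent (Θ ++ [.bot])) e₁.diagram
        ((d.diagram ++ [⟨.L :: fms Γ, .bot, [.R]⟩]) ++ whisk [.L] [.fm .bot, .R] ρ.twisting) := by
      simpa [Derivation.diagram] using k₁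
    have a₂ : SEq [] (sequent [.one]) e₂.diagram
        ([⟨[], .one, []⟩] ++ whisk [.L, .fm .one] [.R] []) := by
      simpa [Derivation.diagram] using k₂
    have p := (SEq.joined (Δ := []) hc a₁ a₂).trans (seq_joined_exch (Δ := []) hc
      (d.isDiagram.comp (isDiagram_gate (.L :: fms Γ) [.R] .bot) |>.cast)
      (isDiagram_gate [] [] .one) ρ.twisting_spec.isDiagram rfl)
    have c := (seq_cut_bot_one d.isDiagram).comp (SEq.refl dρ)
    simp only [joined, sequent, Derivation.diagram, whisk_cons, whisk_nil,
      whisk_whisk, List.append_assoc, List.cons_append, List.nil_append, List.append_nil,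
      fms_append, fms_cons, fms_nil] at p c k₃ ⊢
    exact p.trans (c.trans k₃.symm)
  | one_bot h d ρ e₁ e₂ he₁ he₂ t ht =>
    rename_i Γ Θ
    have hc : IsSplit (Atom := Atom) .one .bot (.cut .one) [] := IsSplit.cut .one
    have k₁ := he₁.seq (.nil [.one])
    have k₂ := he₂.seq ((Twisting.comm Γ [.bot]).trans
      ((Twisting.nil [.bot]).append ρ.twisting_spec))
    have k₃ := ht.seq ρ.twisting_spec
    have dρ := ρ.twisting_spec.isDiagram_sequent
    have n := ((SEq.refl d.isDiagram).comp ((seq_bot_cross Γ).whisk [.L] [.R])).comp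
      (SEq.refl (ρ.twisting_spec.isDiagram.whisk [.L, .fm .bot] [.R]))
    have a₁ : SEq [] (sequent [.one]) e₁.diagram
        ([⟨[], .one, []⟩] ++ whisk [.L] [.fm .one, .R] []) := by
      simpa [Derivation.diagram] using k₁
    have a₂ : SEq [] (sequent (.bot :: Θ)) e₂.diagram
        ((d.diagram ++ [⟨[.L], .bot, fms Γ ++ [.R]⟩]) ++
          whisk [.L, .fm .bot] [.R] ρ.twisting) := by
      refine SEq.trans (by simpa [Derivation.diagram] using k₂) ?_
      simpa [sequent] using n
    have p := (SEq.joined (Γ := []) hc a₁ a₂).trans (seq_joined_exch (Γ := []) hc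
      (isDiagram_gate [] [] .one)
      (d.isDiagram.comp (isDiagram_gate [.L] (fms Γ ++ [.R]) .bot) |>.cast)
      rfl ρ.twisting_spec.isDiagram)
    have c := (seq_cut_one_bot d.isDiagram).comp (SEq.refl dρ)
    simp only [joined, sequent, Derivation.diagram, whisk_append, whisk_cons, whisk_nil,
      whisk_whisk, List.append_assoc, List.cons_append, List.nil_append, List.append_nil,
      fms_cons, fms_nil] at p c k₃ ⊢
    exact p.trans (c.trans k₃.symm)
  | cut_left A B h e _ ih =>
    subst h
    simpa [joined, Derivation.diagram] using SEq.joined (.cut A) ih (.refl e.isDiagram)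
  | cut_right A B h d _ ih =>
    subst h
    simpa [joined, Derivation.diagram] using SEq.joined (.cut A) (.refl d.isDiagram) ih
  | tensor_left A B e _ ih =>
    simpa [joined, Derivation.diagram] using SEq.joined (.tensor A B) ih (.refl e.isDiagram)
  | tensor_right A B d _ ih =>
    simpa [joined, Derivation.diagram] using SEq.joined (.tensor A B) (.refl d.isDiagram) ih
  | par A B _ ih => exact ih.append (.refl (by simp [IsDiagram, Gate.src, Gate.tgt, sequent]))
  | bot _ ih => exact ih.append (.refl (by simp [IsDiagram, Gate.src, Gate.tgt, sequent]))
  | exch σ _ ih => exact ih.append (.refl σ.twisting_spec.isDiagram_sequent)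

/-! ## A relational model -/

/-- The points of the model: binary trees. -/
inductive Point : Type
  | leaf
  | node (x y : Point)

namespace Point

/-- Mirror image. -/
def neg : Point → Point
  | leaf => leaf
  | node x y => node y.neg x.neg

theorem neg_neg (x : Point) : x.neg.neg = x := by
  induction x with
  | leaf => rfl
  | node x y hx hy => simp [neg, hx, hy]

end Point

/-- The number of formulas in a word. -/
def arity : Word Atom → ℕ
  | [] => 0
  | .fm _ :: w => arity w + 1
  | .L :: w => arity w
  | .R :: w => arity w

@[simp] theorem arity_nil : arity ([] : Word Atom) = 0 := rfl

@[simp] theorem arity_fm (A : Formula Atom) (w : Word Atom) :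
    arity (.fm A :: w) = arity w + 1 := rfl

@[simp] theorem arity_L (w : Word Atom) : arity (.L :: w) = arity w := rfl

@[simp] theorem arity_R (w : Word Atom) : arity (.R :: w) = arity w := rfl

@[simp] theorem arity_append (w w' : Word Atom) : arity (w ++ w') = arity w + arity w' := by
  induction w with
  | nil => simp
  | cons x w ih => cases x <;> simp [ih] <;> omega

@[simp] theorem arity_fms (Γ : List (Formula Atom)) : arity (fms Γ) = Γ.length := by
  induction Γ with
  | nil => rfl
  | cons A Γ ih => simp [ih]

@[simp] theorem arity_sequent (Γ : List (Formula Atom)) : arity (sequent Γ) = Γ.length := by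
  simp [sequent]

/-- The relation between inputs and outputs of a gate. -/
def Gate.Den : Gate Atom → List Point → List Point → Prop
  | tensor _ _, s, t => ∃ x y, s = [x, y] ∧ t = [.node x y]
  | par _ _, s, t => ∃ x y, s = [x, y] ∧ t = [.node x y]
  | ax _, s, t => s = [] ∧ ∃ x, t = [x, x.neg]
  | cut _, s, t => (∃ x, s = [x, x.neg]) ∧ t = []
  | swap _ _, s, t => ∃ x y, s = [x, y] ∧ t = [y, x]
  | one, s, t => s = [] ∧ t = [.leaf]
  | bot, s, t => s = [] ∧ t = [.leaf]
  | big W W', s, t => ∃ x y, x.length = arity (sheaf W) ∧ y.length = arity (sheaf W') ∧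
      s = x ++ y ∧ t = y ++ x

theorem Gate.Den.length {g : Gate Atom} {s t : List Point} (h : g.Den s t) :
    t.length = arity g.tgt := by
  cases g with
  | big W W' => obtain ⟨x, y, hx, hy, rfl, rfl⟩ := h; simp [Gate.tgt, hx, hy]
  | tensor | par | swap => obtain ⟨x, y, rfl, rfl⟩ := h; simp [Gate.tgt]
  | ax => obtain ⟨rfl, x, rfl⟩ := h; simp [Gate.tgt]
  | cut => obtain ⟨-, rfl⟩ := h; simp [Gate.tgt]
  | one | bot => obtain ⟨-, rfl⟩ := h; simp [Gate.tgt]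

/-- A gate acts on the formulas above it and fixes the others. -/
def Layer.Den (x : Layer Atom) (s t : List Point) : Prop :=
  ∃ a i o b, s = a ++ i ++ b ∧ t = a ++ o ++ b ∧ a.length = arity x.left ∧
    b.length = arity x.right ∧ x.gate.Den i o

/-- The relation between inputs and outputs of a diagram. -/
def Den : List (Layer Atom) → List Point → List Point → Prop
  | [], s, t => t = s
  | x :: φ, s, t => ∃ m, x.Den s m ∧ Den φ m t

@[simp] theorem den_nil {s t : List Point} : Den ([] : List (Layer Atom)) s t ↔ t = s := Iff.rfl

theorem den_append {φ ψ : List (Layer Atom)} {s t : List Point} :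
    Den (φ ++ ψ) s t ↔ ∃ m, Den φ s m ∧ Den ψ m t := by
  induction φ generalizing s with
  | nil => simp
  | cons x φ ih =>
    simp only [List.cons_append, Den, ih]
    constructor
    · rintro ⟨m, h, n, h', h''⟩
      exact ⟨n, ⟨m, h, h'⟩, h''⟩
    · rintro ⟨n, ⟨m, h, h'⟩, h''⟩
      exact ⟨m, h, n, h', h''⟩

/-- The lengths of the outer parts determine the decomposition of the values, so the existential
decomposition in `Layer.Den` can be replaced by a chosen one. The default arguments derive the
lengths from the hypotheses at hand. -/
theorem den_cons {l r : Word Atom} {g : Gate Atom} {φ : List (Layer Atom)} {s t : List Point}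
    (a i b : List Point) (hs : s = a ++ i ++ b := by simp)
    (ha : a.length = arity l := by simp [*] <;> omega)
    (hb : b.length = arity r := by simp [*] <;> omega) :
    Den (⟨l, g, r⟩ :: φ) s t ↔ ∃ o, g.Den i o ∧ Den φ (a ++ o ++ b) t := by
  subst hs
  constructor
  · rintro ⟨m, ⟨a', i', o, b', h, rfl, ha', hb', ho⟩, hφ⟩
    obtain ⟨h₁, rfl⟩ := List.append_inj' h (hb.trans hb'.symm)
    obtain ⟨rfl, rfl⟩ := List.append_inj h₁ (ha.trans ha'.symm)
    exact ⟨o, ho, hφ⟩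
  · rintro ⟨o, ho, hφ⟩
    exact ⟨_, ⟨a, i, o, b, rfl, rfl, ha, hb, ho⟩, hφ⟩

/-- The added identity strings carry their values unchanged. The decompositions chosen by the
individual layers are refined along the lengths of `a` and `b`. -/
theorem den_whisk {l r : Word Atom} {φ : List (Layer Atom)} {a i b t : List Point}
    (ha : a.length = arity l) (hb : b.length = arity r) :
    Den (whisk l r φ) (a ++ i ++ b) t ↔ ∃ o, Den φ i o ∧ t = a ++ o ++ b := by
  induction φ generalizing i with
  | nil => simp
  | cons x φ ih =>
    rw [whisk_cons]
    constructor
    · rintro ⟨m, ⟨a', i', o, b', h, rfl, ha', hb', ho⟩, hφ⟩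
      simp only [arity_append] at ha' hb'
      obtain ⟨c, d, rfl, hc, hd⟩ : ∃ c d, a' = c ++ d ∧ c.length = a.length ∧
          d.length = arity x.left :=
        ⟨a'.take a.length, a'.drop a.length, by simp, by simp; omega, by simp; omega⟩
      obtain ⟨e, f, rfl, he, hf⟩ : ∃ e f, b' = e ++ f ∧ e.length = arity x.right ∧
          f.length = b.length :=
        ⟨b'.take (arity x.right), b'.drop (arity x.right), by simp, by simp; omega,
          by simp; omega⟩
      obtain ⟨h₁, rfl⟩ := List.append_inj' (s₁ := a ++ i) (s₂ := c ++ d ++ i' ++ e)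
        (by simpa using h) hf.symm
      obtain ⟨rfl, rfl⟩ := List.append_inj (t₂ := d ++ i' ++ e) (by simpa using h₁) hc.symm
      rw [show a ++ d ++ o ++ (e ++ b) = a ++ (d ++ o ++ e) ++ b by simp, ih] at hφ
      obtain ⟨p, hp, rfl⟩ := hφ
      exact ⟨p, ⟨_, ⟨d, i', o, e, rfl, rfl, hd, he, ho⟩, hp⟩, rfl⟩
    · rintro ⟨p, ⟨_, ⟨d, i', o, e, rfl, rfl, hd, he, ho⟩, hp⟩, rfl⟩
      exact ⟨a ++ (d ++ o ++ e) ++ b, ⟨a ++ d, i', o, e ++ b, by simp, by simp, by simp [ha, hd],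
        by simp [hb, he], ho⟩, ih.2 ⟨p, hp, rfl⟩⟩

theorem den_whisk_append {l r : Word Atom} {φ ψ : List (Layer Atom)} {s t : List Point}
    (a i b : List Point) (hs : s = a ++ i ++ b := by simp)
    (ha : a.length = arity l := by simp [*] <;> omega)
    (hb : b.length = arity r := by simp [*] <;> omega) :
    Den (whisk l r φ ++ ψ) s t ↔ ∃ o, Den φ i o ∧ Den ψ (a ++ o ++ b) t := by
  subst hs
  simp only [den_append, den_whisk ha hb]
  constructor
  · rintro ⟨_, ⟨o, ho, rfl⟩, h⟩
    exact ⟨o, ho, h⟩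
  · rintro ⟨o, ho, h⟩
    exact ⟨_, ⟨o, ho, rfl⟩, h⟩

theorem Den.length {φ : List (Layer Atom)} {w w' : Word Atom} (hφ : IsDiagram w φ w')
    {s t : List Point} (h : Den φ s t) (hs : s.length = arity w) : t.length = arity w' := by
  induction φ generalizing w s with
  | nil =>
    obtain rfl : t = s := h
    obtain rfl : w = w' := hφ
    exact hs
  | cons x φ ih =>
    obtain ⟨rfl, hφ⟩ := hφ
    obtain ⟨m, ⟨a, i, o, b, rfl, rfl, ha, hb, ho⟩, h⟩ := h
    exact ih hφ h (by simp [ha, hb, ho.length])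


/-! ### Gates in context -/

section

variable {l r : Word Atom} {φ : List (Layer Atom)} {s t : List Point}

theorem den_tensor {A B : Formula Atom} (a : List Point) (x y : Point) (b : List Point)
    (hs : s = a ++ x :: y :: b := by simp) (ha : a.length = arity l := by simp [*] <;> omega)
    (hb : b.length = arity r := by simp [*] <;> omega) :
    Den (⟨l, .tensor A B, r⟩ :: φ) s t ↔ Den φ (a ++ .node x y :: b) t := by
  rw [den_cons a [x, y] b (by simpa using hs) ha hb]
  simp [Gate.Den]

theorem den_par {A B : Formula Atom} (a : List Point) (x y : Point) (b : List Point)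
    (hs : s = a ++ x :: y :: b := by simp) (ha : a.length = arity l := by simp [*] <;> omega)
    (hb : b.length = arity r := by simp [*] <;> omega) :
    Den (⟨l, .par A B, r⟩ :: φ) s t ↔ Den φ (a ++ .node x y :: b) t := by
  rw [den_cons a [x, y] b (by simpa using hs) ha hb]
  simp [Gate.Den]

theorem den_swap {A B : Formula Atom} (a : List Point) (x y : Point) (b : List Point)
    (hs : s = a ++ x :: y :: b := by simp) (ha : a.length = arity l := by simp [*] <;> omega)
    (hb : b.length = arity r := by simp [*] <;> omega) :
    Den (⟨l, .swap A B, r⟩ :: φ) s t ↔ Den φ (a ++ y :: x :: b) t := by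
  rw [den_cons a [x, y] b (by simpa using hs) ha hb]
  simp [Gate.Den]

theorem den_cut {A : Formula Atom} (a : List Point) (x y : Point) (b : List Point)
    (hs : s = a ++ x :: y :: b := by simp) (ha : a.length = arity l := by simp [*] <;> omega)
    (hb : b.length = arity r := by simp [*] <;> omega) :
    Den (⟨l, .cut A, r⟩ :: φ) s t ↔ y = x.neg ∧ Den φ (a ++ b) t := by
  rw [den_cons a [x, y] b (by simpa using hs) ha hb]
  simp [Gate.Den]

theorem den_ax {A : Formula Atom} (a b : List Point)
    (hs : s = a ++ b := by simp) (ha : a.length = arity l := by simp [*] <;> omega)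
    (hb : b.length = arity r := by simp [*] <;> omega) :
    Den (⟨l, .ax A, r⟩ :: φ) s t ↔ ∃ x : Point, Den φ (a ++ x :: x.neg :: b) t := by
  rw [den_cons a [] b (by simpa using hs) ha hb]
  simp [Gate.Den]

theorem den_one (a b : List Point)
    (hs : s = a ++ b := by simp) (ha : a.length = arity l := by simp [*] <;> omega)
    (hb : b.length = arity r := by simp [*] <;> omega) :
    Den (⟨l, .one, r⟩ :: φ) s t ↔ Den φ (a ++ .leaf :: b) t := by
  rw [den_cons a [] b (by simpa using hs) ha hb]
  simp [Gate.Den]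

theorem den_bot (a b : List Point)
    (hs : s = a ++ b := by simp) (ha : a.length = arity l := by simp [*] <;> omega)
    (hb : b.length = arity r := by simp [*] <;> omega) :
    Den (⟨l, .bot, r⟩ :: φ) s t ↔ Den φ (a ++ .leaf :: b) t := by
  rw [den_cons a [] b (by simpa using hs) ha hb]
  simp [Gate.Den]

end

/-! ### Block crossings and `big` gates in the model -/

theorem den_crossOne (A : Formula Atom) (Δ : List (Formula Atom)) (x : Point) {d t : List Point}
    (hd : d.length = Δ.length) : Den (crossOne A Δ) (x :: d) t ↔ t = d ++ [x] := by
  induction Δ generalizing d t with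
  | nil => obtain rfl := List.length_eq_zero_iff.1 hd; simp [crossOne]
  | cons B Δ ih =>
    obtain ⟨y, d, rfl⟩ := List.exists_cons_of_length_eq_add_one hd
    have hd : d.length = Δ.length := by simpa using hd
    rw [crossOne, den_swap [] x y d, ← List.append_nil (whisk _ _ _),
      den_whisk_append [y] (x :: d) []]
    simp [ih hd]

theorem den_cross (Γ Δ : List (Formula Atom)) {c d t : List Point} (hc : c.length = Γ.length)
    (hd : d.length = Δ.length) : Den (cross Γ Δ) (c ++ d) t ↔ t = d ++ c := by
  induction Γ generalizing c t with
  | nil => obtain rfl := List.length_eq_zero_iff.1 hc; simp [cross]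
  | cons A Γ ih =>
    obtain ⟨x, c, rfl⟩ := List.exists_cons_of_length_eq_add_one hc
    have hc : c.length = Γ.length := by simpa using hc
    rw [cross, den_whisk_append [x] (c ++ d) []]
    simp only [ih hc, exists_eq_left]
    rw [← List.append_nil (whisk _ _ _), den_whisk_append [] (x :: d) c]
    simp [den_crossOne A Δ x hd]

theorem den_cross_append {l r : Word Atom} {Γ Δ : List (Formula Atom)} {ψ : List (Layer Atom)}
    {s t : List Point} (a c d b : List Point) (hs : s = a ++ (c ++ d) ++ b := by simp)
    (ha : a.length = arity l := by simp [*] <;> omega)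
    (hb : b.length = arity r := by simp [*] <;> omega)
    (hc : c.length = Γ.length := by simp [*] <;> omega)
    (hd : d.length = Δ.length := by simp [*] <;> omega) :
    Den (whisk l r (cross Γ Δ) ++ ψ) s t ↔ Den ψ (a ++ d ++ c ++ b) t := by
  rw [den_whisk_append a (c ++ d) b hs ha hb]
  simp [den_cross Γ Δ hc hd]

theorem den_big {l r : Word Atom} {W W' : List (Option (Formula Atom))} {ψ : List (Layer Atom)}
    {s t : List Point} (a c d b : List Point) (hs : s = a ++ (c ++ d) ++ b := by simp)
    (ha : a.length = arity l := by simp [*] <;> omega)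
    (hb : b.length = arity r := by simp [*] <;> omega)
    (hc : c.length = arity (sheaf W) := by simp [*] <;> omega)
    (hd : d.length = arity (sheaf W') := by simp [*] <;> omega) :
    Den (⟨l, .big W W', r⟩ :: ψ) s t ↔ Den ψ (a ++ d ++ c ++ b) t := by
  rw [den_cons a (c ++ d) b hs ha hb]
  constructor
  · rintro ⟨o, ⟨x, y, hx, hy, h, rfl⟩, h'⟩
    obtain ⟨rfl, rfl⟩ := List.append_inj h (hc.trans hx.symm)
    simpa using h'
  · intro h
    exact ⟨_, ⟨c, d, hc, hd, rfl, rfl⟩, by simpa using h⟩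

/-! ## Soundness of the model -/

/-- The number of inputs of a diagram, read off its first layer. -/
def inputs : List (Layer Atom) → ℕ
  | [] => 0
  | x :: _ => arity (x.left ++ x.gate.src ++ x.right)

/-- The rules whose two sides have the same denotation. -/
def SameDen (φ ψ : List (Layer Atom)) : Prop :=
  φ ≠ [] ∧ ∀ s t : List Point, s.length = inputs φ → (Den φ s t ↔ Den ψ s t)

theorem exists_eq_append_of_length {s : List Point} {m n : ℕ} (h : s.length = m + n) :
    ∃ a b, s = a ++ b ∧ a.length = m ∧ b.length = n :=
  ⟨s.take m, s.drop m, by simp, by simp; omega, by simp; omega⟩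

theorem SameDen.context {φ ψ : List (Layer Atom)} (h : SameDen φ ψ) {w w' l r : Word Atom}
    {p q : List (Layer Atom)} (hd : IsDiagram w (p ++ whisk l r φ ++ q) w') {s t : List Point}
    (hs : s.length = arity w) :
    Den (p ++ whisk l r φ ++ q) s t ↔ Den (p ++ whisk l r ψ ++ q) s t := by
  obtain ⟨hne, h⟩ := h
  rw [List.append_assoc, isDiagram_append_iff] at hd
  obtain ⟨m, hp, hd⟩ := hd
  rw [List.append_assoc, List.append_assoc, den_append, den_append]
  refine exists_congr fun n => and_congr_right fun hn => ?_
  have hl := hn.length hp hs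
  -- The first layer of `φ` records its source, so typing fixes the number of values that reach the
  -- replaced part. This is the reason for the two side conditions in `SameDen`.
  have hm : n.length = arity l + inputs φ + arity r := by
    cases φ with
    | nil => exact absurd rfl hne
    | cons x φ =>
      obtain ⟨rfl, -⟩ := hd
      simp [inputs] at hl ⊢
      omega
  obtain ⟨n, b, rfl, hn, hb⟩ := exists_eq_append_of_length hm
  obtain ⟨a, i, rfl, ha, hi⟩ := exists_eq_append_of_length hn
  rw [den_whisk_append a i b rfl ha hb, den_whisk_append a i b rfl ha hb]
  simp only [h i _ hi]

theorem sameDen_interchange (x : Word Atom) (g g' : Gate Atom) :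
    SameDen [⟨[], g, x ++ g'.src⟩, ⟨g.tgt ++ x, g', []⟩]
      [⟨g.src ++ x, g', []⟩, ⟨[], g, x ++ g'.tgt⟩] := by
  refine ⟨by simp, fun s t hs => ?_⟩
  simp only [inputs, arity_append, arity_nil, zero_add] at hs
  obtain ⟨i, b, rfl, hi, hb⟩ := exists_eq_append_of_length hs
  obtain ⟨c, i', rfl, hc, hi'⟩ := exists_eq_append_of_length hb
  have h₁ : Den [⟨[], g, x ++ g'.src⟩, ⟨g.tgt ++ x, g', []⟩] (i ++ (c ++ i')) t ↔
      ∃ o, g.Den i o ∧ ∃ o', g'.Den i' o' ∧ t = o ++ c ++ o' := by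
    rw [den_cons [] i (c ++ i')]
    refine exists_congr fun o => and_congr_right fun ho => ?_
    have := ho.length
    rw [den_cons (o ++ c) i' []]
    simp
  have h₂ : Den [⟨g.src ++ x, g', []⟩, ⟨[], g, x ++ g'.tgt⟩] (i ++ (c ++ i')) t ↔
      ∃ o', g'.Den i' o' ∧ ∃ o, g.Den i o ∧ t = o ++ c ++ o' := by
    rw [den_cons (i ++ c) i' []]
    refine exists_congr fun o' => and_congr_right fun ho' => ?_
    have := ho'.length
    rw [den_cons [] i (c ++ o')]
    simp
  rw [h₁, h₂]
  constructor
  · rintro ⟨o, ho, o', ho', h⟩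
    exact ⟨o', ho', o, ho, h⟩
  · rintro ⟨o, ho, o', ho', h⟩
    exact ⟨o', ho', o, ho, h⟩

theorem ControlRule.sameDen {φ ψ : List (Layer Atom)} (h : ControlRule φ ψ) : SameDen φ ψ := by
  cases h with
  | involution A B =>
    refine ⟨by simp, fun s t hs => ?_⟩
    obtain ⟨x, y, rfl⟩ := List.length_eq_two.1 hs
    clear hs
    rw [den_swap [] x y [], den_swap [] y x []]
    simp
  | yangBaxter A B C =>
    refine ⟨by simp, fun s t hs => ?_⟩
    obtain ⟨x, y, z, rfl⟩ := List.length_eq_three.1 hs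
    clear hs
    rw [den_swap [] x y [z], den_swap [y] x z [], den_swap [] y z [x], den_swap [x] y z [],
      den_swap [] x z [y], den_swap [z] x y []]
    simp
  | par_left A B C =>
    refine ⟨by simp, fun s t hs => ?_⟩
    obtain ⟨x, y, z, rfl⟩ := List.length_eq_three.1 hs
    clear hs
    rw [den_par [] x y [z], den_swap [] (.node x y) z [], den_swap [x] y z [],
      den_swap [] x z [y], den_par [z] x y []]
    simp
  | par_right A B C =>
    refine ⟨by simp, fun s t hs => ?_⟩
    obtain ⟨x, y, z, rfl⟩ := List.length_eq_three.1 hs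
    clear hs
    rw [den_par [x] y z [], den_swap [] x (.node y z) [], den_swap [] x y [z],
      den_swap [y] x z [], den_par [] y z [x]]
  | ax A =>
    refine ⟨by simp, fun s t hs => ?_⟩
    obtain rfl := List.length_eq_zero_iff.1 hs
    clear hs
    rw [den_ax [] [], den_ax [] []]
    -- A pair `x, x.neg` read backwards is the pair `y, y.neg` for `y = x.neg`, since mirror image
    -- is an involution.
    constructor
    · rintro ⟨x, h⟩
      rw [den_swap [] x x.neg []] at h
      exact ⟨x.neg, by simpa [Point.neg_neg] using h⟩
    · rintro ⟨x, h⟩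
      refine ⟨x.neg, ?_⟩
      rw [den_swap [] x.neg x.neg.neg []]
      simpa [Point.neg_neg] using h
  | bot_left A =>
    refine ⟨by simp, fun s t hs => ?_⟩
    obtain ⟨x, rfl⟩ := List.length_eq_one_iff.1 hs
    clear hs
    rw [den_bot [] [x], den_swap [] .leaf x [], den_bot [x] []]
    simp
  | bot_right A =>
    refine ⟨by simp, fun s t hs => ?_⟩
    obtain ⟨x, rfl⟩ := List.length_eq_one_iff.1 hs
    clear hs
    rw [den_bot [x] [], den_swap [] x .leaf [], den_bot [] [x]]

theorem sameDen_untangle_left {g : Gate Atom} {l r : Word Atom}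
    {W W₁ W' : List (Option (Formula Atom))}
    (hs : l ++ g.src ++ r = sheaf W) (ht : l ++ g.tgt ++ r = sheaf W₁) :
    SameDen [⟨l, g, r ++ sheaf W'⟩, ⟨[], .big W₁ W', []⟩]
      [⟨[], .big W W', []⟩, ⟨sheaf W' ++ l, g, r⟩] := by
  refine ⟨by simp, fun s t h => ?_⟩
  have hs := congrArg arity hs
  have ht := congrArg arity ht
  simp only [arity_append, add_assoc] at hs ht
  simp only [inputs, arity_append, ← add_assoc] at h
  obtain ⟨s, d, rfl, h, hd⟩ := exists_eq_append_of_length h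
  obtain ⟨s, b, rfl, h, hb⟩ := exists_eq_append_of_length h
  obtain ⟨a, i, rfl, ha, hi⟩ := exists_eq_append_of_length h
  rw [den_cons a i (b ++ d), den_big [] (a ++ i ++ b) d [], den_cons (d ++ a) i b]
  refine exists_congr fun o => and_congr_right fun ho => ?_
  have := ho.length
  rw [den_big [] (a ++ o ++ b) d []]
  simp

theorem sameDen_untangle_right {g : Gate Atom} {l r : Word Atom}
    {W W₁ W' : List (Option (Formula Atom))}
    (hs : l ++ g.src ++ r = sheaf W') (ht : l ++ g.tgt ++ r = sheaf W₁) :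
    SameDen [⟨sheaf W ++ l, g, r⟩, ⟨[], .big W W₁, []⟩]
      [⟨[], .big W W', []⟩, ⟨l, g, r ++ sheaf W⟩] := by
  refine ⟨by simp, fun s t h => ?_⟩
  have hs := congrArg arity hs
  have ht := congrArg arity ht
  simp only [arity_append, add_assoc] at hs ht
  simp only [inputs, arity_append] at h
  obtain ⟨s, b, rfl, h, hb⟩ := exists_eq_append_of_length h
  obtain ⟨s, i, rfl, h, hi⟩ := exists_eq_append_of_length h
  obtain ⟨d, a, rfl, hd, ha⟩ := exists_eq_append_of_length h
  rw [den_cons (d ++ a) i b, den_big [] d (a ++ i ++ b) [], den_cons a i (b ++ d)]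
  refine exists_congr fun o => and_congr_right fun ho => ?_
  have := ho.length
  rw [den_big [] d (a ++ o ++ b) []]
  simp

theorem sameDen_untangle_left_new {g : Gate Atom} {W₁ W' : List (Option (Formula Atom))}
    (hs : g.src = []) (ht : g.tgt = sheaf W₁) :
    SameDen [⟨[], g, sheaf W'⟩, ⟨[], .big W₁ W', []⟩] [⟨sheaf W', g, []⟩] := by
  refine ⟨by simp, fun s t h => ?_⟩
  simp only [inputs, hs, List.append_nil, List.nil_append] at h
  rw [den_cons [] [] s, den_cons s [] []]
  refine exists_congr fun o => and_congr_right fun ho => ?_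
  have ho := ho.length
  rw [ht] at ho
  rw [den_big [] o s []]
  simp

theorem sameDen_untangle_right_new {g : Gate Atom} {W W₁ : List (Option (Formula Atom))}
    (hs : g.src = []) (ht : g.tgt = sheaf W₁) :
    SameDen [⟨sheaf W, g, []⟩, ⟨[], .big W W₁, []⟩] [⟨[], g, sheaf W⟩] := by
  refine ⟨by simp, fun s t h => ?_⟩
  simp only [inputs, hs, List.append_nil] at h
  rw [den_cons s [] [], den_cons [] [] s]
  refine exists_congr fun o => and_congr_right fun ho => ?_
  have ho := ho.length
  rw [ht] at ho
  rw [den_big [] s o []]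
  simp

theorem den_crossOne_append {l r : Word Atom} {A : Formula Atom} {Δ : List (Formula Atom)}
    {ψ : List (Layer Atom)} {s t : List Point} (a : List Point) (x : Point) (d b : List Point)
    (hs : s = a ++ x :: (d ++ b) := by simp)
    (ha : a.length = arity l := by simp [*] <;> omega)
    (hb : b.length = arity r := by simp [*] <;> omega)
    (hd : d.length = Δ.length := by simp [*] <;> omega) :
    Den (whisk l r (crossOne A Δ) ++ ψ) s t ↔ Den ψ (a ++ d ++ x :: b) t := by
  rw [den_whisk_append a (x :: d) b (by simpa using hs) ha hb]
  simp [den_crossOne A Δ x hd]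

/-- The cut relations between the logical gates. -/
theorem sameDen_tensor_par (A B : Formula Atom) (Γ : List (Formula Atom)) :
    SameDen
      ([⟨[], .tensor A B, fms Γ ++ [.R, .L, .fm B.neg, .fm A.neg]⟩]
        ++ whisk [] [.R, .L, .fm B.neg, .fm A.neg] (crossOne (.tensor A B) Γ)
        ++ [⟨fms Γ ++ [.fm (.tensor A B), .R, .L], .par B.neg A.neg, []⟩,
            ⟨fms Γ, .cut (.tensor A B), []⟩])
      (whisk [.fm A, .R, .L] [.R, .L, .fm B.neg, .fm A.neg] (crossOne B Γ)
        ++ [⟨[.fm A, .R, .L] ++ fms Γ, .cut B, [.fm A.neg]⟩]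
        ++ whisk [.fm A, .R, .L] [] (cross Γ [A.neg])
        ++ [⟨[], .cut A, fms Γ⟩]) := by
  refine ⟨by simp, fun s t h => ?_⟩
  obtain ⟨p, s', rfl, hp, h'⟩ := exists_eq_append_of_length (m := 2) (n := Γ.length + 2) (s := s)
    (by simp [inputs, Gate.src] at h; omega)
  obtain ⟨c, q, rfl, hc, hq⟩ := exists_eq_append_of_length h'
  obtain ⟨x, y, rfl⟩ := List.length_eq_two.1 hp
  obtain ⟨z, w, rfl⟩ := List.length_eq_two.1 hq
  simp only [List.append_assoc, List.cons_append, List.nil_append]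
  rw [den_tensor [] x y (c ++ [z, w]), den_crossOne_append [] (.node x y) c [z, w],
    den_par (c ++ [.node x y]) z w [], den_cut c (.node x y) (.node z w) [],
    den_crossOne_append [x] y c [z, w], den_cut (x :: c) y z [w]]
  rw [den_cross_append [x] c [w] [], den_cut [] x w c]
  -- The mirror image of `node x y` is `node y.neg x.neg`, so the condition of the single cut splits
  -- into those of the two smaller cuts. Reversing the order in `Point.neg` matches the reversal in
  -- `Formula.neg`.
  simp [Point.neg, and_assoc]

theorem sameDen_par_tensor (A B : Formula Atom) (Γ : List (Formula Atom)) :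
    SameDen
      ([⟨[.fm A, .fm B, .R, .L] ++ fms Γ, .tensor B.neg A.neg, []⟩,
        ⟨[], .par A B, [.R, .L] ++ fms Γ ++ [.fm (.tensor B.neg A.neg)]⟩]
        ++ whisk [.fm (.par A B), .R, .L] [] (cross Γ [.tensor B.neg A.neg])
        ++ [⟨[], .cut (.par A B), fms Γ⟩])
      (whisk [.fm A, .fm B, .R, .L] [.R, .L, .fm A.neg] (cross Γ [B.neg])
        ++ [⟨[.fm A], .cut B, fms Γ ++ [.R, .L, .fm A.neg]⟩]
        ++ whisk [] [.R, .L, .fm A.neg] (crossOne A Γ)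
        ++ [⟨fms Γ, .cut A, []⟩]) := by
  refine ⟨by simp, fun s t h => ?_⟩
  obtain ⟨p, s', rfl, hp, h'⟩ := exists_eq_append_of_length (m := 2) (n := Γ.length + 2) (s := s)
    (by simp [inputs, Gate.src] at h; omega)
  obtain ⟨c, q, rfl, hc, hq⟩ := exists_eq_append_of_length h'
  obtain ⟨x, y, rfl⟩ := List.length_eq_two.1 hp
  obtain ⟨z, w, rfl⟩ := List.length_eq_two.1 hq
  simp only [List.append_assoc, List.cons_append, List.nil_append]
  rw [den_tensor (x :: y :: c) z w [], den_par [] x y (c ++ [.node z w]),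
    den_cross_append [.node x y] c [.node z w] [], den_cut [] (.node x y) (.node z w) c,
    den_cross_append [x, y] c [z] [w], den_cut [x] y z (c ++ [w])]
  rw [den_crossOne_append [] x c [w], den_cut c x w []]
  simp [Point.neg, and_assoc]

/-! ### The introduction relations in the model -/

theorem den_whisk_typed {l r : Word Atom} {φ ψ : List (Layer Atom)} {w w' : Word Atom}
    (hφ : IsDiagram w φ w') {s t : List Point} (a i b : List Point)
    (hi : i.length = arity w := by simp [*] <;> omega)
    (hs : s = a ++ i ++ b := by simp)
    (ha : a.length = arity l := by simp [*] <;> omega)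
    (hb : b.length = arity r := by simp [*] <;> omega) :
    Den (whisk l r φ ++ ψ) s t ↔
      ∃ o, o.length = arity w' ∧ Den φ i o ∧ Den ψ (a ++ o ++ b) t := by
  rw [den_whisk_append a i b hs ha hb]
  exact exists_congr fun o => ⟨fun h => ⟨h.1.length hφ hi, h⟩, And.right⟩

theorem den_split {A B : Formula Atom} {g : Gate Atom} {c : List (Formula Atom)}
    (hg : IsSplit A B g c) {l r : Word Atom} {ψ : List (Layer Atom)} {s t : List Point}
    (a x y b : List Point) (hs : s = a ++ (x ++ y) ++ b := by simp)
    (ha : a.length = arity l := by simp [*] <;> omega)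
    (hb : b.length = arity r := by simp [*] <;> omega) :
    Den (⟨l, g, r⟩ :: ψ) s t ↔
      ∃ o, o.length = c.length ∧ g.Den (x ++ y) o ∧ Den ψ (a ++ o ++ b) t := by
  rw [den_cons a (x ++ y) b hs ha hb]
  exact exists_congr fun o => ⟨fun h => ⟨by simpa [hg.tgt_eq] using h.1.length, h⟩, And.right⟩

theorem den_big_map_some {l r : Word Atom} {Γ Δ : List (Formula Atom)} {ψ : List (Layer Atom)}
    {s t : List Point} (a c d b : List Point) (hs : s = a ++ (c ++ d) ++ b := by simp)
    (ha : a.length = arity l := by simp [*] <;> omega)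
    (hb : b.length = arity r := by simp [*] <;> omega)
    (hc : c.length = Γ.length := by simp [*] <;> omega)
    (hd : d.length = Δ.length := by simp [*] <;> omega) :
    Den (⟨l, .big (Γ.map some) (Δ.map some), r⟩ :: ψ) s t ↔ Den ψ (a ++ d ++ c ++ b) t :=
  den_big a c d b hs ha hb (by rw [sheaf_map_some, arity_sequent, hc])
    (by rw [sheaf_map_some, arity_sequent, hd])

/-- The common part above the gates is left out. On both sides `α` acts on the values of `A, B`, `N`
on those of `G₂, G₃`, and `β` on the result and the value of `C`. These actions are independent
except that `β` waits for `N`; only their order and the bookkeeping of positions differ. -/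
theorem den_intro_left {Γ G₂ G₃ Δ S : List (Formula Atom)} {A B A' C : Formula Atom}
    {α β : Gate Atom} {a b : List (Formula Atom)} (hα : IsSplit A B α a) (hβ : IsSplit A' C β b)
    {N : List (Layer Atom)} (hN : IsDiagram (fms (G₂ ++ G₃)) N [.fm A'])
    {m t : List Point} (hm : m.length =
      arity (sequent (Γ ++ G₂ ++ G₃ ++ [A]) ++ sequent (B :: Δ) ++ sequent (C :: S))) :
    Den ([⟨.L :: fms (Γ ++ G₂ ++ G₃), α, fms Δ ++ [.R] ++ sequent (C :: S)⟩]
          ++ whisk (.L :: fms Γ) ([.R] ++ sequent (C :: S)) (cross (G₂ ++ G₃) (a ++ Δ))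
          ++ whisk (.L :: fms (Γ ++ a ++ Δ)) ([.R] ++ sequent (C :: S)) N
          ++ [⟨.L :: fms (Γ ++ a ++ Δ), β, fms S ++ [.R]⟩]) m t ↔
    Den (whisk (.L :: fms Γ) ([.R] ++ sequent (B :: Δ) ++ sequent (C :: S))
              (cross (G₂ ++ G₃) [A])
          ++ [⟨sequent (Γ ++ [A] ++ G₂ ++ G₃),
                .big ((B :: Δ).map some) ((C :: S).map some), []⟩]
          ++ whisk (.L :: fms (Γ ++ [A])) ([.R] ++ sequent (C :: S) ++ sequent (B :: Δ)) N
          ++ [⟨.L :: fms (Γ ++ [A]), β, fms S ++ [.R] ++ sequent (B :: Δ)⟩]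
          ++ whisk (.L :: fms Γ) ([.R] ++ sequent (B :: Δ)) (cross (A :: b) S)
          ++ whisk (.L :: fms (Γ ++ S)) ([.R] ++ sequent (B :: Δ)) (cross [A] b)
          ++ [⟨.L :: fms (Γ ++ S ++ b), α, fms Δ ++ [.R]⟩]
          ++ whisk (.L :: fms Γ) (fms Δ ++ [.R]) (cross (S ++ b) a)
          ++ whisk (.L :: fms (Γ ++ a)) [.R] (cross (S ++ b) Δ)
          ++ whisk (.L :: fms (Γ ++ a ++ Δ)) [.R] (cross S b)) m t := by
  -- The values on `Γ`, `G₂ ++ G₃`, `A`, `B`, `Δ`, `C` and `S`, in this order.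
  obtain ⟨γ, g, x, y, δ, z, σ, rfl, hγ, hg, hx, hy, hδ, hz, hσ⟩ : ∃ γ g x y δ z σ : List Point,
      m = γ ++ g ++ x ++ y ++ δ ++ z ++ σ ∧ γ.length = Γ.length ∧
      g.length = G₂.length + G₃.length ∧ x.length = 1 ∧ y.length = 1 ∧ δ.length = Δ.length ∧
      z.length = 1 ∧ σ.length = S.length := by
    obtain ⟨m₁, σ, rfl, hm₁, hσ⟩ := exists_eq_append_of_length (s := m) (n := S.length)
      (m := Γ.length + (G₂.length + G₃.length) + 1 + 1 + Δ.length + 1)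
      (by rw [hm]; simp; omega)
    obtain ⟨m₂, z, rfl, hm₂, hz⟩ := exists_eq_append_of_length hm₁
    obtain ⟨m₃, δ, rfl, hm₃, hδ⟩ := exists_eq_append_of_length hm₂
    obtain ⟨m₄, y, rfl, hm₄, hy⟩ := exists_eq_append_of_length hm₃
    obtain ⟨m₅, x, rfl, hm₅, hx⟩ := exists_eq_append_of_length hm₄
    obtain ⟨γ, g, rfl, hγ, hg⟩ := exists_eq_append_of_length hm₅
    exact ⟨γ, g, x, y, δ, z, σ, rfl, hγ, hg, hx, hy, hδ, hz, hσ⟩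
  clear hm
  refine Iff.trans (b := ∃ o, o.length = a.length ∧ α.Den (x ++ y) o ∧ ∃ n, n.length = 1 ∧
    Den N g n ∧ ∃ p, p.length = b.length ∧ β.Den (n ++ z) p ∧ t = γ ++ o ++ δ ++ p ++ σ) ?_ ?_
  · simp only [List.append_assoc, List.cons_append, List.nil_append]
    rw [den_split hα (γ ++ g) x y (δ ++ z ++ σ)]
    refine exists_congr fun o => and_congr_right fun ho => and_congr_right fun _ => ?_
    rw [den_cross_append γ g (o ++ δ) (z ++ σ), den_whisk_typed hN (γ ++ o ++ δ) g (z ++ σ)]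
    refine exists_congr fun n => and_congr_right fun hn => and_congr_right fun _ => ?_
    rw [den_split hβ (γ ++ o ++ δ) n z σ]
    simp
  -- The existential quantifiers are reordered: the source of the relation applies `α` first, its
  -- target applies `N` and `β` first.
  refine Iff.trans (b := ∃ n, n.length = 1 ∧ Den N g n ∧ ∃ p, p.length = b.length ∧
    β.Den (n ++ z) p ∧ ∃ o, o.length = a.length ∧ α.Den (x ++ y) o ∧
    t = γ ++ o ++ δ ++ p ++ σ) ?_ ?_
  · constructor
    · rintro ⟨o, ho, hα, n, hn, hN, p, hp, hβ, h⟩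
      exact ⟨n, hn, hN, p, hp, hβ, o, ho, hα, h⟩
    · rintro ⟨n, hn, hN, p, hp, hβ, o, ho, hα, h⟩
      exact ⟨o, ho, hα, n, hn, hN, p, hp, hβ, h⟩
  symm
  rw [← List.append_nil (whisk _ _ (cross S b))]
  simp only [List.append_assoc, List.cons_append, List.nil_append]
  rw [den_cross_append γ g x (y ++ δ ++ z ++ σ),
    den_big_map_some (γ ++ x ++ g) (y ++ δ) (z ++ σ) [],
    den_whisk_typed hN (γ ++ x) g (z ++ σ ++ y ++ δ)]
  refine exists_congr fun n => and_congr_right fun hn => and_congr_right fun _ => ?_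
  rw [den_split hβ (γ ++ x) n z (σ ++ y ++ δ)]
  refine exists_congr fun p => and_congr_right fun hp => and_congr_right fun _ => ?_
  rw [den_cross_append γ (x ++ p) σ (y ++ δ), den_cross_append (γ ++ σ) x p (y ++ δ),
    den_split hα (γ ++ σ ++ p) x y δ]
  refine exists_congr fun o => and_congr_right fun ho => and_congr_right fun _ => ?_
  rw [den_cross_append γ (σ ++ p) o δ, den_cross_append (γ ++ o) (σ ++ p) δ [],
    den_cross_append (γ ++ o ++ δ) σ p []]
  simp

/-- The argument of `den_intro_left` with left and right exchanged; `σ, z, δ, y, x, g, γ` are the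
values on `S`, `C`, `Δ`, `B`, `A`, `G₂ ++ G₃` and `Γ`. -/
theorem den_intro_right {Γ G₂ G₃ Δ S : List (Formula Atom)} {A B A' C : Formula Atom}
    {α β : Gate Atom} {a b : List (Formula Atom)} (hα : IsSplit B A α a) (hβ : IsSplit C A' β b)
    {N : List (Layer Atom)} (hN : IsDiagram (fms (G₂ ++ G₃)) N [.fm A'])
    {m t : List Point} (hm : m.length =
      arity (sequent (S ++ [C]) ++ sequent (Δ ++ [B]) ++ sequent (A :: (G₂ ++ G₃ ++ Γ)))) :
    Den ([⟨sequent (S ++ [C]) ++ .L :: fms Δ, α, fms (G₂ ++ G₃ ++ Γ) ++ [.R]⟩]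
          ++ whisk (sequent (S ++ [C]) ++ [.L]) (fms Γ ++ [.R]) (cross (Δ ++ a) (G₂ ++ G₃))
          ++ whisk (sequent (S ++ [C]) ++ [.L]) (fms (Δ ++ a ++ Γ) ++ [.R]) N
          ++ [⟨.L :: fms S, β, fms (Δ ++ a ++ Γ) ++ [.R]⟩]) m t ↔
    Den ([⟨[], .big ((S ++ [C]).map some) ((Δ ++ [B]).map some),
                sequent (A :: (G₂ ++ G₃ ++ Γ))⟩]
          ++ whisk (sequent (Δ ++ [B]) ++ sequent (S ++ [C]) ++ [.L]) (fms Γ ++ [.R])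
              (cross [A] (G₂ ++ G₃))
          ++ whisk (sequent (Δ ++ [B]) ++ sequent (S ++ [C]) ++ [.L])
              (fms (A :: Γ) ++ [.R]) N
          ++ [⟨sequent (Δ ++ [B]) ++ .L :: fms S, β, fms (A :: Γ) ++ [.R]⟩]
          ++ whisk (sequent (Δ ++ [B]) ++ [.L]) (fms Γ ++ [.R]) (cross (S ++ b) [A])
          ++ [⟨.L :: fms Δ, α, fms (S ++ b ++ Γ) ++ [.R]⟩]
          ++ whisk [.L] (fms Γ ++ [.R]) (cross (Δ ++ a) (S ++ b))) m t := by
  obtain ⟨σ, z, δ, y, x, g, γ, rfl, hσ, hz, hδ, hy, hx, hg, hγ⟩ : ∃ σ z δ y x g γ : List Point,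
      m = σ ++ z ++ δ ++ y ++ x ++ g ++ γ ∧ σ.length = S.length ∧ z.length = 1 ∧
      δ.length = Δ.length ∧ y.length = 1 ∧ x.length = 1 ∧ g.length = G₂.length + G₃.length ∧
      γ.length = Γ.length := by
    obtain ⟨m₁, γ, rfl, hm₁, hγ⟩ := exists_eq_append_of_length (s := m) (n := Γ.length)
      (m := S.length + 1 + Δ.length + 1 + 1 + (G₂.length + G₃.length))
      (by rw [hm]; simp; omega)
    obtain ⟨m₂, g, rfl, hm₂, hg⟩ := exists_eq_append_of_length hm₁
    obtain ⟨m₃, x, rfl, hm₃, hx⟩ := exists_eq_append_of_length hm₂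
    obtain ⟨m₄, y, rfl, hm₄, hy⟩ := exists_eq_append_of_length hm₃
    obtain ⟨m₅, δ, rfl, hm₅, hδ⟩ := exists_eq_append_of_length hm₄
    obtain ⟨σ, z, rfl, hσ, hz⟩ := exists_eq_append_of_length hm₅
    exact ⟨σ, z, δ, y, x, g, γ, rfl, hσ, hz, hδ, hy, hx, hg, hγ⟩
  clear hm
  refine Iff.trans (b := ∃ o, o.length = a.length ∧ α.Den (y ++ x) o ∧ ∃ n, n.length = 1 ∧
    Den N g n ∧ ∃ p, p.length = b.length ∧ β.Den (z ++ n) p ∧ t = σ ++ p ++ δ ++ o ++ γ) ?_ ?_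
  · simp only [List.append_assoc, List.cons_append, List.nil_append]
    rw [den_split hα (σ ++ z ++ δ) y x (g ++ γ)]
    refine exists_congr fun o => and_congr_right fun ho => and_congr_right fun _ => ?_
    rw [den_cross_append (σ ++ z) (δ ++ o) g γ, den_whisk_typed hN (σ ++ z) g (δ ++ o ++ γ)]
    refine exists_congr fun n => and_congr_right fun hn => and_congr_right fun _ => ?_
    rw [den_split hβ σ z n (δ ++ o ++ γ)]
    simp
  refine Iff.trans (b := ∃ n, n.length = 1 ∧ Den N g n ∧ ∃ p, p.length = b.length ∧
    β.Den (z ++ n) p ∧ ∃ o, o.length = a.length ∧ α.Den (y ++ x) o ∧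
    t = σ ++ p ++ δ ++ o ++ γ) ?_ ?_
  · constructor
    · rintro ⟨o, ho, hα, n, hn, hN, p, hp, hβ, h⟩
      exact ⟨n, hn, hN, p, hp, hβ, o, ho, hα, h⟩
    · rintro ⟨n, hn, hN, p, hp, hβ, o, ho, hα, h⟩
      exact ⟨o, ho, hα, n, hn, hN, p, hp, hβ, h⟩
  symm
  rw [← List.append_nil (whisk _ _ (cross (Δ ++ a) (S ++ b)))]
  simp only [List.append_assoc, List.cons_append, List.nil_append]
  rw [den_big_map_some [] (σ ++ z) (δ ++ y) (x ++ g ++ γ),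
    den_cross_append (δ ++ y ++ σ ++ z) x g γ,
    den_whisk_typed hN (δ ++ y ++ σ ++ z) g (x ++ γ)]
  refine exists_congr fun n => and_congr_right fun hn => and_congr_right fun _ => ?_
  rw [den_split hβ (δ ++ y ++ σ) z n (x ++ γ)]
  refine exists_congr fun p => and_congr_right fun hp => and_congr_right fun _ => ?_
  rw [den_cross_append (δ ++ y) (σ ++ p) x γ, den_split hα δ y x (σ ++ p ++ γ)]
  refine exists_congr fun o => and_congr_right fun ho => and_congr_right fun _ => ?_
  rw [den_cross_append [] (δ ++ o) (σ ++ p) γ]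
  simp

/-- Two diagrams with a common first part. -/
theorem sameDen_append {ρ φ ψ : List (Layer Atom)} {w : Word Atom} (hρ : ρ ≠ [])
    (dρ : IsDiagram [] ρ w)
    (h : ∀ m t : List Point, m.length = arity w → (Den φ m t ↔ Den ψ m t)) :
    SameDen (ρ ++ φ) (ρ ++ ψ) := by
  cases ρ with
  | nil => exact absurd rfl hρ
  | cons x ρ =>
    refine ⟨by simp, fun s t hs => ?_⟩
    rw [den_append, den_append]
    refine exists_congr fun m => and_congr_right fun hm => h m t (hm.length dρ ?_)
    rw [hs, List.cons_append, inputs, ← dρ.1]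

theorem IsDiagram.ne_nil {φ : List (Layer Atom)} {Γ : List (Formula Atom)}
    (h : IsDiagram [] φ (sequent Γ)) : φ ≠ [] := by
  rintro rfl
  exact List.cons_ne_nil _ _ (show [] = sequent Γ from h).symm

theorem ProofRule.sameDen {φ ψ : List (Layer Atom)} (h : ProofRule φ ψ) : SameDen φ ψ := by
  cases h with
  | control h => exact h.sameDen
  | untangle_left g _ l r W W₁ W' hs ht => exact sameDen_untangle_left hs ht
  | untangle_left_new g _ W₁ W' hs ht => exact sameDen_untangle_left_new hs ht
  | untangle_right g _ l r W W' W₁ hs ht => exact sameDen_untangle_right hs ht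
  | untangle_right_new g _ W W₁ hs ht => exact sameDen_untangle_right_new hs ht
  | intro_left Γ G₂ G₃ M Δ S A B A' C α β a b hα hβ φ₀ φ φ₁ φ₂ N N' h₀ hN' lN' hφ h₁ h₂ hN =>
    have dφ : IsDiagram [] φ (sequent (Γ ++ G₂ ++ G₃ ++ [A])) := by
      rw [hφ]
      exact (h₀.comp ((isDiagram_cross M G₃).whisk (.L :: fms (Γ ++ G₂)) [.R])).comp
        (hN'.whisk (.L :: fms (Γ ++ G₂ ++ G₃)) [.R]) |>.cast
    have d := (dφ.comp (h₁.whisk (sequent (Γ ++ G₂ ++ G₃ ++ [A])) [])).comp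
      (h₂.whisk (sequent (Γ ++ G₂ ++ G₃ ++ [A]) ++ sequent (B :: Δ)) [])
    have k := sameDen_append (by simp [dφ.ne_nil]) d fun m t hm =>
      den_intro_left hα hβ hN (m := m) (t := t) (by simpa using hm)
    simpa only [List.append_assoc] using k
  | intro_right Γ G₂ G₃ M Δ S A B A' C α β a b hα hβ φ₀ φ φ₁ φ₂ N N' h₀ hN' lN' hφ h₁ h₂ hN =>
    have dφ : IsDiagram [] φ (sequent (A :: (G₂ ++ G₃ ++ Γ))) := by
      rw [hφ]
      have k := (h₀.comp ((isDiagram_cross G₂ M).whisk [.L] (fms (G₃ ++ Γ) ++ [.R]))).comp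
        (hN'.whisk [.L] (fms (G₂ ++ G₃ ++ Γ) ++ [.R]))
      exact k.cast
    have d := (h₁.comp (h₂.whisk (sequent (S ++ [C])) [])).comp
      (dφ.whisk (sequent (S ++ [C]) ++ sequent (Δ ++ [B])) [])
    have k := sameDen_append (by simp [h₁.ne_nil]) d fun m t hm =>
      den_intro_right hα hβ hN (Γ := Γ) (Δ := Δ) (S := S) (m := m) (t := t) (by simpa using hm)
    simpa only [List.append_assoc] using k

theorem SemRule.sameDen {φ ψ : List (Layer Atom)} (h : SemRule φ ψ) : SameDen φ ψ := by
  cases h with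
  | proof h => exact h.sameDen
  | tensor_par A B Γ => exact sameDen_tensor_par A B Γ
  | par_tensor A B Γ => exact sameDen_par_tensor A B Γ
  | ax_left A =>
    refine ⟨by simp, fun s t hs => ?_⟩
    obtain ⟨x, rfl⟩ := List.length_eq_one_iff.1 hs
    clear hs
    rw [den_ax [] [x]]
    -- The cut selects, among all pairs that the axiom offers, the one with `y = x`, so the value
    -- `x` is passed on unchanged.
    have k : ∀ y : Point, Den [⟨[.L, .fm A], .cut A.neg, []⟩] [y, y.neg, x] t ↔
        x = y ∧ t = [y] := fun y => by
      rw [den_cut [y] y.neg x [], Point.neg_neg]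
      simp
    simp [k]
  | ax_right A =>
    refine ⟨by simp, fun s t hs => ?_⟩
    obtain ⟨x, rfl⟩ := List.length_eq_one_iff.1 hs
    clear hs
    rw [den_ax [x] []]
    have k : ∀ y : Point, Den [⟨[], .cut A, [.fm A, .R]⟩] [x, y, y.neg] t ↔
        y = x.neg ∧ t = [y.neg] := fun y => by
      rw [den_cut [] x y [y.neg]]
      simp
    simp [k, Point.neg_neg]
  | bot_one =>
    refine ⟨by simp, fun s t hs => ?_⟩
    obtain rfl := List.length_eq_zero_iff.1 hs
    clear hs
    rw [den_bot [] [], den_one [.leaf] [], den_cut [] .leaf .leaf []]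
    simp [Point.neg]
  | one_bot =>
    refine ⟨by simp, fun s t hs => ?_⟩
    obtain rfl := List.length_eq_zero_iff.1 hs
    clear hs
    rw [den_one [] [], den_bot [.leaf] [], den_cut [] .leaf .leaf []]
    simp [Point.neg]

/-- Equal diagrams have the same denotation. -/
theorem SEq.den_iff {w w' : Word Atom} {φ ψ : List (Layer Atom)} (h : SEq w w' φ ψ)
    {s t : List Point} (hs : s.length = arity w) : Den φ s t ↔ Den ψ s t := by
  obtain ⟨hφ, hψ, h⟩ := h
  have k : ∀ φ ψ : Diagram w w', Related SemRule φ ψ → (Den φ.1 s t ↔ Den ψ.1 s t) := by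
    rintro ⟨φ, hφ⟩ ⟨ψ, hψ⟩ (h | h)
    · obtain ⟨p, q, l, x, r, g, g'⟩ := h
      simpa using (sameDen_interchange x g g').context (l := l) (r := r) (p := p) (q := q)
        (by simpa using hφ) hs
    · obtain ⟨p, q, l, r, φ, ψ, h⟩ := h
      exact h.sameDen.context hφ hs
  exact iff_of_eq (congrArg (Quot.lift (fun φ : Diagram w w' => Den φ.1 s t)
    fun φ ψ h => propext (k φ ψ h)) h)

/-! ## Non-degeneracy -/

/-- On `1 ⅋ ⊥`, the axiom followed by `⅋` yields `node x x.neg` for every tree `x`, while the two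
unit rules followed by `⅋` yield `node leaf leaf` only. No atom is involved, so `Atom` can be empty.
-/
theorem exists_not_seq : ∃ (A : Formula Atom) (d d' : Derivation [A]),
    ¬ SEq [] (sequent [A]) d.diagram d'.diagram := by
  let d : Derivation ([] ++ [Formula.par .one (.bot : Formula Atom)]) :=
    .par .one .bot (.ax .one .bot rfl)
  let d' : Derivation ([] ++ [Formula.par .one (.bot : Formula Atom)]) :=
    .par .one .bot (.bot (Γ := [.one]) .one)
  refine ⟨.par .one .bot, d, d', fun h => ?_⟩
  have k := h.den_iff (s := []) (t := [.node (.node .leaf .leaf) (.node .leaf .leaf)]) rfl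
  simp only [d, d', Derivation.diagram, List.cons_append, List.nil_append] at k
  rw [den_ax [] [], den_one [] [], den_bot [.leaf] [], den_par [] .leaf .leaf []] at k
  simp only [den_nil, List.nil_append, List.cons.injEq, Point.node.injEq, reduceCtorEq,
    false_and, and_false, iff_false, not_exists] at k
  -- The smallest tree other than the leaf; it is its own mirror image.
  refine k (.node .leaf .leaf) ?_
  rw [den_par [] (.node .leaf .leaf) (.node .leaf .leaf) [] (by simp [Point.neg])]
  rfl

end ProofDiagrams

theorem mainTheorem4 (Atom : Type u) :
    (∃! sem : ProofDiagrams.Interpretation Atom, ProofDiagrams.IsDiagramInterpretation sem) ∧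
    ∀ sem : ProofDiagrams.Interpretation Atom, ProofDiagrams.IsDiagramInterpretation sem →
      ProofDiagrams.IsDenotationalSemantics sem := by
  open ProofDiagrams in
  refine ⟨⟨interpretation, isDiagramInterpretation_interpretation, fun _ h => h.eq⟩, ?_⟩
  intro sem hsem
  -- By uniqueness, all properties need to be checked for canonical diagrams only.
  obtain rfl := hsem.eq
  refine ⟨fun Γ d d' h => interpretation_eq_iff.2 h.seq, ?_, ?_, ?_, ?_, ?_, ?_⟩
  · obtain ⟨A, d, d', h⟩ := exists_not_seq (Atom := Atom)
    exact ⟨A, d, d', mt interpretation_eq_iff.1 h⟩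
  · rintro Γ Δ A _ rfl d d' e e' hd he
    rw [interpretation_eq_iff] at hd he ⊢
    simpa [joined, Derivation.diagram] using SEq.joined (.cut A) hd he
  · intro Γ Δ A B d d' e e' hd he
    rw [interpretation_eq_iff] at hd he ⊢
    simpa [joined, Derivation.diagram] using SEq.joined (.tensor A B) hd he
  · intro Γ A B d d' h
    rw [interpretation_eq_iff] at h ⊢
    exact h.append (.refl (by simp [IsDiagram, Gate.src, Gate.tgt, sequent]))
  · intro Γ d d' h
    rw [interpretation_eq_iff] at h ⊢
    exact h.append (.refl (by simp [IsDiagram, Gate.src, Gate.tgt, sequent]))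
  · intro Γ Δ σ d d' h
    rw [interpretation_eq_iff] at h ⊢
    exact h.append (.refl σ.twisting_spec.isDiagram_sequent)
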